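/- For a finite dataset $X\subseteq\mathbb{R}^d$ and a finite nonempty set $C\subseteq\mathbb{R}^d$ of centers let $\Phi(C,X)=\sum_{x\in X}\min_{c\in C}\|x-c\|^2$, and let $\Delta_k(X)$ be the infimum of $\Phi(C,X)$ over all sets $C\subseteq\mathbb{R}^d$ of $k$ points (the optimal value of the $k$-means objective). An optimal clustering of $X$ is obtained from a set $C$ of $k$ points with $\Phi(C,X)=\Delta_k(X)$ by assigning every $x\in X$ to a closest center in $C$, ties being broken arbitrarily. In the semi-supervised active clustering (SSAC) model an algorithm may adaptively ask, for two points of $X$, whether they belong to the same cluster of a fixed optimal clustering of $X$ that is not known to it, and a perfect same-cluster oracle answers every such query correctly. Algorithms are programs for a real RAM: each arithmetic operation on or comparison of real numbers, each memory access, each addition, subtraction or comparison of natural numbers used as counters and addresses, each drawing of an independent uniformly random real from $[0,1]$, and each query takes unit time; there is no rounding of real numbers to integers. **Theorem.** There are a single randomized query algorithm $A$ and a constant $c$ such that the following holds for all integers $d,k\ge 1$, every real $0<\varepsilon\le 1/2$, every nonempty finite set $X\subseteq\mathbb{R}^d$ with $n$ points, listed in any order, and every optimal clustering of $X$ (for $k$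 clusters) that determines the answers of the perfect same-cluster oracle. On the input $n,d,k,\varepsilon,X$, for every outcome of the random choices, the algorithm $A$ halts after at most $c\cdot ndk^9/\varepsilon^4$ steps, asks at most $c\cdot k^9/\varepsilon^4$ same-cluster queries, and outputs a nonempty set $C\subseteq\mathbb{R}^d$ of at most $k$ centers. With probability at least $0.99$ the output satisfies $$\Phi(C,X)\le(1+\varepsilon)\,\Delta_k(X).$$ -/

import Mathlib

open MeasureTheory

/-! ## The `k`-means problem -/

namespace KMeans

/-- The `k`-means cost `Φ(C, X) = ∑_{x ∈ X} min_{c ∈ C} ‖x - c‖²` of a nonempty finite set `C`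
of centers on a dataset `X`. -/
noncomputable def cost {d : ℕ} (C X : Finset (EuclideanSpace ℝ (Fin d))) : ℝ :=
  ∑ x ∈ X, ⨅ c : C, ‖x - (c : EuclideanSpace ℝ (Fin d))‖ ^ 2

/-- The optimal value `Δ_k(X)` of the `k`-means objective: the infimum of the costs of all sets of
`k` centers. -/
noncomputable def optCost {d : ℕ} (k : ℕ) (X : Finset (EuclideanSpace ℝ (Fin d))) : ℝ :=
  sInf {r : ℝ | ∃ C : Finset (EuclideanSpace ℝ (Fin d)), C.card = k ∧ r = cost C X}

/-- `cl` describes an optimal clustering of `X`: for some optimal set of `k` centers, every point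
`x` of `X` is assigned to a closest center `cl x` (ties are broken in an arbitrary way). The
clusters are the sets of points of `X` with the same value of `cl`. -/
def IsOptimalClustering {d : ℕ} (k : ℕ) (X : Finset (EuclideanSpace ℝ (Fin d)))
    (cl : EuclideanSpace ℝ (Fin d) → EuclideanSpace ℝ (Fin d)) : Prop :=
  ∃ C : Finset (EuclideanSpace ℝ (Fin d)),
    C.card = k ∧ cost C X = optCost k X ∧
      ∀ x ∈ X, cl x ∈ C ∧ ∀ c ∈ C, ‖x - cl x‖ ≤ ‖x - c‖

end KMeans

/-! ## A randomized real RAM with a pairwise query oracle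

A program is a finite text in a small imperative language. The machine has registers and arrays
of natural numbers (for counters and addresses) and registers and arrays of real numbers. Every
elementary operation costs one unit of time: a constant, a memory access, an addition or
subtraction of natural numbers, a field operation or a comparison of real numbers, an assignment,
a branch, the drawing of one uniformly random real from `[0,1]`, and one oracle query. There
is no rounding of reals to integers and no multiplication of natural numbers, and the only
constants in a program are natural and rational numbers. -/

namespace RealRAM

/-- The configuration of the machine, with the counters `time`, `queries`, `draws` of the time
used, the oracle queries asked and the random numbers drawn so far; programs cannot read the
counters. -/
structure State where
  natReg : ℕ → ℕ
  natArr : ℕ → ℕ → ℕ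
  realReg : ℕ → ℝ
  realArr : ℕ → ℕ → ℝ
  time : ℕ
  queries : ℕ
  draws : ℕ

/-- Expressions with values in `ℕ`; `sub` is truncated subtraction and `load a i` is the entry
`i` of the array `a`. -/
inductive NatExpr where
  | const (m : ℕ)
  | reg (r : ℕ)
  | load (a : ℕ) (i : NatExpr)
  | add (x y : NatExpr)
  | sub (x y : NatExpr)

/-- The value of an expression. -/
def NatExpr.val (s : State) : NatExpr → ℕ
  | const m => m
  | reg r => s.natReg r
  | load a i => s.natArr a (i.val s)
  | add x y => x.val s + y.val s
  | sub x y => x.val s - y.val s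

/-- The number of operations in an expression. -/
def NatExpr.size : NatExpr → ℕ
  | const _ => 1
  | reg _ => 1
  | load _ i => i.size + 1
  | add x y => x.size + y.size + 1
  | sub x y => x.size + y.size + 1

/-- Expressions with values in `ℝ`; division by zero gives zero. -/
inductive RealExpr where
  | const (q : ℚ)
  | reg (r : ℕ)
  | load (a : ℕ) (i : NatExpr)
  | ofNat (i : NatExpr)
  | add (x y : RealExpr)
  | sub (x y : RealExpr)
  | mul (x y : RealExpr)
  | div (x y : RealExpr)

/-- The value of an expression. -/
noncomputable def RealExpr.val (s : State) : RealExpr → ℝ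
  | const q => (q : ℝ)
  | reg r => s.realReg r
  | load a i => s.realArr a (i.val s)
  | ofNat i => (i.val s : ℝ)
  | add x y => x.val s + y.val s
  | sub x y => x.val s - y.val s
  | mul x y => x.val s * y.val s
  | div x y => x.val s / y.val s

/-- The number of operations in an expression. -/
def RealExpr.size : RealExpr → ℕ
  | const _ => 1
  | reg _ => 1
  | load _ i => i.size + 1
  | ofNat i => i.size + 1
  | add x y => x.size + y.size + 1
  | sub x y => x.size + y.size + 1
  | mul x y => x.size + y.size + 1
  | div x y => x.size + y.size + 1

/-- Conditions for branches and loops. -/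
inductive Test where
  | natLt (x y : NatExpr)
  | realLt (x y : RealExpr)
  | not (t : Test)
  | and (t u : Test)

/-- The condition `t` holds in the state `s`. -/
def Test.Holds (s : State) : Test → Prop
  | natLt x y => x.val s < y.val s
  | realLt x y => x.val s < y.val s
  | not t => ¬ t.Holds s
  | and t u => t.Holds s ∧ u.Holds s

/-- The number of operations in a condition. -/
def Test.size : Test → ℕ
  | natLt x y => x.size + y.size + 1
  | realLt x y => x.size + y.size + 1
  | not t => t.size + 1
  | and t u => t.size + u.size + 1

/-- Programs. `draw r` puts a fresh random number into the real register `r`, and `query r x y`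
puts the answer (`1` or `0`) of the oracle for the pair `(x, y)` into the natural register `r`. -/
inductive Program where
  | skip
  | setNat (r : ℕ) (x : NatExpr)
  | storeNat (a : ℕ) (i x : NatExpr)
  | setReal (r : ℕ) (x : RealExpr)
  | storeReal (a : ℕ) (i : NatExpr) (x : RealExpr)
  | draw (r : ℕ)
  | query (r : ℕ) (x y : NatExpr)
  | seq (A B : Program)
  | ite (t : Test) (A B : Program)
  | while (t : Test) (A : Program)

/-- Let `m` units of time pass. -/
def State.tick (m : ℕ) (s : State) : State := { s with time := s.time + m }

open Classical in
/-- `Runs ω oracle A s s'`: the program `A`, started in the state `s`, halts in the state `s'`,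
when the successive random numbers are `ω 0, ω 1, …` and a query for the pair `(i, j)` is answered
positively exactly if `oracle i j` holds. -/
inductive Runs (ω : ℕ → unitInterval) (oracle : ℕ → ℕ → Prop) : Program → State → State → Prop
  | skip (s : State) : Runs ω oracle .skip s (s.tick 1)
  | setNat (r : ℕ) (x : NatExpr) (s : State) :
      Runs ω oracle (.setNat r x) s
        (State.tick (x.size + 1) { s with natReg := Function.update s.natReg r (x.val s) })
  | storeNat (a : ℕ) (i x : NatExpr) (s : State) :
      Runs ω oracle (.storeNat a i x) s
        (State.tick (i.size + x.size + 1) { s with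
          natArr := Function.update s.natArr a
            (Function.update (s.natArr a) (i.val s) (x.val s)) })
  | setReal (r : ℕ) (x : RealExpr) (s : State) :
      Runs ω oracle (.setReal r x) s
        (State.tick (x.size + 1) { s with realReg := Function.update s.realReg r (x.val s) })
  | storeReal (a : ℕ) (i : NatExpr) (x : RealExpr) (s : State) :
      Runs ω oracle (.storeReal a i x) s
        (State.tick (i.size + x.size + 1) { s with
          realArr := Function.update s.realArr a
            (Function.update (s.realArr a) (i.val s) (x.val s)) })
  | draw (r : ℕ) (s : State) :
      Runs ω oracle (.draw r) s
        (State.tick 1 { s with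
          realReg := Function.update s.realReg r (ω s.draws : ℝ), draws := s.draws + 1 })
  | query (r : ℕ) (x y : NatExpr) (s : State) :
      Runs ω oracle (.query r x y) s
        (State.tick (x.size + y.size + 1) { s with
          natReg := Function.update s.natReg r (if oracle (x.val s) (y.val s) then 1 else 0),
          queries := s.queries + 1 })
  | seq {A B : Program} {s s₁ s₂ : State} :
      Runs ω oracle A s s₁ → Runs ω oracle B s₁ s₂ → Runs ω oracle (.seq A B) s s₂
  | ite_true {t : Test} {A B : Program} {s s₁ : State} :
      t.Holds s → Runs ω oracle A (s.tick (t.size + 1)) s₁ → Runs ω oracle (.ite t A B) s s₁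
  | ite_false {t : Test} {A B : Program} {s s₁ : State} :
      ¬ t.Holds s → Runs ω oracle B (s.tick (t.size + 1)) s₁ → Runs ω oracle (.ite t A B) s s₁
  | while_false {t : Test} {A : Program} {s : State} :
      ¬ t.Holds s → Runs ω oracle (.while t A) s (s.tick (t.size + 1))
  | while_true {t : Test} {A : Program} {s s₁ s₂ : State} :
      t.Holds s → Runs ω oracle A (s.tick (t.size + 1)) s₁ → Runs ω oracle (.while t A) s₁ s₂ →
        Runs ω oracle (.while t A) s s₂

/-- The law of the random numbers: independent and uniform on `[0,1]`. -/
noncomputable def randomTape : Measure (ℕ → unitInterval) :=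
  Measure.infinitePi fun _ : ℕ => (volume : Measure unitInterval)

end RealRAM

/-! ## Query algorithms for `k`-means: input, same-cluster oracle, output -/

namespace KMeans

/-- The input: the natural registers `0, 1, 2` hold `n, d, k`, the real register `0` holds `ε`,
and the real array `0` holds the coordinates of the `n` points, point after point; all other
memory is zero. -/
noncomputable def start {n d : ℕ} (p : Fin n → EuclideanSpace ℝ (Fin d)) (k : ℕ) (ε : ℝ) :
    RealRAM.State where
  natReg r := if r = 0 then n else if r = 1 then d else if r = 2 then k else 0
  natArr _ _ := 0
  realReg r := if r = 0 then ε else 0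
  realArr a t :=
    if h : a = 0 ∧ t < d * n then
      p ⟨t / d, Nat.div_lt_of_lt_mul h.2⟩
        ⟨t % d, Nat.mod_lt t (Nat.pos_of_mul_pos_right (Nat.zero_lt_of_lt h.2))⟩
    else 0
  time := 0
  queries := 0
  draws := 0

/-- The perfect same-cluster oracle for the clustering `cl`: do the `i`-th and the `j`-th input
point belong to the same cluster? (Numbers that do not name an input point get the answer no.) -/
def sameCluster {n d : ℕ} (p : Fin n → EuclideanSpace ℝ (Fin d))
    (cl : EuclideanSpace ℝ (Fin d) → EuclideanSpace ℝ (Fin d)) (i j : ℕ) : Prop :=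
  ∃ (hi : i < n) (hj : j < n), cl (p ⟨i, hi⟩) = cl (p ⟨j, hj⟩)

open Classical in
/-- The output: the set of the `k` centers (repetitions allowed) whose coordinates stand, center
after center, in the real array `1`. -/
noncomputable def output (d k : ℕ) (s : RealRAM.State) : Finset (EuclideanSpace ℝ (Fin d)) :=
  Finset.univ.image fun i : Fin k =>
    WithLp.toLp 2 fun j : Fin d => s.realArr 1 ((i : ℕ) * d + j)

end KMeans

/-!
The algorithm has two phases. The first one draws `1600 k²` seeds by `D²`-sampling, where every
seed is chosen with probability proportional to its squared distance to the earlier seeds. The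
second one draws about `k⁵ / ε²` independent samples according to the importances (`weight`): the
importance of a point is its share of the cost of the seeds plus the reciprocal of the size of its
cell, that is, of the set of points nearest to the same seed. At most `k` queries per sample, to one
representative for each cluster met so far, tell to which cluster of the hidden clustering the
sample belongs. The output consists of the weighted means of the samples of each cluster, with the
reciprocals of the importances as weights.

*Seeding.* Call a cluster bad if the seeds cost more than 16 times its optimal cost on it. As long
as the seeds are not a 32-approximation, the bad clusters carry half of the cost, and a point of a
bad cluster chosen by `D²`-sampling repairs its cluster with probability at least `1 / 2`
(`IsCentroidal.clusterCost_le_two_mul`). So the expected number of bad clusters shrinks by the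
factor `1 - 1 / (4 k)` in each round, and the seeds are a 32-approximation with probability at least
`1 - 4 k² / K` after `K` rounds (`IsCentroidal.expect_seedCost_le`).

*Clusters that are hard to sample.* If a point of a cluster of `M` points has importance less than
`γ / M`, then it is close to its seed, and the cell of this seed has more than `M / γ` points, which
belong to at most `k` clusters. Hence the cell has many points of a cluster that is at least four
times as large and whose center is close to the seed, and optimality moves the center of the small
cluster close to the center of the large one (`IsCentroidal.exists_larger`). Repeating this leads to
a large cluster without points of small importance, at a total cost bounded by a geometric series
(`IsCentroidal.exists_isSampled`). So it suffices to estimate the centers of the clusters without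
points of small importance (`IsCentroidal.exists_assignment`); no decision about which clusters
these are is needed, because further centers in the output do no harm.

*Estimates.* For such a cluster the weights are bounded by `M / γ`. Chebyshev's inequality keeps the
total weight of its samples above half of its expectation, and Markov's inequality for the sum of
the squared errors of the weighted sums bounds the total cost of the estimates
(`IsCentroidal.expect_estimate_le`).

*Probability.* The event that the sampled points are a given list is a box in the space of random
tapes, so probabilities are finite iterated sums (`expect`, `randomTape_process_le`), and both
phases combine to a failure probability of at most `1 / 100`
(`IsCentroidal.randomTape_not_succeeds_le`).

*The program.* The steps of the real RAM program are verified with a program logic whose assertions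
include the running time and the number of queries. Its main rules are `WP.forUpTo` for counting
loops and `WP.frame` for everything that a program leaves untouched. The result, `clusterCode_spec`,
expresses the output by the functions `seeds`, `weight` and `samples` of the random tape, which are
the objects of the analysis.
-/

namespace RealRAM

/-! ### Program logic for the real RAM -/

/-- The program `A`, started in `s`, halts in a state with the property `Q`. -/
def WP (ω : ℕ → unitInterval) (O : ℕ → ℕ → Prop) (A : Program) (Q : State → Prop) (s : State) :
    Prop :=
  ∃ s', Runs ω O A s s' ∧ Q s'

section Rules

variable {ω : ℕ → unitInterval} {O : ℕ → ℕ → Prop} {A B : Program} {Q Q' : State → Prop}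
  {s s' : State}

theorem Runs.deterministic (h : Runs ω O A s s') : ∀ {s''}, Runs ω O A s s'' → s' = s'' := by
  induction h with
  | skip | setNat | storeNat | setReal | storeReal | draw | query =>
    intro s'' h; cases h; rfl
  | seq _ _ ihA ihB => intro s'' h; cases h with | seq hA hB => cases ihA hA; exact ihB hB
  | ite_true ht _ ih =>
    intro s'' h; cases h with
    | ite_true _ hA => exact ih hA
    | ite_false hf _ => exact absurd ht hf
  | ite_false hf _ ih =>
    intro s'' h; cases h with
    | ite_true ht _ => exact absurd ht hf
    | ite_false _ hB => exact ih hB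
  | while_false hf =>
    intro s'' h; cases h with
    | while_false => rfl
    | while_true ht _ _ => exact absurd ht hf
  | while_true ht _ _ ihA ihW =>
    intro s'' h; cases h with
    | while_false hf => exact absurd ht hf
    | while_true _ hA hW => cases ihA hA; exact ihW hW

theorem WP.mono (h : WP ω O A Q s) (hQ : ∀ s', Q s' → Q' s') : WP ω O A Q' s :=
  h.imp fun _ h => ⟨h.1, hQ _ h.2⟩

theorem wp_skip : WP ω O .skip Q s ↔ Q (s.tick 1) :=
  ⟨fun ⟨_, h, q⟩ => by cases h; exact q, fun h => ⟨_, .skip _, h⟩⟩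

theorem wp_setNat {r x} : WP ω O (.setNat r x) Q s ↔
    Q (State.tick (x.size + 1) { s with natReg := Function.update s.natReg r (x.val s) }) :=
  ⟨fun ⟨_, h, q⟩ => by cases h; exact q, fun h => ⟨_, .setNat .., h⟩⟩

theorem wp_storeNat {a i x} : WP ω O (.storeNat a i x) Q s ↔
    Q (State.tick (i.size + x.size + 1) { s with
      natArr := Function.update s.natArr a
        (Function.update (s.natArr a) (i.val s) (x.val s)) }) :=
  ⟨fun ⟨_, h, q⟩ => by cases h; exact q, fun h => ⟨_, .storeNat .., h⟩⟩

theorem wp_setReal {r x} : WP ω O (.setReal r x) Q s ↔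
    Q (State.tick (x.size + 1) { s with realReg := Function.update s.realReg r (x.val s) }) :=
  ⟨fun ⟨_, h, q⟩ => by cases h; exact q, fun h => ⟨_, .setReal .., h⟩⟩

theorem wp_storeReal {a i x} : WP ω O (.storeReal a i x) Q s ↔
    Q (State.tick (i.size + x.size + 1) { s with
      realArr := Function.update s.realArr a
        (Function.update (s.realArr a) (i.val s) (x.val s)) }) :=
  ⟨fun ⟨_, h, q⟩ => by cases h; exact q, fun h => ⟨_, .storeReal .., h⟩⟩

theorem wp_draw {r} : WP ω O (.draw r) Q s ↔
    Q (State.tick 1 { s with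
      realReg := Function.update s.realReg r (ω s.draws : ℝ), draws := s.draws + 1 }) :=
  ⟨fun ⟨_, h, q⟩ => by cases h; exact q, fun h => ⟨_, .draw .., h⟩⟩

open Classical in
theorem wp_query {r x y} : WP ω O (.query r x y) Q s ↔
    Q (State.tick (x.size + y.size + 1) { s with
      natReg := Function.update s.natReg r (if O (x.val s) (y.val s) then 1 else 0),
      queries := s.queries + 1 }) :=
  ⟨fun ⟨_, h, q⟩ => by cases h; exact q, fun h => ⟨_, .query .., h⟩⟩

theorem wp_seq : WP ω O (.seq A B) Q s ↔ WP ω O A (WP ω O B Q) s :=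
  ⟨fun ⟨_, h, q⟩ => by cases h with | seq hA hB => exact ⟨_, hA, _, hB, q⟩,
    fun ⟨_, hA, _, hB, q⟩ => ⟨_, .seq hA hB, q⟩⟩

theorem wp_ite {t} : WP ω O (.ite t A B) Q s ↔
    (t.Holds s → WP ω O A Q (s.tick (t.size + 1))) ∧
      (¬ t.Holds s → WP ω O B Q (s.tick (t.size + 1))) := by
  constructor
  · rintro ⟨_, h, q⟩
    cases h with
    | ite_true ht hA => exact ⟨fun _ => ⟨_, hA, q⟩, fun hf => absurd ht hf⟩
    | ite_false hf hB => exact ⟨fun ht => absurd ht hf, fun _ => ⟨_, hB, q⟩⟩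
  · rintro ⟨h₁, h₂⟩
    by_cases ht : t.Holds s
    · obtain ⟨_, hA, q⟩ := h₁ ht
      exact ⟨_, .ite_true ht hA, q⟩
    · obtain ⟨_, hB, q⟩ := h₂ ht
      exact ⟨_, .ite_false ht hB, q⟩

end Rules

/-- The natural registers that a program writes. -/
def Program.natRegs : Program → List ℕ
  | setNat r _ | query r _ _ => [r]
  | seq A B | ite _ A B => A.natRegs ++ B.natRegs
  | .while _ A => A.natRegs
  | _ => []

/-- The arrays of natural numbers that a program writes. -/
def Program.natArrs : Program → List ℕ
  | storeNat a _ _ => [a]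
  | seq A B | ite _ A B => A.natArrs ++ B.natArrs
  | .while _ A => A.natArrs
  | _ => []

/-- The real registers that a program writes. -/
def Program.realRegs : Program → List ℕ
  | setReal r _ | draw r => [r]
  | seq A B | ite _ A B => A.realRegs ++ B.realRegs
  | .while _ A => A.realRegs
  | _ => []

/-- The arrays of real numbers that a program writes. -/
def Program.realArrs : Program → List ℕ
  | storeReal a _ _ => [a]
  | seq A B | ite _ A B => A.realArrs ++ B.realArrs
  | .while _ A => A.realArrs
  | _ => []

/-- Does the text of the program contain no `draw`? -/
def Program.drawFree : Program → Bool
  | draw _ => false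
  | seq A B | ite _ A B => A.drawFree && B.drawFree
  | .while _ A => A.drawFree
  | _ => true

/-- Does the text of the program contain no `query`? -/
def Program.queryFree : Program → Bool
  | query _ _ _ => false
  | seq A B | ite _ A B => A.queryFree && B.queryFree
  | .while _ A => A.queryFree
  | _ => true

/-- The states `s` and `s'` agree on everything that `A` cannot write. -/
structure Frame (A : Program) (s s' : State) : Prop where
  natReg : ∀ r, r ∉ A.natRegs → s'.natReg r = s.natReg r
  natArr : ∀ a, a ∉ A.natArrs → s'.natArr a = s.natArr a
  realReg : ∀ r, r ∉ A.realRegs → s'.realReg r = s.realReg r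
  realArr : ∀ a, a ∉ A.realArrs → s'.realArr a = s.realArr a
  draws : A.drawFree = true → s'.draws = s.draws
  queries : A.queryFree = true → s'.queries = s.queries

theorem Frame.trans {A : Program} {s₁ s₂ s₃ : State} (h : Frame A s₁ s₂) (h' : Frame A s₂ s₃) :
    Frame A s₁ s₃ where
  natReg r hr := (h'.natReg r hr).trans (h.natReg r hr)
  natArr r hr := (h'.natArr r hr).trans (h.natArr r hr)
  realReg r hr := (h'.realReg r hr).trans (h.realReg r hr)
  realArr r hr := (h'.realArr r hr).trans (h.realArr r hr)
  draws hr := (h'.draws hr).trans (h.draws hr)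
  queries hr := (h'.queries hr).trans (h.queries hr)

theorem Frame.mono {A B : Program} {s s' : State} (h : Frame A s s')
    (h₁ : ∀ r ∈ A.natRegs, r ∈ B.natRegs) (h₂ : ∀ r ∈ A.natArrs, r ∈ B.natArrs)
    (h₃ : ∀ r ∈ A.realRegs, r ∈ B.realRegs) (h₄ : ∀ r ∈ A.realArrs, r ∈ B.realArrs)
    (h₅ : B.drawFree = true → A.drawFree = true)
    (h₆ : B.queryFree = true → A.queryFree = true) : Frame B s s' where
  natReg r hr := h.natReg r fun hA => hr (h₁ r hA)
  natArr r hr := h.natArr r fun hA => hr (h₂ r hA)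
  realReg r hr := h.realReg r fun hA => hr (h₃ r hA)
  realArr r hr := h.realArr r fun hA => hr (h₄ r hA)
  draws hr := h.draws (h₅ hr)
  queries hr := h.queries (h₆ hr)

theorem Frame.of_tick {A : Program} {s s' : State} {m : ℕ} (h : Frame A (s.tick m) s') :
    Frame A s s' :=
  ⟨h.natReg, h.natArr, h.realReg, h.realArr, h.draws, h.queries⟩

/-- A run changes nothing but what the text of the program can write. -/
theorem Runs.frame {ω : ℕ → unitInterval} {O : ℕ → ℕ → Prop} {A : Program} {s s' : State}
    (h : Runs ω O A s s') : Frame A s s' := by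
  induction h with
  | skip => exact ⟨fun _ _ => rfl, fun _ _ => rfl, fun _ _ => rfl, fun _ _ => rfl,
      fun _ => rfl, fun _ => rfl⟩
  | setNat | storeNat | setReal | storeReal | draw | query =>
    constructor <;>
      simp +contextual [Program.natRegs, Program.natArrs, Program.realRegs, Program.realArrs,
        Program.drawFree, Program.queryFree, State.tick]
  | seq _ _ ihA ihB =>
    refine (ihA.mono ?_ ?_ ?_ ?_ ?_ ?_).trans (ihB.mono ?_ ?_ ?_ ?_ ?_ ?_) <;>
      simp +contextual [Program.natRegs, Program.natArrs, Program.realRegs, Program.realArrs,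
        Program.drawFree, Program.queryFree]
  | ite_true _ _ ih =>
    refine ih.of_tick.mono ?_ ?_ ?_ ?_ ?_ ?_ <;>
      simp +contextual [Program.natRegs, Program.natArrs, Program.realRegs, Program.realArrs,
        Program.drawFree, Program.queryFree]
  | ite_false _ _ ih =>
    refine ih.of_tick.mono ?_ ?_ ?_ ?_ ?_ ?_ <;>
      simp +contextual [Program.natRegs, Program.natArrs, Program.realRegs, Program.realArrs,
        Program.drawFree, Program.queryFree]
  | while_false => exact ⟨fun _ _ => rfl, fun _ _ => rfl, fun _ _ => rfl, fun _ _ => rfl,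
      fun _ => rfl, fun _ => rfl⟩
  | while_true _ _ _ ihA ihW =>
    refine Frame.trans (ihA.of_tick.mono ?_ ?_ ?_ ?_ ?_ ?_) ihW <;>
      simp [Program.natRegs, Program.natArrs, Program.realRegs, Program.realArrs,
        Program.drawFree, Program.queryFree]

/-- The frame rule: an assertion may be combined with all facts about untouched registers, arrays and
counters. -/
theorem WP.frame {ω : ℕ → unitInterval} {O : ℕ → ℕ → Prop} {A : Program} {Q Q' : State → Prop}
    {s : State} (h : WP ω O A Q s) (hQ : ∀ s', Frame A s s' → Q s' → Q' s') : WP ω O A Q' s :=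
  h.imp fun _ h => ⟨h.1, hQ _ h.1.frame h.2⟩

/-- The loop `for r = 0, …, b - 1 do body`, where `b` is the content of the register `b`. -/
def Program.forUpTo (r b : ℕ) (body : Program) : Program :=
  .seq (.setNat r (.const 0))
    (.while (.natLt (.reg r) (.reg b)) (.seq body (.setNat r (.add (.reg r) (.const 1)))))

/-- The rule for counting loops: `I i` is the invariant after `i` rounds, and every round takes at
most `T` units of time and at most `q` queries. -/
theorem WP.forUpTo {ω : ℕ → unitInterval} {O : ℕ → ℕ → Prop} {r b : ℕ} {body : Program} {s : State}
    (I : ℕ → State → Prop) (m T q : ℕ) (hm : s.natReg b = m)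
    (hr : r ∉ body.natRegs) (hb : b ∉ body.natRegs) (hrb : b ≠ r)
    (hI : ∀ i s v t, I i s → I i { s with natReg := Function.update s.natReg r v, time := t })
    (h0 : I 0 s)
    (step : ∀ i s₁, i < m → s₁.natReg r = i → I i s₁ → Frame (.forUpTo r b body) s s₁ →
      WP ω O body (fun s₂ => I (i + 1) s₂ ∧ s₂.time ≤ s₁.time + T ∧
        s₂.queries ≤ s₁.queries + q) s₁) :
    WP ω O (.forUpTo r b body) (fun s' => I m s' ∧ s'.time ≤ s.time + m * (T + 8) + 6 ∧
      s'.queries ≤ s.queries + m * q) s := by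
  have loop : ∀ j i s₁, i + j = m → s₁.natReg r = i → I i s₁ → Frame (.forUpTo r b body) s s₁ →
      WP ω O (.while (.natLt (.reg r) (.reg b))
        (.seq body (.setNat r (.add (.reg r) (.const 1)))))
        (fun s' => I m s' ∧ s'.time ≤ s₁.time + j * (T + 8) + 4 ∧
          s'.queries ≤ s₁.queries + j * q) s₁ := by
    intro j
    induction j with
    | zero =>
      intro i s₁ hij hi hIi hF
      have hbm : s₁.natReg b = m := by
        rw [hF.natReg b (by simp [Program.forUpTo, Program.natRegs, hb, hrb]), hm]
      refine ⟨_, .while_false ?_, ?_, ?_, ?_⟩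
      · simp [Test.Holds, NatExpr.val, hi, hbm]; omega
      · have := hI i s₁ (s₁.natReg r) (s₁.time + 4) hIi
        rw [Function.update_eq_self] at this
        rw [add_zero] at hij
        subst hij
        exact this
      · simp [State.tick, Test.size, NatExpr.size]
      · simp [State.tick]
    | succ j ih =>
      intro i s₁ hij hi hIi hF
      have hbm : s₁.natReg b = m := by
        rw [hF.natReg b (by simp [Program.forUpTo, Program.natRegs, hb, hrb]), hm]
      have hI' : I i (s₁.tick 4) := by
        have := hI i s₁ (s₁.natReg r) (s₁.time + 4) hIi
        rwa [Function.update_eq_self] at this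
      have hF' : Frame (.forUpTo r b body) s (s₁.tick 4) :=
        ⟨hF.natReg, hF.natArr, hF.realReg, hF.realArr, hF.draws, hF.queries⟩
      obtain ⟨s₂, hrun, hI₂, ht₂, hq₂⟩ := step i (s₁.tick 4) (by omega) hi hI' hF'
      have hF₂ : Frame (.forUpTo r b body) s s₂ := by
        refine hF'.trans (hrun.frame.mono ?_ ?_ ?_ ?_ ?_ ?_) <;>
        simp +contextual [Program.forUpTo, Program.natRegs, Program.natArrs, Program.realRegs,
          Program.realArrs, Program.drawFree, Program.queryFree]
      have hr₂ : s₂.natReg r = i := (hrun.frame.natReg r hr).trans hi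
      obtain ⟨s₃, hW, hI₃, ht₃, hq₃⟩ := ih (i + 1)
        (State.tick 4 { s₂ with natReg := Function.update s₂.natReg r (s₂.natReg r + 1) })
        (by omega) (by simp [State.tick, hr₂]) (hI _ _ _ _ hI₂)
        (hF₂.trans (by
          constructor <;> simp +contextual [Program.forUpTo, Program.natRegs, State.tick]))
      refine ⟨s₃, .while_true ?_ (.seq hrun (.setNat _ _ _)) hW, hI₃, ?_, ?_⟩
      · simp [Test.Holds, NatExpr.val, hi, hbm]; omega
      · simp only [State.tick] at ht₂ ht₃
        rw [add_mul]; omega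
      · simp only [State.tick] at hq₂ hq₃
        rw [add_mul]; omega
  rw [Program.forUpTo, wp_seq, wp_setNat]
  refine (loop m 0 _ (by omega) (by simp [NatExpr.val]) (hI _ _ _ _ h0) ?_).mono ?_
  · constructor <;> simp +contextual [Program.forUpTo, Program.natRegs]
  · rintro s' ⟨h₁, h₂, h₃⟩
    refine ⟨h₁, ?_, h₃⟩
    simp only [NatExpr.size] at h₂
    omega

end RealRAM

namespace KMeans

open RealRAM Program

/-! ### The algorithm -/

/-- The last index `i < n` with `w 0 + ⋯ + w (i - 1) ≤ θ`. -/
noncomputable def pick (w : ℕ → ℝ) : ℕ → ℝ → ℕ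
  | 0, _ => 0
  | i + 1, θ => if θ < ∑ j ∈ Finset.range i, w j then pick w i θ else i

/-- The index below `n` that the random number `u` selects, with probabilities proportional to the
weights `w`. -/
noncomputable def sampleIdx (w : ℕ → ℝ) (n : ℕ) (u : ℝ) : ℕ :=
  pick w n (u * ∑ i ∈ Finset.range n, w i)

theorem pick_lt (w : ℕ → ℝ) {n : ℕ} (hn : 0 < n) (θ : ℝ) : pick w n θ < n := by
  induction n with
  | zero => omega
  | succ n ih =>
    rw [pick]
    split_ifs with h
    · rcases Nat.eq_zero_or_pos n with rfl | hn'
      · simp [pick]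
      · exact (ih hn').trans (Nat.lt_succ_self n)
    · exact Nat.lt_succ_self n

theorem pick_congr {w w' : ℕ → ℝ} {n : ℕ} (h : ∀ i < n, w i = w' i) (θ : ℝ) :
    pick w n θ = pick w' n θ := by
  induction n with
  | zero => rfl
  | succ n ih =>
    rw [pick, pick, ih fun i hi => h i (by omega),
      Finset.sum_congr rfl fun i hi => h i (by have := Finset.mem_range.1 hi; omega)]

theorem sampleIdx_congr {w w' : ℕ → ℝ} {n : ℕ} (h : ∀ i < n, w i = w' i) (u : ℝ) :
    sampleIdx w n u = sampleIdx w' n u := by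
  rw [sampleIdx, sampleIdx, pick_congr h, Finset.sum_congr rfl fun i hi => h i
    (Finset.mem_range.1 hi)]

/-- The smallest squared distance of the point `i` to a point of the list, newest point first. For
the empty list the value is `0`. -/
noncomputable def minDist (D : ℕ → ℕ → ℝ) : List ℕ → ℕ → ℝ
  | [], _ => 0
  | m :: L, i => if L.length < 1 ∨ D i m < minDist D L i then D i m else minDist D L i

/-- The position, counted from the oldest point of the list, of a point of the list closest to the
point `i`. -/
noncomputable def nearest (D : ℕ → ℕ → ℝ) : List ℕ → ℕ → ℕ
  | [], _ => 0
  | m :: L, i => if L.length < 1 ∨ D i m < minDist D L i then L.length else nearest D L i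

/-- The points chosen by `T` rounds of `D²`-sampling, newest point first. In the first round all
weights are zero, so that the choice does not depend on the random number. -/
noncomputable def seeds (D : ℕ → ℕ → ℝ) (n : ℕ) (ω : ℕ → unitInterval) : ℕ → List ℕ
  | 0 => []
  | T + 1 => sampleIdx (minDist D (seeds D n ω T)) n (ω T) :: seeds D n ω T

/-- The number of points below `n` in the cell `t` of the list `L`. -/
noncomputable def cellSize (D : ℕ → ℕ → ℝ) (n : ℕ) (L : List ℕ) (t : ℕ) : ℕ :=
  {i ∈ Finset.range n | nearest D L i = t}.card

/-- The importance of the point `i` with respect to the centers `L`: its share of the cost plus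
the reciprocal of the size of its cell. If the cost is zero, the first summand is zero, both here and
on the machine, by the convention for division by zero. -/
noncomputable def weight (D : ℕ → ℕ → ℝ) (n : ℕ) (L : List ℕ) (i : ℕ) : ℝ :=
  minDist D L i / (∑ j ∈ Finset.range n, minDist D L j) + 1 / (cellSize D n L (nearest D L i) : ℝ)

/-- `T` independent samples with probabilities proportional to `v`, newest sample first; the first
sample uses the random number `ω K`. -/
noncomputable def samples (v : ℕ → ℝ) (n : ℕ) (ω : ℕ → unitInterval) (K : ℕ) : ℕ → List ℕ
  | 0 => []
  | T + 1 => sampleIdx v n (ω (K + T)) :: samples v n ω K T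

theorem length_seeds (D : ℕ → ℕ → ℝ) (n : ℕ) (ω : ℕ → unitInterval) (T : ℕ) :
    (seeds D n ω T).length = T := by
  induction T with
  | zero => rfl
  | succ T ih => simp [seeds, ih]

/-! The programs below use the following registers and arrays.
* Natural registers: `0, 1, 2` hold `n, d, k`; `3, 4` the numbers of seeds and of samples;
  `5, 6, 8, 11` are loop counters; `7` is the index of the sampled point; `9` the number of
  clusters met so far; `10` the number of the cluster of the sampled point; `12` an answer of the
  oracle; `13` a running address.
* Real registers: `0` holds `ε`; `1` a bound; `2` a sum of weights; `3` the threshold of the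
  sampler; `4` a partial sum; `5` a squared distance.
* Arrays of natural numbers: `0` holds the addresses `i d`; `1` the cells of the points; `2` the
  sizes of the cells; `3` the representatives of the clusters.
* Real arrays: `0` holds the points; `1` the weighted sums of the samples and later the output;
  `2` the squared distances to the seeds; `3` the importances; `4` the total weights. -/

/-- Puts the rounded up content of the real register `1` into the natural register `r`. -/
def ceilCode (r : ℕ) : Program :=
  .seq (.setNat r (.const 0))
    (.while (.realLt (.ofNat (.reg r)) (.reg 1)) (.setNat r (.add (.reg r) (.const 1))))

/-- Fills the table of the addresses `i d`. -/
def baseCode : Program :=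
  .seq (.setNat 13 (.const 0))
    (.forUpTo 5 0 (.seq (.storeNat 0 (.reg 5) (.reg 13)) (.setNat 13 (.add (.reg 13) (.reg 1)))))

/-- Sums the first `n` entries of the real array `a`. -/
def sumCode (a : ℕ) : Program :=
  .seq (.setReal 2 (.const 0)) (.forUpTo 5 0 (.setReal 2 (.add (.reg 2) (.load a (.reg 5)))))

/-- Samples an index with probabilities proportional to the entries of the real array `a`. -/
def sampleCode (a : ℕ) : Program :=
  .seq (sumCode a) (.seq (.draw 3) (.seq (.setReal 3 (.mul (.reg 3) (.reg 2)))
    (.seq (.setReal 4 (.const 0)) (.seq (.setNat 7 (.const 0))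
      (.forUpTo 5 0 (.seq (.ite (.realLt (.reg 3) (.reg 4)) .skip (.setNat 7 (.reg 5)))
        (.setReal 4 (.add (.reg 4) (.load a (.reg 5))))))))))

/-- The coordinate `j` of the point whose index is in the natural register `r`. -/
def coord (r : ℕ) : RealExpr := .load 0 (.add (.load 0 (.reg r)) (.reg 6))

/-- Computes the squared distance of the points `i` and `m`. -/
def distCode : Program :=
  .seq (.setReal 5 (.const 0))
    (.forUpTo 6 1 (.setReal 5 (.add (.reg 5)
      (.mul (.sub (coord 5) (coord 7)) (.sub (coord 5) (coord 7))))))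

/-- Adds the point `m` to the list of seeds. -/
def insertCode : Program :=
  .forUpTo 5 0 (.seq distCode
    (.ite (.and (.not (.natLt (.reg 8) (.const 1))) (.not (.realLt (.reg 5) (.load 2 (.reg 5)))))
      .skip (.seq (.storeReal 2 (.reg 5) (.reg 5)) (.storeNat 1 (.reg 5) (.reg 8)))))

/-- Chooses the seeds. -/
def seedCode : Program := .forUpTo 8 3 (.seq (sampleCode 2) insertCode)

/-- Counts the points in the cells. -/
def countCode : Program :=
  .forUpTo 5 0 (.storeNat 2 (.load 1 (.reg 5)) (.add (.load 2 (.load 1 (.reg 5))) (.const 1)))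

/-- Computes the importances of the points. -/
def weightCode : Program :=
  .seq (sumCode 2) (.seq countCode
    (.forUpTo 5 0 (.storeReal 3 (.reg 5) (.add (.div (.load 2 (.reg 5)) (.reg 2))
      (.div (.const 1) (.ofNat (.load 2 (.load 1 (.reg 5)))))))))

/-! ### Correctness of the parts of the program -/

section Specifications

variable {ω : ℕ → unitInterval} {O : ℕ → ℕ → Prop} {s : State}

theorem ceilCode_spec (r : ℕ) :
    WP ω O (ceilCode r) (fun s' => s'.natReg r = ⌈s.realReg 1⌉₊ ∧
      s'.time ≤ s.time + ⌈s.realReg 1⌉₊ * 9 + 7) s := by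
  set m := ⌈s.realReg 1⌉₊ with hm
  have loop : ∀ j i s₁, i + j = m → s₁.natReg r = i → s₁.realReg 1 = s.realReg 1 →
      WP ω O (.while (.realLt (.ofNat (.reg r)) (.reg 1)) (.setNat r (.add (.reg r) (.const 1))))
        (fun s' => s'.natReg r = m ∧ s'.time ≤ s₁.time + j * 9 + 5) s₁ := by
    intro j
    induction j with
    | zero =>
      intro i s₁ hij hi hr
      refine ⟨_, .while_false ?_, ?_, ?_⟩
      · simp only [Test.Holds, RealExpr.val, NatExpr.val, hi, hr, not_lt]
        exact Nat.ceil_le.1 (by omega)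
      · simp [State.tick, hi]; omega
      · simp [State.tick, Test.size, RealExpr.size, NatExpr.size]
    | succ j ih =>
      intro i s₁ hij hi hr
      obtain ⟨s₂, hrun, h₁, h₂⟩ := ih (i + 1)
        (State.tick 4 { s₁.tick 5 with natReg := Function.update s₁.natReg r (s₁.natReg r + 1) })
        (by omega) (by simp [State.tick, hi]) hr
      refine ⟨s₂, .while_true ?_ (.setNat _ _ _) hrun, h₁, ?_⟩
      · simp only [Test.Holds, RealExpr.val, NatExpr.val, hi, hr]
        exact Nat.lt_ceil.1 (by omega)
      · simp only [State.tick] at h₂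
        omega
  rw [ceilCode, wp_seq, wp_setNat]
  refine WP.mono (loop m 0 _ ?_ ?_ ?_) ?_
  · omega
  · simp [State.tick, NatExpr.val]
  · simp [State.tick]
  rintro s' ⟨h₁, h₂⟩
  refine ⟨h₁, ?_⟩
  simp only [State.tick, NatExpr.size] at h₂
  omega

theorem baseCode_spec {n d : ℕ} (hn : s.natReg 0 = n) (hd : s.natReg 1 = d) :
    WP ω O baseCode (fun s' => (∀ i < n, s'.natArr 0 i = i * d) ∧
      s'.time ≤ s.time + n * 15 + 8) s := by
  rw [baseCode, wp_seq, wp_setNat]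
  refine (WP.forUpTo (fun i s' => (∀ t < i, s'.natArr 0 t = t * d) ∧ s'.natReg 13 = i * d)
    n 7 0 ?_ (by decide) (by decide) (by decide) ?_ ?_ ?_).mono ?_
  · simpa [State.tick] using hn
  · intro i s v t h
    simpa using h
  · simp [State.tick, NatExpr.val]
  · rintro i s₁ hi h5 ⟨h₁, h₂⟩ hF
    have hd' : s₁.natReg 1 = d := by
      rw [hF.natReg 1 (by decide)]; simpa [State.tick] using hd
    simp only [wp_seq, wp_setNat, wp_storeNat, State.tick, NatExpr.val, NatExpr.size]
    refine ⟨⟨fun t ht => ?_, ?_⟩, by omega, by omega⟩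
    · rcases eq_or_ne t i with rfl | hti
      · simp [h5, h₂]
      · simp [h5, hti, h₁ t (by omega)]
    · simp [h₂, hd']; ring
  · rintro s' ⟨h₁, h₂, -⟩
    refine ⟨h₁.1, ?_⟩
    simp only [State.tick, NatExpr.size] at h₂
    omega

theorem sumCode_spec {n : ℕ} (a : ℕ) (hn : s.natReg 0 = n) :
    WP ω O (sumCode a) (fun s' => s'.realReg 2 = ∑ i ∈ Finset.range n, s.realArr a i ∧
      s'.time ≤ s.time + n * 13 + 8) s := by
  rw [sumCode, wp_seq, wp_setReal]
  refine (WP.forUpTo (fun i s' => s'.realReg 2 = ∑ t ∈ Finset.range i, s.realArr a t)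
    n 5 0 ?_ (by simp [natRegs]) (by simp [natRegs]) (by decide) ?_ ?_ ?_).mono ?_
  · simpa [State.tick] using hn
  · intro i s v t h
    simpa using h
  · simp [State.tick, RealExpr.val]
  · rintro i s₁ hi h5 h₁ hF
    have ha : s₁.realArr a = s.realArr a := hF.realArr a (by
      simp [forUpTo, realArrs])
    simp only [wp_setReal, State.tick, RealExpr.val, NatExpr.val, RealExpr.size, NatExpr.size]
    refine ⟨?_, by omega, by omega⟩
    simp [h5, h₁, ha, Finset.sum_range_succ]
  · rintro s' ⟨h₁, h₂, -⟩
    refine ⟨h₁, ?_⟩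
    simp only [State.tick, RealExpr.size] at h₂
    omega

theorem sampleCode_spec {n : ℕ} (a : ℕ) (hn : s.natReg 0 = n) :
    WP ω O (sampleCode a) (fun s' => s'.natReg 7 = sampleIdx (s.realArr a) n (ω s.draws) ∧
      s'.draws = s.draws + 1 ∧ s'.time ≤ s.time + n * 32 + 30) s := by
  rw [sampleCode, wp_seq]
  refine (sumCode_spec a hn).frame ?_
  rintro s₁ hF ⟨hsum, ht⟩
  have hn₁ : s₁.natReg 0 = n := (hF.natReg 0 (by simp [sumCode, forUpTo, natRegs])).trans hn
  have ha₁ : s₁.realArr a = s.realArr a := hF.realArr a (by simp [sumCode, forUpTo, realArrs])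
  have hd₁ : s₁.draws = s.draws := hF.draws (by simp [sumCode, forUpTo, drawFree])
  set θ : ℝ := (ω s.draws : ℝ) * ∑ i ∈ Finset.range n, s.realArr a i with hθ
  simp only [wp_seq, wp_draw, wp_setReal, wp_setNat]
  refine ((WP.forUpTo (fun i s' => s'.natReg 7 = pick (s.realArr a) i θ ∧
    s'.realReg 4 = ∑ t ∈ Finset.range i, s.realArr a t)
    n 11 0 ?_ (by simp [natRegs]) (by simp [natRegs]) (by decide) ?_ ?_ ?_).frame ?_)
  · simpa [State.tick] using hn₁
  · intro i s v t h
    simpa using h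
  · simp [State.tick, RealExpr.val, NatExpr.val, pick]
  · rintro i s₂ hi h5 ⟨h₁, h₂⟩ hF₂
    have ha : s₂.realArr a = s.realArr a :=
      (hF₂.realArr a (by simp [forUpTo, realArrs])).trans (by simpa [State.tick] using ha₁)
    have h3 : s₂.realReg 3 = θ := by
      rw [hF₂.realReg 3 (by simp [forUpTo, realRegs])]
      simp [State.tick, RealExpr.val, hsum, hd₁, hθ]
    simp only [wp_seq, wp_ite, wp_skip, wp_setReal, wp_setNat, State.tick, RealExpr.val,
      NatExpr.val, RealExpr.size, NatExpr.size, Test.Holds, Test.size]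
    refine ⟨fun hlt => ⟨⟨?_, ?_⟩, by omega, by omega⟩, fun hlt => ⟨⟨?_, ?_⟩, by omega, by omega⟩⟩
    · rw [h3, h₂] at hlt
      rw [h₁, pick, if_pos hlt]
    · simp [h5, h₂, ha, Finset.sum_range_succ]
    · rw [h3, h₂] at hlt
      simp [h5, pick, if_neg hlt]
    · simp [h5, h₂, ha, Finset.sum_range_succ]
  · rintro s' hF₂ ⟨h₁, h₂, -⟩
    refine ⟨h₁.1, ?_, ?_⟩
    · rw [hF₂.draws (by simp [forUpTo, drawFree])]
      simp [State.tick, hd₁]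
    · simp only [State.tick, RealExpr.size, NatExpr.size] at h₂
      omega

/-- The static part of the memory: the size of the data, the points, and the address table. -/
structure Data (n d : ℕ) (a : ℕ → ℝ) (s : State) : Prop where
  size : s.natReg 0 = n
  dim : s.natReg 1 = d
  points : s.realArr 0 = a
  base : ∀ i < n, s.natArr 0 i = i * d

theorem Data.frame {n d : ℕ} {a : ℕ → ℝ} {A : Program} {s' : State} (h : Data n d a s)
    (hF : Frame A s s') (h0 : 0 ∉ A.natRegs := by decide) (h1 : 1 ∉ A.natRegs := by decide)
    (h2 : 0 ∉ A.realArrs := by decide) (h3 : 0 ∉ A.natArrs := by decide) : Data n d a s' where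
  size := (hF.natReg 0 h0).trans h.size
  dim := (hF.natReg 1 h1).trans h.dim
  points := (hF.realArr 0 h2).trans h.points
  base i hi := by rw [hF.natArr 0 h3]; exact h.base i hi

/-- The squared distance of two points in terms of the array of coordinates. -/
def arrDist (d : ℕ) (a : ℕ → ℝ) (i m : ℕ) : ℝ :=
  ∑ j ∈ Finset.range d, (a (i * d + j) - a (m * d + j)) * (a (i * d + j) - a (m * d + j))

theorem distCode_spec {n d i m : ℕ} {a : ℕ → ℝ} (hs : Data n d a s) (hi : i < n) (hm : m < n)
    (h5 : s.natReg 5 = i) (h7 : s.natReg 7 = m) :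
    WP ω O distCode (fun s' => s'.realReg 5 = arrDist d a i m ∧
      s'.time ≤ s.time + d * 34 + 8) s := by
  rw [distCode, wp_seq, wp_setReal]
  refine (WP.forUpTo (fun j s' => s'.realReg 5 = ∑ t ∈ Finset.range j,
    (a (i * d + t) - a (m * d + t)) * (a (i * d + t) - a (m * d + t)))
    d 26 0 ?_ (by decide) (by decide) (by decide) ?_ ?_ ?_).mono ?_
  · simpa [State.tick] using hs.dim
  · intro i s v t h
    simpa using h
  · simp [State.tick, RealExpr.val]
  · rintro j s₁ hj h6 h₁ hF
    have hD : Data n d a s₁ := Data.frame (s := s) hs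
      (hF := ⟨hF.natReg, hF.natArr, fun r hr => (hF.realReg r hr).trans (by
        have : r ≠ 5 := by rintro rfl; exact hr (by decide)
        simp [State.tick, this]), hF.realArr, hF.draws, hF.queries⟩)
    have e5 : s₁.natReg 5 = i := (hF.natReg 5 (by decide)).trans h5
    have e7 : s₁.natReg 7 = m := (hF.natReg 7 (by decide)).trans h7
    simp only [wp_setReal, State.tick, RealExpr.val, NatExpr.val, RealExpr.size, NatExpr.size,
      coord]
    refine ⟨?_, by omega, by omega⟩
    simp [h6, e5, e7, h₁, hD.points, hD.base i hi, hD.base m hm, Finset.sum_range_succ]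
  · rintro s' ⟨h₁, h₂, -⟩
    refine ⟨h₁, ?_⟩
    simp only [State.tick, RealExpr.size] at h₂
    omega

end Specifications

end KMeans

namespace KMeans

open RealRAM Program

section Specifications

variable {ω : ℕ → unitInterval} {O : ℕ → ℕ → Prop} {s : State}

theorem insertCode_spec {n d m : ℕ} {a : ℕ → ℝ} {L : List ℕ} (hs : Data n d a s) (hm : m < n)
    (h7 : s.natReg 7 = m) (h8 : s.natReg 8 = L.length)
    (hw : ∀ i < n, s.realArr 2 i = minDist (arrDist d a) L i)
    (hc : ∀ i < n, s.natArr 1 i = nearest (arrDist d a) L i) :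
    WP ω O insertCode (fun s' => (∀ i < n, s'.realArr 2 i = minDist (arrDist d a) (m :: L) i) ∧
      (∀ i < n, s'.natArr 1 i = nearest (arrDist d a) (m :: L) i) ∧
      s'.time ≤ s.time + n * (d * 34 + 40) + 6) s := by
  rw [insertCode]
  refine (WP.forUpTo (fun i s' =>
      (∀ t < i, s'.realArr 2 t = minDist (arrDist d a) (m :: L) t ∧
        s'.natArr 1 t = nearest (arrDist d a) (m :: L) t) ∧
      (∀ t, i ≤ t → t < n → s'.realArr 2 t = minDist (arrDist d a) L t ∧
        s'.natArr 1 t = nearest (arrDist d a) L t))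
    n (d * 34 + 32) 0 hs.size (by decide) (by decide) (by decide) ?_ ?_ ?_).mono ?_
  · intro i s v t h
    simpa using h
  · exact ⟨fun t ht => absurd ht (Nat.not_lt_zero t), fun t _ ht => ⟨hw t ht, hc t ht⟩⟩
  · rintro i s₁ hi h5 ⟨h₁, h₂⟩ hF
    have hD : Data n d a s₁ := hs.frame hF
    have e7 : s₁.natReg 7 = m := (hF.natReg 7 (by decide)).trans h7
    rw [wp_seq]
    refine (distCode_spec hD hi hm h5 e7).frame ?_
    rintro s₂ hF₂ ⟨hdist, ht⟩
    have e5 : s₂.natReg 5 = i := (hF₂.natReg 5 (by decide)).trans h5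
    have e8 : s₂.natReg 8 = L.length :=
      (hF₂.natReg 8 (by decide)).trans ((hF.natReg 8 (by decide)).trans h8)
    have ew : s₂.realArr 2 = s₁.realArr 2 := hF₂.realArr 2 (by decide)
    have ec : s₂.natArr 1 = s₁.natArr 1 := hF₂.natArr 1 (by decide)
    have eq : s₂.queries = s₁.queries := hF₂.queries (by decide)
    simp only [wp_seq, wp_ite, wp_skip, wp_storeReal, wp_storeNat, State.tick, RealExpr.val,
      NatExpr.val, RealExpr.size, NatExpr.size, Test.Holds, Test.size, e5, e8, hdist, ew,
      (h₂ i le_rfl hi).1]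
    refine ⟨fun hcond => ⟨⟨fun t ht => ?_, fun t ht htn => ?_⟩, by omega, by omega⟩,
      fun hcond => ⟨⟨fun t ht => ?_, fun t ht htn => ?_⟩, by omega, by omega⟩⟩
    · rcases Nat.lt_succ_iff_lt_or_eq.1 ht with ht | rfl
      · simpa [ew, ec] using h₁ t ht
      · rw [← not_or] at hcond
        rw [minDist, nearest, if_neg hcond, if_neg hcond]
        simpa [ew, ec] using h₂ t le_rfl hi
    · simpa [ew, ec] using h₂ t (by omega) htn
    · rcases Nat.lt_succ_iff_lt_or_eq.1 ht with ht | rfl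
      · simpa [ew, ec, ht.ne] using h₁ t ht
      · rw [← not_or, not_not] at hcond
        rw [minDist, nearest, if_pos hcond, if_pos hcond]
        simp
    · have : t ≠ i := by omega
      simpa [ew, ec, this] using h₂ t (by omega) htn
  · rintro s' ⟨h₁, h₂, -⟩
    refine ⟨fun i hi => (h₁.1 i hi).1, fun i hi => (h₁.1 i hi).2, ?_⟩
    linarith

theorem seedCode_spec {n d K : ℕ} {a : ℕ → ℝ} (hs : Data n d a s) (hn : 0 < n)
    (hK : s.natReg 3 = K) (hdraws : s.draws = 0) (hw : ∀ i, s.realArr 2 i = 0)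
    (hc : ∀ i, s.natArr 1 i = 0) :
    WP ω O seedCode (fun s' => s'.draws = K ∧
      (∀ i < n, s'.realArr 2 i = minDist (arrDist d a) (seeds (arrDist d a) n ω K) i) ∧
      (∀ i < n, s'.natArr 1 i = nearest (arrDist d a) (seeds (arrDist d a) n ω K) i) ∧
      s'.time ≤ s.time + K * (n * (d * 34 + 72) + 44) + 6) s := by
  set D := arrDist d a with hD
  rw [seedCode]
  refine (WP.forUpTo (fun t s' => s'.draws = t ∧
      (∀ i < n, s'.realArr 2 i = minDist D (seeds D n ω t) i) ∧
      (∀ i < n, s'.natArr 1 i = nearest D (seeds D n ω t) i))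
    K (n * (d * 34 + 72) + 36) 0 hK (by decide) (by decide) (by decide) ?_ ?_ ?_).mono ?_
  · intro i s v t h
    simpa using h
  · exact ⟨hdraws, fun i _ => hw i, fun i _ => hc i⟩
  · rintro t s₁ ht h8 ⟨h₁, h₂, h₃⟩ hF
    have hs₁ : Data n d a s₁ := hs.frame hF
    rw [wp_seq]
    refine (sampleCode_spec 2 hs₁.size).frame ?_
    rintro s₂ hF₂ ⟨h7, hd, ht₂⟩
    have hs₂ : Data n d a s₂ := hs₁.frame hF₂
    rw [h₁, sampleIdx_congr h₂] at h7
    refine (insertCode_spec hs₂ (pick_lt _ hn _) h7 (L := seeds D n ω t) ?_ ?_ ?_).frame ?_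
    · rw [length_seeds, hF₂.natReg 8 (by decide), h8]
    · rw [hF₂.realArr 2 (by decide)]; exact h₂
    · rw [hF₂.natArr 1 (by decide)]; exact h₃
    · rintro s₃ hF₃ ⟨h₄, h₅, ht₃⟩
      refine ⟨⟨?_, h₄, h₅⟩, ?_, ?_⟩
      · rw [hF₃.draws (by decide), hd, h₁]
      · have : n * (d * 34 + 72) = n * (d * 34 + 40) + n * 32 := by ring
        omega
      · rw [hF₃.queries (by decide), hF₂.queries (by decide), add_zero]
  · rintro s' ⟨⟨h₁, h₂, h₃⟩, h₄, -⟩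
    exact ⟨h₁, h₂, h₃, h₄⟩

theorem countCode_spec {n : ℕ} {c : ℕ → ℕ} (hn : s.natReg 0 = n)
    (hc : ∀ i < n, s.natArr 1 i = c i) (h0 : ∀ t, s.natArr 2 t = 0) :
    WP ω O countCode (fun s' => (∀ t, s'.natArr 2 t = {i ∈ Finset.range n | c i = t}.card) ∧
      s'.time ≤ s.time + n * 16 + 6) s := by
  rw [countCode]
  refine (WP.forUpTo (fun i s' => ∀ t, s'.natArr 2 t = {j ∈ Finset.range i | c j = t}.card)
    n 8 0 hn (by decide) (by decide) (by decide) ?_ ?_ ?_).mono ?_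
  · intro i s v t h
    simpa using h
  · simpa using h0
  · rintro i s₁ hi h5 h₁ hF
    have e1 : s₁.natArr 1 i = c i := by rw [hF.natArr 1 (by decide), hc i hi]
    simp only [wp_storeNat, State.tick, NatExpr.val, NatExpr.size]
    refine ⟨fun t => ?_, by omega, by omega⟩
    rw [Finset.range_add_one, Finset.filter_insert]
    simp only [h5, e1]
    by_cases ht : c i = t
    · simp [ht, h₁]
    · simp [ht, h₁, Ne.symm ht]
  · rintro s' ⟨h₁, h₂, -⟩
    exact ⟨h₁, by omega⟩

theorem weightCode_spec {n d : ℕ} {a : ℕ → ℝ} {L : List ℕ} (hs : Data n d a s)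
    (hw : ∀ i < n, s.realArr 2 i = minDist (arrDist d a) L i)
    (hc : ∀ i < n, s.natArr 1 i = nearest (arrDist d a) L i) (h0 : ∀ t, s.natArr 2 t = 0) :
    WP ω O weightCode (fun s' => (∀ i < n, s'.realArr 3 i = weight (arrDist d a) n L i) ∧
      s'.time ≤ s.time + n * 50 + 20) s := by
  rw [weightCode, wp_seq]
  refine (sumCode_spec 2 hs.size).frame ?_
  rintro s₁ hF₁ ⟨hsum, ht₁⟩
  have hs₁ : Data n d a s₁ := hs.frame hF₁
  rw [wp_seq]
  refine (countCode_spec (c := nearest (arrDist d a) L) hs₁.size ?_ ?_).frame ?_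
  · rw [hF₁.natArr 1 (by decide)]; exact hc
  · rw [hF₁.natArr 2 (by decide)]; exact h0
  rintro s₂ hF₂ ⟨hcount, ht₂⟩
  have hs₂ : Data n d a s₂ := hs₁.frame hF₂
  refine (WP.forUpTo (fun i s' => ∀ t < i, s'.realArr 3 t = weight (arrDist d a) n L t)
    n 13 0 hs₂.size (by decide) (by decide) (by decide) ?_ ?_ ?_).mono ?_
  · intro i s v t h
    simpa using h
  · simp
  · rintro i s₃ hi h5 h₁ hF₃
    have e1 : s₃.natArr 1 i = nearest (arrDist d a) L i := by
      rw [hF₃.natArr 1 (by decide), hF₂.natArr 1 (by decide), hF₁.natArr 1 (by decide), hc i hi]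
    have e2 : ∀ t, s₃.natArr 2 t = cellSize (arrDist d a) n L t := by
      intro t
      rw [hF₃.natArr 2 (by decide), hcount, cellSize]
    have e3 : s₃.realArr 2 i = minDist (arrDist d a) L i := by
      rw [hF₃.realArr 2 (by decide), hF₂.realArr 2 (by decide), hF₁.realArr 2 (by decide), hw i hi]
    have e4 : s₃.realReg 2 = ∑ i ∈ Finset.range n, minDist (arrDist d a) L i := by
      rw [hF₃.realReg 2 (by decide), hF₂.realReg 2 (by decide), hsum]
      exact Finset.sum_congr rfl fun i hi => hw i (Finset.mem_range.1 hi)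
    simp only [wp_storeReal, State.tick, NatExpr.val, NatExpr.size, RealExpr.val, RealExpr.size]
    refine ⟨fun t ht => ?_, by omega, by omega⟩
    rcases Nat.lt_succ_iff_lt_or_eq.1 ht with ht | rfl
    · simpa [h5, ht.ne] using h₁ t ht
    · simp [h5, e1, e2, e3, e4, weight]
  · rintro s' ⟨h₁, h₂, -⟩
    exact ⟨h₁, by omega⟩

end Specifications

end KMeans

namespace KMeans

open RealRAM Program

/-! ### Estimating the centroids of the clusters -/

/-- Finds the number of the cluster of the sampled point among the clusters met so far; the result
is the number of these clusters if the cluster is new. -/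
def labelCode : Program :=
  .seq (.setNat 10 (.reg 9)) (.forUpTo 11 9 (.seq (.query 12 (.load 3 (.reg 11)) (.reg 7))
    (.ite (.natLt (.const 0) (.reg 12)) (.setNat 10 (.reg 11)) .skip)))

/-- Makes the sampled point the representative of its cluster. -/
def registerCode : Program :=
  .seq (.storeNat 3 (.reg 10) (.reg 7))
    (.ite (.natLt (.reg 10) (.reg 9)) .skip (.setNat 9 (.add (.reg 9) (.const 1))))

/-- The address of the coordinate `j` of the cluster whose number is in the natural
register `r`. -/
def slot (r : ℕ) : NatExpr := .add (.load 0 (.reg r)) (.reg 6)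

/-- Adds the sampled point, divided by its importance, to the sums of its cluster. -/
def accumulateCode : Program :=
  .seq (.storeReal 4 (.reg 10) (.add (.load 4 (.reg 10)) (.div (.const 1) (.load 3 (.reg 7)))))
    (.forUpTo 6 1 (.storeReal 1 (slot 10) (.add (.load 1 (slot 10))
      (.div (coord 7) (.load 3 (.reg 7))))))

/-- Draws the samples and keeps the weighted sums for all clusters. -/
def tallyCode : Program :=
  .forUpTo 8 4 (.seq (sampleCode 3) (.seq labelCode (.seq registerCode accumulateCode)))

/-- Divides the weighted sums by the total weights. -/
def outputCode : Program :=
  .forUpTo 11 9 (.forUpTo 6 1 (.storeReal 1 (slot 11)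
    (.div (.load 1 (slot 11)) (.load 4 (.reg 11)))))

section Tally

variable {α : Type*}

open Classical in
/-- The sum of `f m / v m` over the samples `m` with the label `c`. -/
noncomputable def classSum (v f : ℕ → ℝ) (y : ℕ → α) (l : List ℕ) (c : α) : ℝ :=
  (l.map fun m => if y m = c then f m / v m else 0).sum

theorem classSum_cons_self {v f : ℕ → ℝ} {y : ℕ → α} {l : List ℕ} {m : ℕ} {c : α} (h : y m = c) :
    classSum v f y (m :: l) c = classSum v f y l c + f m / v m := by
  simp [classSum, h, add_comm]

theorem classSum_cons_ne {v f : ℕ → ℝ} {y : ℕ → α} {l : List ℕ} {m : ℕ} {c : α} (h : y m ≠ c) :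
    classSum v f y (m :: l) c = classSum v f y l c := by
  simp [classSum, h]

theorem classSum_eq_zero {v f : ℕ → ℝ} {y : ℕ → α} {l : List ℕ} {c : α} (h : ∀ m ∈ l, y m ≠ c) :
    classSum v f y l c = 0 := by
  induction l with
  | nil => simp [classSum]
  | cons m l ih =>
    rw [classSum_cons_ne (h m (by simp)), ih fun m hm => h m (by simp [hm])]

/-- The tables after the samples `l` have been processed: `R` clusters have been met, with the
representatives `rep`, and `S₀`, `S₁` hold the weighted sums. -/
structure Tally (n d : ℕ) (a v : ℕ → ℝ) (y : ℕ → α) (l : List ℕ) (R : ℕ) (rep : ℕ → ℕ)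
    (S₀ S₁ : ℕ → ℝ) : Prop where
  rep_lt : ∀ r < R, rep r < n
  inj : ∀ r < R, ∀ r' < R, y (rep r) = y (rep r') → r = r'
  mem : ∀ m ∈ l, ∃ r < R, y (rep r) = y m
  total : ∀ r < R, S₀ r = classSum v (fun _ => 1) y l (y (rep r))
  sum : ∀ r < R, ∀ j < d, S₁ (r * d + j) = classSum v (fun m => a (m * d + j)) y l (y (rep r))
  total_zero : ∀ r, R ≤ r → S₀ r = 0
  sum_zero : ∀ t, R * d ≤ t → S₁ t = 0

variable {n d : ℕ} {a v : ℕ → ℝ} {y : ℕ → α} {l : List ℕ} {R : ℕ} {rep : ℕ → ℕ} {S₀ S₁ : ℕ → ℝ}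

open Classical in
theorem Tally.le_card (h : Tally n d a v y l R rep S₀ S₁) :
    R ≤ ((Finset.range n).image y).card := by
  have := Finset.card_le_card_of_injOn (s := Finset.range R) (t := (Finset.range n).image y)
    (fun r => y (rep r))
    (fun r hr => by
      have hr' : r < R := by simpa using hr
      exact Finset.mem_coe.2 (Finset.mem_image_of_mem _ (Finset.mem_range.2 (h.rep_lt r hr'))))
    (fun r hr r' hr' e => h.inj r (by simpa using hr) r' (by simpa using hr') e)
  simpa using this

/-- The cluster number `lab` is found for the point `m`. -/
def IsLabel (y : ℕ → α) (R : ℕ) (rep : ℕ → ℕ) (m i lab : ℕ) : Prop :=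
  (lab < i ∧ y (rep lab) = y m) ∨ (lab = R ∧ ∀ r < i, y (rep r) ≠ y m)

theorem mul_add_lt_of_lt {d r r' j : ℕ} (h : r < r') (hj : j < d) : r * d + j < r' * d := by
  have : (r + 1) * d ≤ r' * d := Nat.mul_le_mul_right d h
  rw [add_mul] at this
  omega

/-- Processing one more sample `m`, whose cluster has the number `lab`, keeps the tables correct. -/
theorem Tally.cons (h : Tally n d a v y l R rep S₀ S₁) {m lab : ℕ} (hm : m < n)
    (hlab : IsLabel y R rep m R lab) :
    Tally n d a v y (m :: l) (if lab < R then R else R + 1) (Function.update rep lab m)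
      (Function.update S₀ lab (S₀ lab + 1 / v m))
      (fun t => if lab * d ≤ t ∧ t < lab * d + d then S₁ t + a (m * d + (t - lab * d)) / v m
        else S₁ t) := by
  set R' := if lab < R then R else R + 1 with hR'
  have hRR' : R ≤ R' := by rw [hR']; split_ifs <;> omega
  have hlab' : lab < R' := by
    rw [hR']; rcases hlab with h | h <;> split_ifs <;> omega
  have hlt : ∀ r < R', r ≠ lab → r < R := by
    intro r hr hne
    rw [hR'] at hr
    rcases hlab with h | h <;> split_ifs at hr <;> omega
  -- the label of the point `m` occurs nowhere else
  have hne : ∀ r < R, r ≠ lab → y (rep r) ≠ y m := by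
    intro r hr hne e
    rcases hlab with ⟨h₁, h₂⟩ | ⟨h₁, h₂⟩
    · exact hne (h.inj r hr lab h₁ (e.trans h₂.symm))
    · exact h₂ r hr e
  have hold : ∀ f : ℕ → ℝ, ∀ S : ℝ, (lab < R → S = classSum v f y l (y (rep lab))) →
      (R ≤ lab → S = 0) → S = classSum v f y l (y m) := by
    intro f S h₁ h₂
    rcases hlab with ⟨h₃, h₄⟩ | ⟨h₃, h₄⟩
    · rw [← h₄, h₁ h₃]
    · rw [h₂ h₃.ge, classSum_eq_zero]
      intro m' hm' e
      obtain ⟨r, hr, hr'⟩ := h.mem m' hm'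
      exact h₄ r hr (hr'.trans e)
  constructor
  · intro r hr
    rcases eq_or_ne r lab with rfl | hrl
    · simpa using hm
    · simpa [hrl] using h.rep_lt r (hlt r hr hrl)
  · intro r hr r' hr' e
    by_cases hrl : r = lab <;> by_cases hrl' : r' = lab
    · rw [hrl, hrl']
    · rw [hrl, Function.update_self, Function.update_of_ne hrl'] at e
      exact absurd e.symm (hne r' (hlt r' hr' hrl') hrl')
    · rw [hrl', Function.update_self, Function.update_of_ne hrl] at e
      exact absurd e (hne r (hlt r hr hrl) hrl)
    · rw [Function.update_of_ne hrl, Function.update_of_ne hrl'] at e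
      exact h.inj r (hlt r hr hrl) r' (hlt r' hr' hrl') e
  · intro m' hm'
    rcases List.mem_cons.1 hm' with rfl | hm'
    · exact ⟨lab, hlab', by simp⟩
    · obtain ⟨r, hr, e⟩ := h.mem m' hm'
      rcases eq_or_ne r lab with rfl | hrl
      · rcases hlab with ⟨h₁, h₂⟩ | ⟨h₁, h₂⟩
        · exact ⟨r, hlab', by simp [← h₂, e]⟩
        · omega
      · exact ⟨r, by omega, by simp [hrl, e]⟩
  · intro r hr
    rcases eq_or_ne r lab with rfl | hrl
    · rw [Function.update_self, Function.update_self, classSum_cons_self rfl,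
        hold (fun _ => 1) (S₀ r) (fun hr => h.total r hr) (fun hr => h.total_zero r hr)]
    · have := hlt r hr hrl
      rw [Function.update_of_ne hrl, Function.update_of_ne hrl,
        classSum_cons_ne (hne r this hrl).symm, h.total r this]
  · intro r hr j hj
    rcases eq_or_ne r lab with rfl | hrl
    · rw [Function.update_self, classSum_cons_self rfl, if_pos ⟨by omega, by omega⟩,
        Nat.add_sub_cancel_left]
      rw [hold (fun m => a (m * d + j)) (S₁ (r * d + j)) (fun hr => h.sum r hr j hj)
        (fun hr => h.sum_zero _ (by
          have := Nat.mul_le_mul_right d hr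
          omega))]
    · have := hlt r hr hrl
      rw [Function.update_of_ne hrl, classSum_cons_ne (hne r this hrl).symm, if_neg,
        h.sum r this j hj]
      rintro ⟨h₁, h₂⟩
      rcases Nat.lt_or_gt_of_ne hrl with h | h
      · have := mul_add_lt_of_lt h hj
        omega
      · have := Nat.mul_le_mul_right d (Nat.succ_le_of_lt h)
        rw [Nat.succ_mul] at this
        omega
  · intro r hr
    rw [Function.update_of_ne (by omega)]
    exact h.total_zero r (by omega)
  · intro t ht
    have h₁ := Nat.mul_le_mul_right d hRR'
    have h₂ := Nat.mul_le_mul_right d (Nat.succ_le_of_lt hlab')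
    rw [Nat.succ_mul] at h₂
    rw [if_neg (by omega)]
    exact h.sum_zero t (by omega)

end Tally

section Specifications

variable {ω : ℕ → unitInterval} {O : ℕ → ℕ → Prop} {s : State} {α : Type*} {y : ℕ → α}
  {n d m R : ℕ} {a v : ℕ → ℝ}

theorem labelCode_spec (hO : ∀ i < n, ∀ j < n, (O i j ↔ y i = y j)) (h9 : s.natReg 9 = R)
    (h7 : s.natReg 7 = m) (hm : m < n) (hrep : ∀ r < R, s.natArr 3 r < n) :
    WP ω O labelCode (fun s' => IsLabel y R (s.natArr 3) m R (s'.natReg 10) ∧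
      s'.time ≤ s.time + R * 18 + 8 ∧ s'.queries ≤ s.queries + R) s := by
  rw [labelCode, wp_seq, wp_setNat]
  refine (WP.forUpTo (fun i s' => IsLabel y R (s.natArr 3) m i (s'.natReg 10))
    R 10 1 ?_ (by decide) (by decide) (by decide) ?_ ?_ ?_).mono ?_
  · simpa [State.tick] using h9
  · intro i s v t h
    simpa using h
  · exact Or.inr ⟨by simp [State.tick, NatExpr.val, h9], by simp⟩
  · rintro i s₁ hi h11 h₁ hF
    have e3 : s₁.natArr 3 = s.natArr 3 := hF.natArr 3 (by decide)
    have e7 : s₁.natReg 7 = m := by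
      rw [hF.natReg 7 (by decide)]; simpa [State.tick] using h7
    simp only [wp_seq, wp_query, wp_ite, wp_skip, wp_setNat, State.tick, NatExpr.val,
      NatExpr.size, Test.Holds, Test.size, h11, e3, e7, hO _ (hrep i hi) m hm,
      Function.update_self]
    refine ⟨fun hcond => ⟨?_, by omega, by omega⟩, fun hcond => ⟨?_, by omega, by omega⟩⟩
    · have hy : y (s.natArr 3 i) = y m := by
        by_contra hy
        simp [h11, e3, e7, hO _ (hrep i hi) m hm, hy] at hcond
      exact Or.inl ⟨by simp [h11], by simpa [h11] using hy⟩
    · have hy : y (s.natArr 3 i) ≠ y m := by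
        intro hy
        simp [h11, e3, e7, hO _ (hrep i hi) m hm, hy] at hcond
      rcases h₁ with ⟨h₁, h₂⟩ | ⟨h₁, h₂⟩
      · exact Or.inl ⟨by simpa using h₁.trans (Nat.lt_succ_self i), by simpa using h₂⟩
      · refine Or.inr ⟨by simpa using h₁, fun r hr => ?_⟩
        rcases Nat.lt_succ_iff_lt_or_eq.1 hr with hr | rfl
        · exact h₂ r hr
        · exact hy
  · rintro s' ⟨h₁, h₂, h₃⟩
    simp only [State.tick, NatExpr.size] at h₂ h₃
    exact ⟨h₁, by omega, by omega⟩

theorem registerCode_spec {lab : ℕ} (h7 : s.natReg 7 = m) (h9 : s.natReg 9 = R)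
    (h10 : s.natReg 10 = lab) :
    WP ω O registerCode (fun s' => s'.natReg 9 = (if lab < R then R else R + 1) ∧
      s'.natArr 3 = Function.update (s.natArr 3) lab m ∧ s'.time ≤ s.time + 11) s := by
  simp only [registerCode, wp_seq, wp_storeNat, wp_ite, wp_skip, wp_setNat, State.tick,
    NatExpr.val, NatExpr.size, Test.Holds, Test.size, h7, h9, h10, Function.update_self]
  refine ⟨fun h => ⟨by simp [h], trivial, by omega⟩, fun h => ⟨by simp [h], trivial, by omega⟩⟩

theorem accumulateCode_spec {lab : ℕ} (hs : Data n d a s) (hm : m < n) (hlab : lab < n)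
    (h7 : s.natReg 7 = m) (h10 : s.natReg 10 = lab) (hv : ∀ i < n, s.realArr 3 i = v i) :
    WP ω O accumulateCode (fun s' =>
      s'.realArr 4 = Function.update (s.realArr 4) lab (s.realArr 4 lab + 1 / v m) ∧
      s'.realArr 1 = (fun t => if lab * d ≤ t ∧ t < lab * d + d then
        s.realArr 1 t + a (m * d + (t - lab * d)) / v m else s.realArr 1 t) ∧
      s'.time ≤ s.time + d * 28 + 16) s := by
  rw [accumulateCode, wp_seq, wp_storeReal]
  set s₀ := State.tick _ { s with realArr := _ } with hs₀
  have hs₀' : Data n d a s₀ := by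
    refine ⟨hs.size, hs.dim, ?_, hs.base⟩
    simpa [hs₀, State.tick] using hs.points
  refine (WP.forUpTo (fun j s' => s'.realArr 1 = (fun t =>
      if lab * d ≤ t ∧ t < lab * d + j then
        s.realArr 1 t + a (m * d + (t - lab * d)) / v m else s.realArr 1 t))
    d 20 0 hs₀'.dim (by decide) (by decide) (by decide) ?_ ?_ ?_).frame ?_
  · intro i s v t h
    simpa using h
  · funext t
    rw [if_neg (by omega)]
    simp [hs₀, State.tick]
  · rintro j s₁ hj h6 h₁ hF
    have hD := hs₀'.frame hF
    have e7 : s₁.natReg 7 = m := by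
      rw [hF.natReg 7 (by decide)]; simpa [hs₀, State.tick] using h7
    have e10 : s₁.natReg 10 = lab := by
      rw [hF.natReg 10 (by decide)]; simpa [hs₀, State.tick] using h10
    have e3 : s₁.realArr 3 m = v m := by
      rw [hF.realArr 3 (by decide), ← hv m hm]; simp [hs₀, State.tick]
    simp only [wp_storeReal, State.tick, NatExpr.val, NatExpr.size, RealExpr.val, RealExpr.size,
      slot, coord, e7, e10, h6, e3, hD.base m hm, hD.base lab hlab, hD.points]
    refine ⟨?_, by omega, by omega⟩
    funext t
    rw [Function.update_self, h₁]
    rcases eq_or_ne t (lab * d + j) with rfl | ht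
    · simp
    · rw [Function.update_of_ne ht]
      congr 1
      simp only [eq_iff_iff]
      omega
  · rintro s' hF ⟨h₁, h₂, -⟩
    refine ⟨?_, h₁, ?_⟩
    · rw [hF.realArr 4 (by decide)]
      simp [hs₀, State.tick, RealExpr.val, NatExpr.val, h10, h7, hv m hm]
    · simp only [hs₀, State.tick, RealExpr.size, NatExpr.size] at h₂
      omega

open Classical in
theorem tallyCode_spec {N K k : ℕ} (hO : ∀ i < n, ∀ j < n, (O i j ↔ y i = y j))
    (hk : ((Finset.range n).image y).card ≤ k) (hs : Data n d a s) (hn : 0 < n)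
    (hN : s.natReg 4 = N) (hK : s.draws = K) (hv : ∀ i < n, s.realArr 3 i = v i)
    (h9 : s.natReg 9 = 0) (h1 : ∀ t, s.realArr 1 t = 0) (h4 : ∀ t, s.realArr 4 t = 0) :
    WP ω O tallyCode (fun s' =>
      Tally n d a v y (samples v n ω K N) (s'.natReg 9) (s'.natArr 3) (s'.realArr 4)
        (s'.realArr 1) ∧
      s'.time ≤ s.time + N * (n * 32 + k * 18 + d * 28 + 73) + 6 ∧
      s'.queries ≤ s.queries + N * k) s := by
  rw [tallyCode]
  refine (WP.forUpTo (fun t s' => s'.draws = K + t ∧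
      Tally n d a v y (samples v n ω K t) (s'.natReg 9) (s'.natArr 3) (s'.realArr 4)
        (s'.realArr 1))
    N (n * 32 + k * 18 + d * 28 + 65) k hN (by decide) (by decide) (by decide) ?_ ?_ ?_).mono ?_
  · intro i s v t h
    simpa using h
  · refine ⟨hK, ?_⟩
    rw [h9]
    constructor <;> simp [samples, h1, h4]
  · rintro t s₁ ht h8 ⟨hd₁, hT⟩ hF
    have hs₁ : Data n d a s₁ := hs.frame hF
    have hv₁ : ∀ i < n, s₁.realArr 3 i = v i := by
      rw [hF.realArr 3 (by decide)]; exact hv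
    rw [wp_seq]
    refine (sampleCode_spec 3 hs₁.size).frame ?_
    rintro s₂ hF₂ ⟨h7, hd₂, ht₂⟩
    have hs₂ : Data n d a s₂ := hs₁.frame hF₂
    rw [hd₁, sampleIdx_congr hv₁] at h7
    have hm := pick_lt v hn ((ω (K + t) : ℝ) * ∑ i ∈ Finset.range n, v i)
    change sampleIdx v n (ω (K + t)) < n at hm
    generalize hm' : sampleIdx v n (ω (K + t)) = m at hm h7
    set R := s₁.natReg 9 with hR
    have hRk : R ≤ k := hT.le_card.trans hk
    have e9 : s₂.natReg 9 = R := hF₂.natReg 9 (by decide)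
    have e3 : s₂.natArr 3 = s₁.natArr 3 := hF₂.natArr 3 (by decide)
    rw [wp_seq]
    refine (labelCode_spec hO e9 h7 hm (by rw [e3]; exact hT.rep_lt)).frame ?_
    rintro s₃ hF₃ ⟨hlab, ht₃, hq₃⟩
    have hs₃ : Data n d a s₃ := hs₂.frame hF₃
    generalize h10 : s₃.natReg 10 = lab at hlab
    rw [e3] at hlab
    have hT' := hT.cons hm hlab
    -- the clusters met so far are distinct, so there are at most `n` of them
    have hlabn : lab < n := by
      have h := hT'.le_card.trans Finset.card_image_le
      rw [Finset.card_range] at h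
      rcases hlab with h' | h' <;> split_ifs at h <;> omega
    rw [wp_seq]
    refine (registerCode_spec ((hF₃.natReg 7 (by decide)).trans h7)
      ((hF₃.natReg 9 (by decide)).trans e9) h10).frame ?_
    rintro s₄ hF₄ ⟨h9₄, h3₄, ht₄⟩
    have hs₄ : Data n d a s₄ := hs₃.frame hF₄
    refine (accumulateCode_spec (v := v) hs₄ hm hlabn
      ((hF₄.natReg 7 (by decide)).trans ((hF₃.natReg 7 (by decide)).trans h7))
      ((hF₄.natReg 10 (by decide)).trans h10) ?_).frame ?_
    · rw [hF₄.realArr 3 (by decide), hF₃.realArr 3 (by decide), hF₂.realArr 3 (by decide)]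
      exact hv₁
    · rintro s₅ hF₅ ⟨h4₅, h1₅, ht₅⟩
      refine ⟨⟨?_, ?_⟩, ?_, ?_⟩
      · rw [hF₅.draws (by decide), hF₄.draws (by decide), hF₃.draws (by decide), hd₂, hd₁]
        rfl
      · rw [hF₅.natReg 9 (by decide), h9₄, hF₅.natArr 3 (by decide), h3₄, h4₅, h1₅,
          hF₄.realArr 4 (by decide), hF₃.realArr 4 (by decide), hF₂.realArr 4 (by decide),
          hF₄.realArr 1 (by decide), hF₃.realArr 1 (by decide), hF₂.realArr 1 (by decide),
          hF₃.natArr 3 (by decide), e3, samples, hm']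
        exact hT'
      · have : R * 18 ≤ k * 18 := Nat.mul_le_mul_right _ hRk
        omega
      · rw [hF₅.queries (by decide), hF₄.queries (by decide)]
        have := hF₂.queries (by decide)
        omega
  · rintro s' ⟨⟨h₁, h₂⟩, h₃, h₄⟩
    exact ⟨h₂, h₃, h₄⟩

theorem outputCode_spec (hs : Data n d a s) (h9 : s.natReg 9 = R) (hR : R ≤ n) :
    WP ω O outputCode (fun s' =>
      (∀ r < R, ∀ j < d, s'.realArr 1 (r * d + j) = s.realArr 1 (r * d + j) / s.realArr 4 r) ∧
      s'.time ≤ s.time + R * (d * 24 + 14) + 6) s := by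
  rw [outputCode]
  refine (WP.forUpTo (fun i s' => ∀ r < n, ∀ j < d, s'.realArr 1 (r * d + j) =
      if r < i then s.realArr 1 (r * d + j) / s.realArr 4 r else s.realArr 1 (r * d + j))
    R (d * 24 + 6) 0 h9 (by decide) (by decide) (by decide) ?_ ?_ ?_).mono ?_
  · intro i s v t h
    simpa using h
  · simp
  · rintro i s₁ hi h11 h₁ hF
    have hs₁ : Data n d a s₁ := hs.frame hF
    have e4 : s₁.realArr 4 = s.realArr 4 := hF.realArr 4 (by decide)
    refine (WP.forUpTo (fun j' s' => ∀ r < n, ∀ j < d, s'.realArr 1 (r * d + j) =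
        if r < i ∨ r = i ∧ j < j' then s.realArr 1 (r * d + j) / s.realArr 4 r
          else s.realArr 1 (r * d + j))
      d 16 0 hs₁.dim (by decide) (by decide) (by decide) ?_ ?_ ?_).mono ?_
    · intro i s v t h
      simpa using h
    · simpa using h₁
    · rintro j s₂ hj h6 h₂ hF₂
      have hs₂ : Data n d a s₂ := hs₁.frame hF₂
      have e11 : s₂.natReg 11 = i := (hF₂.natReg 11 (by decide)).trans h11
      have e4' : s₂.realArr 4 = s.realArr 4 := (hF₂.realArr 4 (by decide)).trans e4
      simp only [wp_storeReal, State.tick, NatExpr.val, NatExpr.size, RealExpr.val,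
        RealExpr.size, slot, e11, h6, hs₂.base i (by omega), e4', h₂ i (by omega) j hj]
      refine ⟨fun r hr j' hj' => ?_, by omega, by omega⟩
      rw [Function.update_self]
      by_cases hrj : r * d + j' = i * d + j
      · have hri : r = i := by
          rcases Nat.lt_trichotomy r i with h | h | h
          · have := mul_add_lt_of_lt h hj'
            omega
          · exact h
          · have := mul_add_lt_of_lt h hj
            omega
        subst hri
        have hjj : j' = j := by omega
        subst hjj
        simp
      · rw [Function.update_of_ne hrj, h₂ r hr j' hj']
        congr 1
        simp only [eq_iff_iff]
        constructor
        · rintro (h | ⟨h, h'⟩) <;> omega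
        · rintro (h | ⟨rfl, h'⟩)
          · exact Or.inl h
          · exact Or.inr ⟨rfl, by omega⟩
    · rintro s₂ ⟨h₂, h₃, h₄⟩
      refine ⟨fun r hr j hj => ?_, by omega, by omega⟩
      rw [h₂ r hr j hj]
      congr 1
      simp only [eq_iff_iff]
      omega
  · rintro s' ⟨h₁, h₂, -⟩
    exact ⟨fun r hr j hj => by rw [h₁ r (by omega) j hj, if_pos hr], h₂⟩

end Specifications

end KMeans

namespace KMeans

open RealRAM Program

/-! ### The complete program -/

/-- The number `1600 k²` of seeds. -/
def seedBound : RealExpr := .mul (.const 1600) (.mul (.ofNat (.reg 2)) (.ofNat (.reg 2)))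

/-- The bound `2 · 10¹¹ k⁵ / ε²` for the number of samples. -/
def sampleBound : RealExpr :=
  .div (.mul (.const 200000000000) (.mul (.ofNat (.reg 2)) (.mul (.ofNat (.reg 2))
    (.mul (.ofNat (.reg 2)) (.mul (.ofNat (.reg 2)) (.ofNat (.reg 2)))))))
    (.mul (.reg 0) (.reg 0))

/-- The query algorithm for `k`-means: seeding by `D²`-sampling, then importance sampling with
labels from the oracle. -/
def clusterCode : Program :=
  .seq (.setReal 1 seedBound) (.seq (ceilCode 3) (.seq (.setReal 1 sampleBound) (.seq (ceilCode 4)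
    (.seq baseCode (.seq seedCode (.seq weightCode (.seq tallyCode outputCode)))))))

/-- The number of seeds. -/
noncomputable def numSeeds (k : ℕ) : ℕ := ⌈(1600 * (k * k) : ℝ)⌉₊

/-- The number of samples. -/
noncomputable def numSamples (k : ℕ) (ε : ℝ) : ℕ :=
  ⌈(200000000000 * (k * (k * (k * (k * k)))) / (ε * ε) : ℝ)⌉₊

open Classical in
/-- The algorithm halts in time, and its output contains the self-normalized importance sampling
estimate of the centroid of every cluster that has been sampled. -/
theorem clusterCode_spec {ω : ℕ → unitInterval} {O : ℕ → ℕ → Prop} {s : State} {α : Type*}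
    {y : ℕ → α} {n d k K N : ℕ} {ε : ℝ} {a : ℕ → ℝ} {D : ℕ → ℕ → ℝ} {v : ℕ → ℝ}
    (hO : ∀ i < n, ∀ j < n, (O i j ↔ y i = y j))
    (hk : ((Finset.range n).image y).card ≤ k) (hn : 0 < n)
    (h0 : s.natReg 0 = n) (h1 : s.natReg 1 = d) (h2 : s.natReg 2 = k) (h9 : s.natReg 9 = 0)
    (hε : s.realReg 0 = ε) (ha : s.realArr 0 = a) (harr : ∀ b t, b ≠ 0 → s.realArr b t = 0)
    (hnat : ∀ b t, s.natArr b t = 0) (hdraws : s.draws = 0)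
    (hK : K = numSeeds k) (hN : N = numSamples k ε)
    (hD : D = arrDist d a) (hv : v = weight D n (seeds D n ω K)) :
    WP ω O clusterCode (fun s' =>
      (∀ m ∈ samples v n ω K N, ∃ r < k, ∀ j < d, s'.realArr 1 (r * d + j) =
        classSum v (fun m => a (m * d + j)) y (samples v n ω K N) (y m) /
          classSum v (fun _ => 1) y (samples v n ω K N) (y m)) ∧
      s'.time ≤ s.time + (K * 9 + N * 9 + n * 15 + K * (n * (d * 34 + 72) + 44) + n * 50 +
        N * (n * 32 + k * 18 + d * 28 + 73) + n * (d * 24 + 14) + 150) ∧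
      s'.queries ≤ s.queries + N * k) s := by
  subst hD
  rw [clusterCode, wp_seq, wp_setReal, wp_seq]
  refine (ceilCode_spec 3).frame ?_
  rintro s₁ hF₁ ⟨hK₁, ht₁⟩
  have eK : ⌈(State.tick (seedBound.size + 1) { s with
      realReg := Function.update s.realReg 1 (seedBound.val s) }).realReg 1⌉₊ = K := by
    simp [State.tick, seedBound, RealExpr.val, NatExpr.val, h2, hK, numSeeds]
  rw [eK] at hK₁ ht₁
  have eε₁ : s₁.realReg 0 = ε := by
    rw [hF₁.realReg 0 (by decide)]
    simpa [State.tick] using hε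
  have e2₁ : s₁.natReg 2 = k := (hF₁.natReg 2 (by decide)).trans h2
  rw [wp_seq, wp_setReal, wp_seq]
  refine (ceilCode_spec 4).frame ?_
  rintro s₂ hF₂ ⟨hN₂, ht₂⟩
  have eN : ⌈(State.tick (sampleBound.size + 1) { s₁ with
      realReg := Function.update s₁.realReg 1 (sampleBound.val s₁) }).realReg 1⌉₊ = N := by
    simp [State.tick, sampleBound, RealExpr.val, NatExpr.val, e2₁, eε₁, hN, numSamples]
  rw [eN] at hN₂ ht₂
  have hnatReg : ∀ r, r ≠ 3 → r ≠ 4 → s₂.natReg r = s.natReg r := by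
    intro r h3 h4
    rw [hF₂.natReg r (by simp [ceilCode, natRegs, h4])]
    exact hF₁.natReg r (by simp [ceilCode, natRegs, h3])
  have hrealArr : s₂.realArr = s.realArr := by
    funext b
    rw [hF₂.realArr b (by simp [ceilCode, realArrs])]
    exact hF₁.realArr b (by simp [ceilCode, realArrs])
  have hnatArr : s₂.natArr = s.natArr := by
    funext b
    rw [hF₂.natArr b (by simp [ceilCode, natArrs])]
    exact hF₁.natArr b (by simp [ceilCode, natArrs])
  have hdraws₂ : s₂.draws = 0 := by
    rw [hF₂.draws (by decide)]
    exact (hF₁.draws (by decide)).trans hdraws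
  have hqueries₂ : s₂.queries = s.queries := by
    rw [hF₂.queries (by decide)]
    exact hF₁.queries (by decide)
  have hK₂ : s₂.natReg 3 = K := (hF₂.natReg 3 (by decide)).trans hK₁
  rw [wp_seq]
  refine (baseCode_spec (n := n) (d := d) (by rw [hnatReg 0 (by decide) (by decide), h0])
    (by rw [hnatReg 1 (by decide) (by decide), h1])).frame ?_
  rintro s₃ hF₃ ⟨hbase, ht₃⟩
  have hs₃ : Data n d a s₃ := by
    refine ⟨?_, ?_, ?_, hbase⟩
    · rw [hF₃.natReg 0 (by decide), hnatReg 0 (by decide) (by decide), h0]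
    · rw [hF₃.natReg 1 (by decide), hnatReg 1 (by decide) (by decide), h1]
    · rw [hF₃.realArr 0 (by decide), hrealArr, ha]
  rw [wp_seq]
  refine (seedCode_spec (K := K) hs₃ hn ?_ ?_ ?_ ?_).frame ?_
  · rw [hF₃.natReg 3 (by decide), hK₂]
  · rw [hF₃.draws (by decide), hdraws₂]
  · intro i
    rw [hF₃.realArr 2 (by decide), hrealArr, harr 2 i (by decide)]
  · intro i
    rw [hF₃.natArr 1 (by decide), hnatArr, hnat]
  rintro s₄ hF₄ ⟨hd₄, hw₄, hc₄, ht₄⟩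
  have hs₄ : Data n d a s₄ := hs₃.frame hF₄
  rw [wp_seq]
  refine (weightCode_spec hs₄ hw₄ hc₄ ?_).frame ?_
  · intro t
    rw [hF₄.natArr 2 (by decide), hF₃.natArr 2 (by decide), hnatArr, hnat]
  rintro s₅ hF₅ ⟨hv₅, ht₅⟩
  have hs₅ : Data n d a s₅ := hs₄.frame hF₅
  rw [← hv] at hv₅
  rw [wp_seq]
  refine (tallyCode_spec (N := N) (K := K) hO hk hs₅ hn ?_ ?_ hv₅ ?_ ?_ ?_).frame ?_
  · rw [hF₅.natReg 4 (by decide), hF₄.natReg 4 (by decide), hF₃.natReg 4 (by decide), hN₂]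
  · rw [hF₅.draws (by decide), hd₄]
  · rw [hF₅.natReg 9 (by decide), hF₄.natReg 9 (by decide), hF₃.natReg 9 (by decide),
      hnatReg 9 (by decide) (by decide), h9]
  · intro t
    rw [hF₅.realArr 1 (by decide), hF₄.realArr 1 (by decide), hF₃.realArr 1 (by decide),
      hrealArr, harr 1 t (by decide)]
  · intro t
    rw [hF₅.realArr 4 (by decide), hF₄.realArr 4 (by decide), hF₃.realArr 4 (by decide),
      hrealArr, harr 4 t (by decide)]
  rintro s₆ hF₆ ⟨hT, ht₆, hq₆⟩
  have hs₆ : Data n d a s₆ := hs₅.frame hF₆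
  have hRn : s₆.natReg 9 ≤ n :=
    hT.le_card.trans (Finset.card_image_le.trans (Finset.card_range n).le)
  refine (outputCode_spec hs₆ rfl hRn).frame ?_
  rintro s₇ hF₇ ⟨hout, ht₇⟩
  refine ⟨fun m hm => ?_, ?_, ?_⟩
  · obtain ⟨r, hr, hy⟩ := hT.mem m hm
    refine ⟨r, hr.trans_le (hT.le_card.trans hk), fun j hj => ?_⟩
    rw [hout r hr j hj, hT.sum r hr j hj, hT.total r hr, hy]
  · have hR := Nat.mul_le_mul_right (d * 24 + 14) hRn
    simp only [State.tick, seedBound, sampleBound, RealExpr.size, NatExpr.size] at ht₁ ht₂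
    omega
  · rw [hF₇.queries (by decide)]
    refine hq₆.trans (le_of_eq ?_)
    rw [hF₅.queries (by decide), hF₄.queries (by decide), hF₃.queries (by decide), hqueries₂]

end KMeans

namespace KMeans

open RealRAM

/-! ### The law of the sampler -/

theorem le_pick_iff {w : ℕ → ℝ} {n i : ℕ} (hw : ∀ i < n, 0 ≤ w i) {θ : ℝ} (hθ : 0 ≤ θ)
    (hi : i < n) :
    i ≤ pick w n θ ↔ ∑ j ∈ Finset.range i, w j ≤ θ := by
  induction n with
  | zero => omega
  | succ n ih =>
    rw [pick]
    have hmono : ∀ i ≤ n, ∑ j ∈ Finset.range i, w j ≤ ∑ j ∈ Finset.range n, w j := fun i hi =>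
      Finset.sum_le_sum_of_subset_of_nonneg (by simpa using hi)
        fun j hj _ => hw j (by have := Finset.mem_range.1 hj; omega)
    split_ifs with h
    · rcases Nat.lt_succ_iff_lt_or_eq.1 hi with hi' | rfl
      · exact ih (fun j hj => hw j (by omega)) hi'
      · constructor
        · intro hle
          rcases Nat.eq_zero_or_pos i with rfl | hpos
          · simpa using hθ
          · exact absurd (pick_lt w hpos θ) (by omega)
        · intro hle
          linarith
    · exact ⟨fun _ => (hmono i (by omega)).trans (not_lt.1 h), fun _ => by omega⟩

theorem measurable_pick (w : ℕ → ℝ) (n : ℕ) : Measurable (pick w n) := by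
  induction n with
  | zero => exact measurable_const
  | succ n ih =>
    exact Measurable.ite (measurableSet_lt measurable_id measurable_const) ih measurable_const

theorem measurableSet_sampleIdx (w : ℕ → ℝ) (n i : ℕ) :
    MeasurableSet {u : unitInterval | sampleIdx w n u = i} := by
  have h : Measurable fun u : unitInterval => sampleIdx w n u :=
    (measurable_pick w n).comp (measurable_subtype_coe.mul_const _)
  exact h (measurableSet_singleton i)

theorem volume_le_sampleIdx {w : ℕ → ℝ} {n i : ℕ} (hw : ∀ i < n, 0 ≤ w i)
    (hW : 0 < ∑ j ∈ Finset.range n, w j) (hi : i ≤ n) :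
    (volume {u : unitInterval | i ≤ sampleIdx w n u}) = ENNReal.ofReal
      (1 - (∑ j ∈ Finset.range i, w j) / ∑ j ∈ Finset.range n, w j) := by
  have hn : 0 < n := by
    rcases Nat.eq_zero_or_pos n with rfl | h
    · simp at hW
    · exact h
  rcases hi.lt_or_eq with hi | rfl
  · have h0 : 0 ≤ ∑ j ∈ Finset.range i, w j := Finset.sum_nonneg fun j hj =>
      hw j (by have := Finset.mem_range.1 hj; omega)
    have h1 : ∑ j ∈ Finset.range i, w j ≤ ∑ j ∈ Finset.range n, w j :=
      Finset.sum_le_sum_of_subset_of_nonneg (by simpa using hi.le)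
        fun j hj _ => hw j (Finset.mem_range.1 hj)
    have : {u : unitInterval | i ≤ sampleIdx w n u} = Set.Ici
        ⟨(∑ j ∈ Finset.range i, w j) / ∑ j ∈ Finset.range n, w j,
          div_nonneg h0 hW.le, (div_le_one hW).2 h1⟩ := by
      ext u
      rw [Set.mem_ofPred_eq, sampleIdx, le_pick_iff hw (mul_nonneg u.2.1 hW.le) hi, Set.mem_Ici,
        ← Subtype.coe_le_coe, div_le_iff₀ hW]
    rw [this, unitInterval.volume_Ici]
  · have : {u : unitInterval | i ≤ sampleIdx w i u} = ∅ := by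
      ext u
      simpa [sampleIdx] using pick_lt w hn _
    rw [this, div_self hW.ne']
    simp

/-- Inverse transform sampling: the index `i` is drawn with probability proportional to `w i`. -/
theorem volume_sampleIdx_eq {w : ℕ → ℝ} {n i : ℕ} (hw : ∀ i < n, 0 ≤ w i)
    (hW : 0 < ∑ j ∈ Finset.range n, w j) (hi : i < n) :
    volume.real {u : unitInterval | sampleIdx w n u = i} =
      w i / ∑ j ∈ Finset.range n, w j := by
  have hset : {u : unitInterval | sampleIdx w n u = i} =
      {u : unitInterval | i ≤ sampleIdx w n u} \ {u : unitInterval | i + 1 ≤ sampleIdx w n u} := by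
    ext u
    simp only [Set.mem_ofPred_eq, Set.mem_sdiff]
    omega
  have hmeas : MeasurableSet {u : unitInterval | i + 1 ≤ sampleIdx w n u} := by
    have h : Measurable fun u : unitInterval => sampleIdx w n u :=
      (measurable_pick w n).comp (measurable_subtype_coe.mul_const _)
    exact h measurableSet_Ici
  have hle : ∀ j ≤ n, 0 ≤ 1 - (∑ j ∈ Finset.range j, w j) / ∑ j ∈ Finset.range n, w j := by
    intro j hj
    rw [sub_nonneg, div_le_one hW]
    exact Finset.sum_le_sum_of_subset_of_nonneg (by simpa using hj)
        fun j hj _ => hw j (Finset.mem_range.1 hj)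
  have hsub : {u : unitInterval | i + 1 ≤ sampleIdx w n u} ⊆
      {u : unitInterval | i ≤ sampleIdx w n u} := fun u hu => Nat.le_of_succ_le hu
  rw [hset, measureReal_sdiff hsub hmeas, measureReal_def,
    measureReal_def, volume_le_sampleIdx hw hW hi.le, volume_le_sampleIdx hw hW hi,
    ENNReal.toReal_ofReal (hle i hi.le), ENNReal.toReal_ofReal (hle (i + 1) hi),
    Finset.sum_range_succ]
  ring

theorem sum_volume_sampleIdx (w : ℕ → ℝ) {n : ℕ} (hn : 0 < n) :
    ∑ i ∈ Finset.range n, volume.real {u : unitInterval | sampleIdx w n u = i} = 1 := by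
  rw [← measureReal_biUnion_finset]
  · have : ⋃ i ∈ Finset.range n, {u : unitInterval | sampleIdx w n u = i} = Set.univ := by
      ext u
      simpa [sampleIdx] using pick_lt w hn _
    rw [this]
    simp
  · intro i _ j _ hij
    refine Set.disjoint_left.2 fun u hu hu' => hij ?_
    exact (hu : sampleIdx w n u = i).symm.trans hu'
  · exact fun i _ => measurableSet_sampleIdx w n i

/-! ### Adaptive sampling -/

/-- The expectation of `F` after `T` more steps of a process with values below `n`, whose next
value is `i` with probability `q h i` if the past is `h` (newest value first). -/
noncomputable def expect (n : ℕ) (q : List ℕ → ℕ → ℝ) : ℕ → (List ℕ → ℝ) → List ℕ → ℝ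
  | 0, F, h => F h
  | T + 1, F, h => ∑ i ∈ Finset.range n, q h i * expect n q T F (i :: h)

/-- The process with the step function `f`, driven by the tape `ω`; newest value first. -/
def process (f : List ℕ → unitInterval → ℕ) (ω : ℕ → unitInterval) : ℕ → List ℕ
  | 0 => []
  | T + 1 => f (process f ω T) (ω T) :: process f ω T

theorem length_process (f : List ℕ → unitInterval → ℕ) (ω : ℕ → unitInterval) (T : ℕ) :
    (process f ω T).length = T := by
  induction T with
  | zero => rfl
  | succ T ih => simp [process, ih]

/-- The random numbers that are allowed at time `t` if the process has the past `h`. -/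
def box (f : List ℕ → unitInterval → ℕ) : List ℕ → ℕ → Set unitInterval
  | [], _ => Set.univ
  | i :: h, t => if t = h.length then {u | f h u = i} else box f h t

theorem process_eq_iff {f : List ℕ → unitInterval → ℕ} {ω : ℕ → unitInterval} (h : List ℕ) :
    process f ω h.length = h ↔ ∀ t < h.length, ω t ∈ box f h t := by
  induction h with
  | nil => simp [process]
  | cons i h ih =>
    rw [List.length_cons, process, List.cons.injEq]
    constructor
    · rintro ⟨h₁, h₂⟩ t ht
      rw [box]
      split_ifs with h'
      · rw [h₂] at h₁
        rw [h']
        exact h₁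
      · exact ih.1 h₂ t (by omega)
    · intro h'
      have h₂ : process f ω h.length = h := by
        rw [ih]
        intro t ht
        have := h' t (by omega)
        rwa [box, if_neg (by omega)] at this
      refine ⟨?_, h₂⟩
      have := h' h.length (by omega)
      rw [box, if_pos rfl] at this
      rw [h₂]
      exact this

/-- The event that the process has the past `h` is a box, so its probability is a product. -/
theorem randomTape_process_eq_cons {f : List ℕ → unitInterval → ℕ}
    (hf : ∀ h i, MeasurableSet {u | f h u = i}) (i : ℕ) (h : List ℕ) :
    randomTape {ω | process f ω (h.length + 1) = i :: h} =
      randomTape {ω | process f ω h.length = h} * volume {u | f h u = i} := by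
  have hbox : ∀ h t, MeasurableSet (box f h t) := by
    intro h t
    induction h with
    | nil => exact MeasurableSet.univ
    | cons i h ih => rw [box]; split_ifs; exacts [hf h i, ih]
  have hset : ∀ h : List ℕ, randomTape {ω | process f ω h.length = h} =
      ∏ t ∈ Finset.range h.length, volume (box f h t) := by
    intro h
    rw [randomTape, ← Measure.infinitePi_pi _ (fun t _ => hbox h t)]
    congr 1
    ext ω
    simp [process_eq_iff, Set.mem_pi]
  have h' := hset (i :: h)
  rw [List.length_cons, Finset.prod_range_succ] at h'
  rw [h', hset h]
  congr 1
  · refine Finset.prod_congr rfl fun t ht => ?_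
    rw [box, if_neg (Finset.mem_range.1 ht).ne]
  · rw [box, if_pos rfl]

theorem expect_nonneg {n : ℕ} {q : List ℕ → ℕ → ℝ} (hq : ∀ h i, 0 ≤ q h i) {F : List ℕ → ℝ}
    (hF : ∀ h, 0 ≤ F h) (T : ℕ) (h : List ℕ) : 0 ≤ expect n q T F h := by
  induction T generalizing h with
  | zero => exact hF h
  | succ T ih => exact Finset.sum_nonneg fun i _ => mul_nonneg (hq h i) (ih _)

open Classical in
/-- Probabilities of events that depend on finitely many steps of the process are expectations in
the sense of `expect`. -/
theorem randomTape_process_le {n : ℕ} {f : List ℕ → unitInterval → ℕ}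
    (hf : ∀ h i, MeasurableSet {u | f h u = i}) (hn : ∀ h u, f h u < n) (B : List ℕ → Prop)
    (T : ℕ) :
    randomTape {ω | B (process f ω T)} ≤ ENNReal.ofReal
      (expect n (fun h i => volume.real {u | f h u = i}) T (fun h => if B h then 1 else 0) []) := by
  set q : List ℕ → ℕ → ℝ := fun h i => volume.real {u | f h u = i} with hq
  set F : List ℕ → ℝ := fun h => if B h then 1 else 0 with hF
  have hq0 : ∀ h i, 0 ≤ q h i := fun h i => measureReal_nonneg
  have hF0 : ∀ h, 0 ≤ F h := by
    intro h
    simp only [hF]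
    split_ifs <;> simp
  have key : ∀ T h, randomTape {ω | process f ω h.length = h ∧ B (process f ω (h.length + T))} ≤
      randomTape {ω | process f ω h.length = h} * ENNReal.ofReal (expect n q T F h) := by
    intro T
    induction T with
    | zero =>
      intro h
      by_cases hB : B h
      · simp only [expect, hF, if_pos hB, ENNReal.ofReal_one, mul_one]
        exact measure_mono fun ω hω => hω.1
      · have : {ω | process f ω h.length = h ∧ B (process f ω (h.length + 0))} = ∅ := by
          ext ω
          simp only [add_zero, Set.mem_ofPred_eq, Set.mem_empty_iff_false, iff_false, not_and]
          intro h'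
          rwa [h']
        rw [this]
        simp
    | succ T ih =>
      intro h
      calc randomTape {ω | process f ω h.length = h ∧ B (process f ω (h.length + (T + 1)))}
          ≤ randomTape (⋃ i ∈ Finset.range n, {ω | process f ω (i :: h).length = i :: h ∧
              B (process f ω ((i :: h).length + T))}) := by
            refine measure_mono fun ω hω => ?_
            simp only [Set.mem_iUnion, Finset.mem_range, exists_prop]
            refine ⟨f h (ω h.length), hn _ _, ?_, ?_⟩
            · rw [List.length_cons, process, hω.1]
            · have := hω.2
              rwa [List.length_cons, add_assoc, add_comm 1 T]
        _ ≤ ∑ i ∈ Finset.range n, randomTape {ω | process f ω (i :: h).length = i :: h ∧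
              B (process f ω ((i :: h).length + T))} := measure_biUnion_finset_le _ _
        _ ≤ ∑ i ∈ Finset.range n, randomTape {ω | process f ω h.length = h} *
              ENNReal.ofReal (q h i * expect n q T F (i :: h)) := by
            refine Finset.sum_le_sum fun i _ => (ih _).trans (le_of_eq ?_)
            rw [List.length_cons, randomTape_process_eq_cons hf, mul_assoc,
              ENNReal.ofReal_mul (hq0 h i), hq, ofReal_measureReal]
        _ = randomTape {ω | process f ω h.length = h} *
              ENNReal.ofReal (expect n q (T + 1) F h) := by
            rw [← Finset.mul_sum, expect, ENNReal.ofReal_sum_of_nonneg]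
            exact fun i _ => mul_nonneg (hq0 h i) (expect_nonneg hq0 hF0 _ _)
  have := key T []
  have hprob : IsProbabilityMeasure randomTape := by
    unfold randomTape
    infer_instance
  simpa [process] using this

section Expect

variable {n : ℕ} {q : List ℕ → ℕ → ℝ}

theorem expect_add (S T : ℕ) (F : List ℕ → ℝ) (h : List ℕ) :
    expect n q (S + T) F h = expect n q S (expect n q T F) h := by
  induction S generalizing h with
  | zero => simp [expect]
  | succ S ih =>
    rw [Nat.succ_add, expect, expect]
    exact Finset.sum_congr rfl fun i _ => by rw [ih]

theorem expect_mono (hq : ∀ h i, 0 ≤ q h i) {F G : List ℕ → ℝ} (T : ℕ) (h : List ℕ)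
    (hFG : ∀ h', h'.length = h.length + T → F h' ≤ G h') :
    expect n q T F h ≤ expect n q T G h := by
  induction T generalizing h with
  | zero => exact hFG h rfl
  | succ T ih =>
    refine Finset.sum_le_sum fun i _ => mul_le_mul_of_nonneg_left (ih _ fun h' hh' => ?_) (hq h i)
    exact hFG h' (by rw [hh', List.length_cons]; omega)

theorem expect_const (hq : ∀ h, ∑ i ∈ Finset.range n, q h i = 1) (c : ℝ) (T : ℕ) (h : List ℕ) :
    expect n q T (fun _ => c) h = c := by
  induction T generalizing h with
  | zero => rfl
  | succ T ih => simp only [expect, ih]; rw [← Finset.sum_mul, hq, one_mul]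

theorem expect_linear (a b : ℝ) (F G : List ℕ → ℝ) (T : ℕ) (h : List ℕ) :
    expect n q T (fun h => a * F h + b * G h) h =
      a * expect n q T F h + b * expect n q T G h := by
  induction T generalizing h with
  | zero => rfl
  | succ T ih =>
    simp only [expect, ih, Finset.mul_sum, ← Finset.sum_add_distrib]
    exact Finset.sum_congr rfl fun i _ => by ring

theorem expect_finsetSum {ι : Type*} (s : Finset ι) (F : ι → List ℕ → ℝ) (T : ℕ) (h : List ℕ) :
    expect n q T (fun h => ∑ c ∈ s, F c h) h = ∑ c ∈ s, expect n q T (F c) h := by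
  induction T generalizing h with
  | zero => rfl
  | succ T ih =>
    simp only [expect, ih, Finset.mul_sum]
    exact Finset.sum_comm

theorem expect_mul_left (a : ℝ) (F : List ℕ → ℝ) (T : ℕ) (h : List ℕ) :
    expect n q T (fun h => a * F h) h = a * expect n q T F h := by
  simpa using expect_linear (n := n) (q := q) a 0 F 0 T h

open Classical in
/-- Markov's inequality. -/
theorem expect_ite_lt_mul_le (hq : ∀ h i, 0 ≤ q h i) {F : List ℕ → ℝ} (hF : ∀ h, 0 ≤ F h) (b : ℝ)
    (T : ℕ) (h : List ℕ) :
    b * expect n q T (fun h => if b ≤ F h then 1 else 0) h ≤ expect n q T F h := by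
  rw [← expect_mul_left]
  refine expect_mono hq T h fun h' _ => ?_
  split_ifs with hb
  · simpa using hb
  · simpa using hF h'

/-- If every step multiplies the expectation of `G` by at most `ρ`, then `T` steps multiply it by
at most `ρ ^ T`. -/
theorem expect_le_pow_mul (hq : ∀ h i, 0 ≤ q h i) {G : List ℕ → ℝ} {ρ : ℝ} (hρ : 0 ≤ ρ)
    (hG : ∀ h, h ≠ [] → ∑ i ∈ Finset.range n, q h i * G (i :: h) ≤ ρ * G h) (T : ℕ) (h : List ℕ)
    (hh : h ≠ []) : expect n q T G h ≤ ρ ^ T * G h := by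
  induction T generalizing h with
  | zero => simp [expect]
  | succ T ih =>
    calc expect n q (T + 1) G h
        ≤ ∑ i ∈ Finset.range n, q h i * (ρ ^ T * G (i :: h)) :=
          Finset.sum_le_sum fun i _ => mul_le_mul_of_nonneg_left (ih _ (by simp)) (hq h i)
      _ = ρ ^ T * ∑ i ∈ Finset.range n, q h i * G (i :: h) := by
          rw [Finset.mul_sum]
          exact Finset.sum_congr rfl fun i _ => by ring
      _ ≤ ρ ^ T * (ρ * G h) := mul_le_mul_of_nonneg_left (hG h hh) (pow_nonneg hρ T)
      _ = ρ ^ (T + 1) * G h := by ring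

/-- Only the law of the next `T` steps matters. -/
theorem expect_congr {q' : List ℕ → ℕ → ℝ} (T : ℕ) (F : List ℕ → ℝ) (h : List ℕ)
    (hq : ∀ h', h'.length < h.length + T → ∀ i < n, q h' i = q' h' i) :
    expect n q T F h = expect n q' T F h := by
  induction T generalizing h with
  | zero => rfl
  | succ T ih =>
    refine Finset.sum_congr rfl fun i hi => ?_
    rw [hq h (by omega) i (Finset.mem_range.1 hi),
      ih (i :: h) fun h' hh' => hq h' (by rw [List.length_cons] at hh'; omega)]

/-- After the past `L` the process is a sequence of independent values with the law `p`. -/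
theorem expect_append {p : ℕ → ℝ} {L : List ℕ} (hqp : ∀ l, ∀ i < n, q (l ++ L) i = p i) (T : ℕ)
    (F : List ℕ → ℝ) (l : List ℕ) :
    expect n q T F (l ++ L) = expect n (fun _ => p) T (fun l => F (l ++ L)) l := by
  induction T generalizing l with
  | zero => rfl
  | succ T ih =>
    refine Finset.sum_congr rfl fun i hi => ?_
    rw [hqp l i (Finset.mem_range.1 hi), ← ih (i :: l), List.cons_append]

/-- The second moment of a sum of independent centered vectors. -/
theorem expect_norm_sum_sq {E : Type*} [NormedAddCommGroup E] [InnerProductSpace ℝ E] {p : ℕ → ℝ}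
    (hp : ∑ i ∈ Finset.range n, p i = 1) {g : ℕ → E}
    (hg : ∑ i ∈ Finset.range n, p i • g i = 0) (T : ℕ) (l : List ℕ) :
    expect n (fun _ => p) T (fun l => ‖(l.map g).sum‖ ^ 2) l =
      ‖(l.map g).sum‖ ^ 2 + T * ∑ i ∈ Finset.range n, p i * ‖g i‖ ^ 2 := by
  induction T generalizing l with
  | zero => simp [expect]
  | succ T ih =>
    simp only [expect, ih, List.map_cons, List.sum_cons]
    set z := (l.map g).sum
    have h0 : ∑ i ∈ Finset.range n, p i * inner ℝ (g i) z = 0 := by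
      have := congrArg (fun v => inner ℝ v z) hg
      simpa [sum_inner, inner_smul_left] using this
    have : ∀ i ∈ Finset.range n, p i * (‖g i + z‖ ^ 2 +
        T * ∑ i ∈ Finset.range n, p i * ‖g i‖ ^ 2) = p i * ‖g i‖ ^ 2 +
        2 * (p i * inner ℝ (g i) z) + p i * (‖z‖ ^ 2 +
          T * ∑ i ∈ Finset.range n, p i * ‖g i‖ ^ 2) := by
      intro i _
      rw [norm_add_sq_real]
      ring
    rw [Finset.sum_congr rfl this, Finset.sum_add_distrib, Finset.sum_add_distrib,
      ← Finset.mul_sum, h0, ← Finset.sum_mul, hp]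
    push_cast
    ring

end Expect

end KMeans

set_option linter.unusedSectionVars false

namespace KMeans

/-! ### Seeding by `D²`-sampling -/

section MinDist

variable {D : ℕ → ℕ → ℝ} {L : List ℕ} {m i : ℕ}

theorem minDist_nonneg (hD : ∀ i m, 0 ≤ D i m) (L : List ℕ) (i : ℕ) : 0 ≤ minDist D L i := by
  induction L with
  | nil => exact le_rfl
  | cons m L ih => rw [minDist]; split_ifs; exacts [hD i m, ih]

theorem minDist_cons_le : minDist D (m :: L) i ≤ D i m := by
  rw [minDist]
  split_ifs with h
  · exact le_rfl
  · exact not_lt.1 (not_or.1 h).2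

theorem minDist_cons_le_minDist (hL : L ≠ []) : minDist D (m :: L) i ≤ minDist D L i := by
  have : 0 < L.length := List.length_pos_iff.2 hL
  rw [minDist]
  split_ifs with h
  · rcases h with h | h
    · omega
    · exact h.le
  · exact le_rfl

theorem minDist_le (hm : m ∈ L) : minDist D L i ≤ D i m := by
  induction L with
  | nil => simp at hm
  | cons m' L ih =>
    rcases List.mem_cons.1 hm with rfl | hm
    · exact minDist_cons_le
    · exact (minDist_cons_le_minDist (List.ne_nil_of_mem hm)).trans (ih hm)

theorem nearest_lt (hL : L ≠ []) : nearest D L i < L.length := by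
  induction L with
  | nil => exact absurd rfl hL
  | cons m L ih =>
    rw [nearest, List.length_cons]
    split_ifs with h
    · exact Nat.lt_succ_self _
    · refine (ih ?_).trans (Nat.lt_succ_self _)
      rintro rfl
      exact h (Or.inl (by simp))

/-- All points of a cell have their smallest distance to the same point of the list. -/
theorem exists_minDist_eq (D : ℕ → ℕ → ℝ) (hL : L ≠ []) :
    ∃ z : ℕ → ℕ, (∀ i, minDist D L i = D i (z (nearest D L i))) ∧ ∀ i, z (nearest D L i) ∈ L := by
  induction L with
  | nil => exact absurd rfl hL
  | cons m L ih =>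
    rcases eq_or_ne L [] with rfl | hL
    · exact ⟨fun _ => m, fun i => by simp [minDist], fun i => by simp⟩
    · obtain ⟨z, hz, hz'⟩ := ih hL
      refine ⟨Function.update z L.length m, fun i => ?_, fun i => ?_⟩
      · rw [minDist, nearest]
        split_ifs with h
        · simp
        · rw [Function.update_of_ne (nearest_lt hL).ne, hz i]
      · rw [nearest]
        split_ifs with h
        · simp
        · rw [Function.update_of_ne (nearest_lt hL).ne]
          exact List.mem_cons_of_mem _ (hz' i)

end MinDist

variable {E : Type*} [NormedAddCommGroup E] [InnerProductSpace ℝ E]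

/-- The squared distances of the points `x i`. -/
def sqDist (x : ℕ → E) (i m : ℕ) : ℝ := ‖x i - x m‖ ^ 2

theorem norm_sub_sq_le (a b c : E) : ‖a - c‖ ^ 2 ≤ 2 * ‖a - b‖ ^ 2 + 2 * ‖b - c‖ ^ 2 := by
  have h := norm_sub_le_norm_sub_add_norm_sub a b c
  have h₁ : ‖a - c‖ ^ 2 ≤ (‖a - b‖ + ‖b - c‖) ^ 2 := pow_le_pow_left₀ (norm_nonneg _) h 2
  nlinarith [sq_nonneg (‖a - b‖ - ‖b - c‖)]

theorem minDist_triangle (x : ℕ → E) {L : List ℕ} (hL : L ≠ []) (a b : ℕ) :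
    minDist (sqDist x) L a ≤ 2 * minDist (sqDist x) L b + 2 * ‖x a - x b‖ ^ 2 := by
  obtain ⟨z, hz, hz'⟩ := exists_minDist_eq (sqDist x) hL
  have h₁ := minDist_le (D := sqDist x) (i := a) (hz' b)
  have h₂ := norm_sub_sq_le (x a) (x b) (x (z (nearest (sqDist x) L b)))
  have h₃ := hz b
  simp only [sqDist] at h₁ h₃ ⊢
  linarith

open Classical in
/-- The cluster of the points with the label `c`. -/
noncomputable def cluster (n : ℕ) (y : ℕ → E) (c : E) : Finset ℕ := {i ∈ Finset.range n | y i = c}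

open Classical in
/-- The labels that occur. -/
noncomputable def labels (n : ℕ) (y : ℕ → E) : Finset E := (Finset.range n).image y

/-- The cost of the cluster `c` with respect to its center. -/
noncomputable def spread (n : ℕ) (x y : ℕ → E) (c : E) : ℝ := ∑ i ∈ cluster n y c, ‖x i - c‖ ^ 2

/-- The cost of the clustering `y`. -/
noncomputable def opt (n : ℕ) (x y : ℕ → E) : ℝ := ∑ i ∈ Finset.range n, ‖x i - y i‖ ^ 2

/-- The properties of optimal clusterings that the algorithm relies on: there are at most `k`
clusters, every point is assigned to a closest center, and the centers are the centroids. A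
cluster is named by its center. -/
structure IsCentroidal (n k : ℕ) (x y : ℕ → E) : Prop where
  card_le : (labels n y).card ≤ k
  closest : ∀ i < n, ∀ j < n, ‖x i - y i‖ ≤ ‖x i - y j‖
  centroid : ∀ c, ∑ i ∈ cluster n y c, (x i - c) = 0

theorem mem_cluster {n : ℕ} {y : ℕ → E} {c : E} {i : ℕ} :
    i ∈ cluster n y c ↔ i < n ∧ y i = c := by
  classical simp [cluster]

theorem mem_labels {n : ℕ} {y : ℕ → E} {c : E} : c ∈ labels n y ↔ ∃ i < n, y i = c := by
  classical simp [labels]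

theorem sum_eq_sum_labels (n : ℕ) (y : ℕ → E) {M : Type*} [AddCommMonoid M] (f : ℕ → M) :
    ∑ i ∈ Finset.range n, f i = ∑ c ∈ labels n y, ∑ i ∈ cluster n y c, f i := by
  classical
  exact (Finset.sum_fiberwise_of_maps_to (fun i hi => Finset.mem_image_of_mem y hi) f).symm

variable {n k : ℕ} {x y : ℕ → E}

theorem opt_eq_sum_spread : opt n x y = ∑ c ∈ labels n y, spread n x y c := by
  rw [opt, sum_eq_sum_labels n y]
  refine Finset.sum_congr rfl fun c _ => Finset.sum_congr rfl fun i hi => ?_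
  rw [(mem_cluster.1 hi).2]

theorem spread_nonneg (c : E) : 0 ≤ spread n x y c := Finset.sum_nonneg fun _ _ => by positivity

theorem opt_nonneg : 0 ≤ opt n x y := Finset.sum_nonneg fun _ _ => by positivity

/-- The cost of a cluster with respect to an arbitrary center. -/
theorem IsCentroidal.sum_norm_sub_sq (hy : IsCentroidal n k x y) (c z : E) :
    ∑ i ∈ cluster n y c, ‖x i - z‖ ^ 2 =
      spread n x y c + (cluster n y c).card * ‖c - z‖ ^ 2 := by
  have h : ∑ i ∈ cluster n y c, inner ℝ (x i - c) (c - z) = 0 := by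
    rw [← sum_inner, hy.centroid c, inner_zero_left]
  have h' : ∀ i ∈ cluster n y c, ‖x i - z‖ ^ 2 =
      ‖x i - c‖ ^ 2 + 2 * inner ℝ (x i - c) (c - z) + ‖c - z‖ ^ 2 := by
    intro i _
    rw [← norm_add_sq_real, sub_add_sub_cancel]
  rw [Finset.sum_congr rfl h', Finset.sum_add_distrib, Finset.sum_add_distrib, ← Finset.mul_sum, h,
    Finset.sum_const, nsmul_eq_mul, spread]
  ring

/-- The cost of the cluster `c` with respect to the points of the list `L`. -/
noncomputable def clusterCost (n : ℕ) (x y : ℕ → E) (L : List ℕ) (c : E) : ℝ :=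
  ∑ i ∈ cluster n y c, minDist (sqDist x) L i

/-- The cost of the points of the list `L`. -/
noncomputable def seedCost (n : ℕ) (x : ℕ → E) (L : List ℕ) : ℝ :=
  ∑ i ∈ Finset.range n, minDist (sqDist x) L i

theorem seedCost_eq_sum (L : List ℕ) :
    seedCost n x L = ∑ c ∈ labels n y, clusterCost n x y L c :=
  sum_eq_sum_labels n y _

theorem minDist_sqDist_nonneg (x : ℕ → E) (L : List ℕ) (i : ℕ) : 0 ≤ minDist (sqDist x) L i :=
  minDist_nonneg (fun _ _ => by unfold sqDist; positivity) L i

theorem clusterCost_nonneg (L : List ℕ) (c : E) : 0 ≤ clusterCost n x y L c :=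
  Finset.sum_nonneg fun i _ => minDist_sqDist_nonneg x L i

theorem clusterCost_cons_le {L : List ℕ} (hL : L ≠ []) (m : ℕ) (c : E) :
    clusterCost n x y (m :: L) c ≤ clusterCost n x y L c :=
  Finset.sum_le_sum fun _ _ => minDist_cons_le_minDist hL

theorem seedCost_cons_le {L : List ℕ} (hL : L ≠ []) (m : ℕ) :
    seedCost n x (m :: L) ≤ seedCost n x L :=
  Finset.sum_le_sum fun _ _ => minDist_cons_le_minDist hL

/-- A point of a cluster chosen by `D²`-sampling is, in expectation, an 8-approximate center. -/
theorem IsCentroidal.sum_minDist_mul_clusterCost_le (hy : IsCentroidal n k x y) {L : List ℕ}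
    (hL : L ≠ []) (c : E) :
    ∑ a ∈ cluster n y c, minDist (sqDist x) L a * clusterCost n x y (a :: L) c ≤
      8 * spread n x y c * clusterCost n x y L c := by
  set Y := cluster n y c with hY
  set φ := clusterCost n x y L c with hφ
  rcases Y.eq_empty_or_nonempty with h | h
  · rw [h, Finset.sum_empty]
    exact mul_nonneg (mul_nonneg (by norm_num) (spread_nonneg c)) (clusterCost_nonneg L c)
  have hm : (0 : ℝ) < Y.card := by exact_mod_cast h.card_pos
  set t : ℕ → ℝ := fun a => ∑ b ∈ Y, ‖x b - x a‖ ^ 2 with ht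
  have ht0 : ∀ a, 0 ≤ t a := fun a => Finset.sum_nonneg fun _ _ => by positivity
  have htsum : ∑ a ∈ Y, t a = 2 * Y.card * spread n x y c := by
    have : ∀ a ∈ Y, t a = spread n x y c + Y.card * ‖x a - c‖ ^ 2 := by
      intro a _
      rw [norm_sub_rev (x a) c]
      exact hy.sum_norm_sub_sq c (x a)
    rw [Finset.sum_congr rfl this, Finset.sum_add_distrib, ← Finset.mul_sum, Finset.sum_const,
      nsmul_eq_mul]
    change (Y.card : ℝ) * spread n x y c + Y.card * spread n x y c = _
    ring
  have hD : ∀ a, Y.card * minDist (sqDist x) L a ≤ 2 * φ + 2 * t a := by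
    intro a
    have : ∑ b ∈ Y, minDist (sqDist x) L a ≤
        ∑ b ∈ Y, (2 * minDist (sqDist x) L b + 2 * ‖x b - x a‖ ^ 2) :=
      Finset.sum_le_sum fun b _ => by
        rw [norm_sub_rev]; exact minDist_triangle x hL a b
    rw [Finset.sum_const, nsmul_eq_mul, Finset.sum_add_distrib, ← Finset.mul_sum,
      ← Finset.mul_sum] at this
    exact this
  have hcost : ∀ a, clusterCost n x y (a :: L) c ≤ t a := fun a =>
    Finset.sum_le_sum fun b _ => minDist_cons_le
  have hcost' : ∀ a, clusterCost n x y (a :: L) c ≤ φ := fun a => clusterCost_cons_le hL a c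
  have hφ0 : 0 ≤ φ := clusterCost_nonneg L c
  have hterm : ∀ a ∈ Y, Y.card * (minDist (sqDist x) L a * clusterCost n x y (a :: L) c) ≤
      4 * φ * t a := by
    intro a _
    have h0 := clusterCost_nonneg (n := n) (x := x) (y := y) (a :: L) c
    calc Y.card * (minDist (sqDist x) L a * clusterCost n x y (a :: L) c)
        = (Y.card * minDist (sqDist x) L a) * clusterCost n x y (a :: L) c := by ring
      _ ≤ (2 * φ + 2 * t a) * clusterCost n x y (a :: L) c :=
          mul_le_mul_of_nonneg_right (hD a) h0
      _ ≤ 4 * φ * t a := by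
          nlinarith [mul_le_mul_of_nonneg_left (hcost a) hφ0,
            mul_le_mul_of_nonneg_left (hcost' a) (ht0 a)]
  have hsum := Finset.sum_le_sum hterm
  rw [← Finset.mul_sum, ← Finset.mul_sum, htsum] at hsum
  refine le_of_mul_le_mul_left (hsum.trans (le_of_eq ?_)) hm
  ring

open Classical in
/-- If a point of a cluster is chosen by `D²`-sampling, then with probability at least `1 / 2` it
is a 16-approximate center. -/
theorem IsCentroidal.clusterCost_le_two_mul (hy : IsCentroidal n k x y) {L : List ℕ} (hL : L ≠ [])
    (c : E) :
    clusterCost n x y L c ≤ 2 * ∑ a ∈ cluster n y c,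
      if clusterCost n x y (a :: L) c ≤ 16 * spread n x y c then minDist (sqDist x) L a else 0 := by
  set Y := cluster n y c with hY
  have h := hy.sum_minDist_mul_clusterCost_le hL c
  have hD := minDist_sqDist_nonneg x L
  -- the points that are not good have at most half of the cost
  have hbad : 2 * ∑ a ∈ Y, (if clusterCost n x y (a :: L) c ≤ 16 * spread n x y c then 0
      else minDist (sqDist x) L a) ≤ clusterCost n x y L c := by
    rcases (spread_nonneg (n := n) (x := x) (y := y) c).eq_or_lt with h0 | h0
    · rw [← h0, mul_zero, zero_mul] at h
      have h0' := (Finset.sum_eq_zero_iff_of_nonneg fun a _ =>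
        mul_nonneg (hD a) (clusterCost_nonneg (n := n) (x := x) (y := y) (a :: L) c)).1
        (le_antisymm h (Finset.sum_nonneg fun a _ =>
          mul_nonneg (hD a) (clusterCost_nonneg (a :: L) c)))
      rw [Finset.sum_eq_zero, mul_zero]
      · exact clusterCost_nonneg L c
      · intro a ha
        split_ifs with h'
        · rfl
        · rw [← h0, mul_zero, not_le] at h'
          exact (mul_eq_zero.1 (h0' a ha)).resolve_right h'.ne'
    · have : 16 * spread n x y c * ∑ a ∈ Y, (if clusterCost n x y (a :: L) c ≤ 16 * spread n x y c
          then 0 else minDist (sqDist x) L a) ≤ 8 * spread n x y c * clusterCost n x y L c := by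
        refine le_trans ?_ h
        rw [Finset.mul_sum]
        refine Finset.sum_le_sum fun a _ => ?_
        split_ifs with h'
        · rw [mul_zero]
          exact mul_nonneg (hD a) (clusterCost_nonneg (a :: L) c)
        · rw [mul_comm]
          exact mul_le_mul_of_nonneg_left (not_le.1 h').le (hD a)
      nlinarith
  have hsplit : clusterCost n x y L c =
      (∑ a ∈ Y, if clusterCost n x y (a :: L) c ≤ 16 * spread n x y c then
        minDist (sqDist x) L a else 0) +
      ∑ a ∈ Y, if clusterCost n x y (a :: L) c ≤ 16 * spread n x y c then 0
        else minDist (sqDist x) L a := by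
    rw [← Finset.sum_add_distrib]
    refine Finset.sum_congr rfl fun a _ => ?_
    split_ifs <;> simp
  linarith

open Classical in
/-- The clusters that the points of the list `L` do not approximate within a factor of 16. -/
noncomputable def badClusters (n : ℕ) (x y : ℕ → E) (L : List ℕ) : Finset E :=
  {c ∈ labels n y | 16 * spread n x y c < clusterCost n x y L c}

open Classical in
/-- The potential of the seeding process: the number of clusters that are not well approximated,
as long as the seeds are not a 32-approximation. -/
noncomputable def potential (n : ℕ) (x y : ℕ → E) (L : List ℕ) : ℝ :=
  if seedCost n x L ≤ 32 * opt n x y then 0 else (badClusters n x y L).card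

theorem potential_nonneg (L : List ℕ) : 0 ≤ potential n x y L := by
  unfold potential
  split_ifs <;> positivity

theorem IsCentroidal.potential_le (hy : IsCentroidal n k x y) (L : List ℕ) :
    potential n x y L ≤ k := by
  unfold potential
  split_ifs
  · positivity
  · exact_mod_cast (Finset.card_filter_le _ _).trans hy.card_le

open Classical in
/-- The clusters that are well approximated have at most half of the cost of the seeds. -/
theorem seedCost_le_two_mul_sum {L : List ℕ} (h : 32 * opt n x y < seedCost n x L) :
    seedCost n x L ≤ 2 * ∑ c ∈ badClusters n x y L, clusterCost n x y L c := by
  have h₁ : seedCost n x L = ∑ c ∈ badClusters n x y L, clusterCost n x y L c +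
      ∑ c ∈ labels n y with ¬ 16 * spread n x y c < clusterCost n x y L c,
        clusterCost n x y L c := by
    rw [seedCost_eq_sum (y := y), badClusters, Finset.sum_filter_add_sum_filter_not]
  have h₂ : ∑ c ∈ labels n y with ¬ 16 * spread n x y c < clusterCost n x y L c,
        clusterCost n x y L c ≤ 16 * opt n x y := by
    rw [opt_eq_sum_spread, Finset.mul_sum]
    refine (Finset.sum_le_sum fun c hc => not_lt.1 (Finset.mem_filter.1 hc).2).trans ?_
    exact Finset.sum_le_sum_of_subset_of_nonneg (Finset.filter_subset _ _)
      fun c _ _ => mul_nonneg (by norm_num) (spread_nonneg c)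
  linarith

theorem one_le_potential {L : List ℕ} (h : 32 * opt n x y < seedCost n x L) :
    1 ≤ potential n x y L := by
  classical
  rw [potential, if_neg (not_le.2 h)]
  have h₁ := seedCost_le_two_mul_sum h
  have : (badClusters n x y L).Nonempty := by
    rw [Finset.nonempty_iff_ne_empty]
    intro h₀
    rw [h₀, Finset.sum_empty, mul_zero] at h₁
    have := opt_nonneg (n := n) (x := x) (y := y)
    linarith
  exact_mod_cast this.card_pos

open Classical in
/-- A new seed that approximates a bad cluster lowers the potential. -/
theorem potential_cons_le {L : List ℕ} (hL : L ≠ []) (h : 32 * opt n x y < seedCost n x L)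
    (i : ℕ) :
    potential n x y (i :: L) ≤ potential n x y L - if y i ∈ badClusters n x y L ∧
      clusterCost n x y (i :: L) (y i) ≤ 16 * spread n x y (y i) then 1 else 0 := by
  have hsub : badClusters n x y (i :: L) ⊆ badClusters n x y L := by
    intro c hc
    rw [badClusters, Finset.mem_filter] at hc ⊢
    exact ⟨hc.1, hc.2.trans_le (clusterCost_cons_le hL i c)⟩
  have h₁ : potential n x y (i :: L) ≤ (badClusters n x y (i :: L)).card := by
    unfold potential
    split_ifs
    · positivity
    · exact le_rfl
  refine h₁.trans ?_
  rw [potential, if_neg (not_le.2 h)]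
  split_ifs with h'
  · have : (badClusters n x y (i :: L)).card < (badClusters n x y L).card := by
      refine Finset.card_lt_card ⟨hsub, fun hsup => ?_⟩
      have := hsup h'.1
      rw [badClusters, Finset.mem_filter] at this
      exact absurd this.2 (not_lt.2 h'.2)
    have : ((badClusters n x y (i :: L)).card : ℝ) + 1 ≤ (badClusters n x y L).card := by
      exact_mod_cast this
    linarith
  · rw [sub_zero]
    exact_mod_cast Finset.card_le_card hsub

open Classical in
/-- One round of `D²`-sampling decreases the expected potential by a factor. -/
theorem IsCentroidal.sum_mul_potential_le (hy : IsCentroidal n k x y) (hk : 0 < k) {L : List ℕ}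
    (hL : L ≠ []) {q : ℕ → ℝ} (hq : 0 < seedCost n x L →
      ∀ i < n, q i = minDist (sqDist x) L i / seedCost n x L) :
    ∑ i ∈ Finset.range n, q i * potential n x y (i :: L) ≤
      (1 - 1 / (4 * k)) * potential n x y L := by
  have hk' : (0 : ℝ) < k := by exact_mod_cast hk
  rcases le_or_gt (seedCost n x L) (32 * opt n x y) with h | h
  · have h' : ∀ i, potential n x y (i :: L) = 0 := fun i => by
      rw [potential, if_pos ((seedCost_cons_le hL i).trans h)]
    rw [potential, if_pos h]
    simp [h']
  have hΦ : 0 < seedCost n x L := by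
    have := opt_nonneg (n := n) (x := x) (y := y)
    linarith
  have hq1 : ∑ i ∈ Finset.range n, q i = 1 := by
    rw [Finset.sum_congr rfl fun i hi => hq hΦ i (Finset.mem_range.1 hi), ← Finset.sum_div]
    exact div_self hΦ.ne'
  set good : ℕ → Prop := fun i => y i ∈ badClusters n x y L ∧
      clusterCost n x y (i :: L) (y i) ≤ 16 * spread n x y (y i) with hgood
  -- a good point is chosen with probability at least `1 / 4`
  have hprob : 1 / 4 ≤ ∑ i ∈ Finset.range n, q i * if good i then 1 else 0 := by
    have h₁ : seedCost n x L ≤ 4 * ∑ i ∈ Finset.range n,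
        if good i then minDist (sqDist x) L i else 0 := by
      refine (seedCost_le_two_mul_sum h).trans ?_
      rw [sum_eq_sum_labels n y]
      have h₂ : ∑ c ∈ badClusters n x y L, clusterCost n x y L c ≤ ∑ c ∈ badClusters n x y L,
          2 * ∑ i ∈ cluster n y c, if good i then minDist (sqDist x) L i else 0 := by
        refine Finset.sum_le_sum fun c hc => (hy.clusterCost_le_two_mul hL c).trans (le_of_eq ?_)
        congr 1
        refine Finset.sum_congr rfl fun i hi => ?_
        obtain ⟨-, rfl⟩ := mem_cluster.1 hi
        simp [hgood, hc]
      have h₃ : ∑ c ∈ badClusters n x y L,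
          ∑ i ∈ cluster n y c, (if good i then minDist (sqDist x) L i else 0) ≤
          ∑ c ∈ labels n y,
          ∑ i ∈ cluster n y c, if good i then minDist (sqDist x) L i else 0 := by
        refine Finset.sum_le_sum_of_subset_of_nonneg (Finset.filter_subset _ _) fun c _ _ =>
          Finset.sum_nonneg fun i _ => ?_
        split_ifs
        exacts [minDist_sqDist_nonneg x L i, le_rfl]
      rw [← Finset.mul_sum] at h₂
      linarith
    have h₂ : ∑ i ∈ Finset.range n, q i * (if good i then 1 else 0) =
        (∑ i ∈ Finset.range n, if good i then minDist (sqDist x) L i else 0) /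
          seedCost n x L := by
      rw [Finset.sum_div]
      refine Finset.sum_congr rfl fun i hi => ?_
      rw [hq hΦ i (Finset.mem_range.1 hi)]
      split_ifs <;> simp
    rw [h₂, le_div_iff₀ hΦ]
    linarith
  have hq0 : ∀ i ∈ Finset.range n, 0 ≤ q i := fun i hi => by
    rw [hq hΦ i (Finset.mem_range.1 hi)]
    exact div_nonneg (minDist_sqDist_nonneg x L i) hΦ.le
  calc ∑ i ∈ Finset.range n, q i * potential n x y (i :: L)
      ≤ ∑ i ∈ Finset.range n, q i * (potential n x y L - if good i then 1 else 0) :=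
        Finset.sum_le_sum fun i hi =>
          mul_le_mul_of_nonneg_left (potential_cons_le hL h i) (hq0 i hi)
    _ = potential n x y L - ∑ i ∈ Finset.range n, q i * if good i then 1 else 0 := by
        simp only [mul_sub, Finset.sum_sub_distrib, ← Finset.sum_mul, hq1, one_mul]
    _ ≤ potential n x y L - 1 / 4 := by linarith
    _ ≤ (1 - 1 / (4 * k)) * potential n x y L := by
        have h₁ : potential n x y L / (4 * k) ≤ 1 / 4 := by
          rw [div_le_div_iff₀ (by positivity) (by norm_num)]
          linarith [hy.potential_le L]
        have h₂ : (1 - 1 / (4 * (k : ℝ))) * potential n x y L =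
          potential n x y L - potential n x y L / (4 * k) := by ring
        linarith

theorem one_sub_pow_mul_le {a : ℝ} (h₀ : 0 ≤ a) (h₁ : a ≤ 1) (T : ℕ) :
    (1 - a) ^ T * (1 + T * a) ≤ 1 := by
  calc (1 - a) ^ T * (1 + T * a) ≤ (1 - a) ^ T * (1 + a) ^ T :=
        mul_le_mul_of_nonneg_left (one_add_mul_le_pow (by linarith) T)
          (pow_nonneg (by linarith) T)
    _ = (1 - a ^ 2) ^ T := by rw [← mul_pow]; ring
    _ ≤ 1 := pow_le_one₀ (by nlinarith) (by nlinarith)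

open Classical in
/-- After `K` rounds of `D²`-sampling, the first of which is arbitrary, the seeds are a
32-approximation with probability at least `1 - 4 k² / K`. -/
theorem IsCentroidal.expect_seedCost_le (hy : IsCentroidal n k x y) (hk : 0 < k)
    {q : List ℕ → ℕ → ℝ} (hq0 : ∀ h i, 0 ≤ q h i) (hq1 : ∀ h, ∑ i ∈ Finset.range n, q h i = 1)
    {K : ℕ} (hK : 0 < K)
    (hq : ∀ h, 0 < seedCost n x h → ∀ i < n, q h i = minDist (sqDist x) h i / seedCost n x h) :
    expect n q K (fun L => if seedCost n x L ≤ 32 * opt n x y then 0 else 1) [] ≤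
      4 * k ^ 2 / K := by
  have hk' : (1 : ℝ) ≤ k := by exact_mod_cast hk
  obtain ⟨T, rfl⟩ : ∃ T, K = T + 1 := ⟨K - 1, by omega⟩
  have hρ : (0 : ℝ) ≤ 1 - 1 / (4 * k) := by
    rw [sub_nonneg, div_le_one (by positivity)]
    linarith
  have h₁ : expect n q (T + 1) (fun L => if seedCost n x L ≤ 32 * opt n x y then 0 else 1) [] ≤
      expect n q (T + 1) (potential n x y) [] := by
    refine expect_mono hq0 _ _ fun L _ => ?_
    split_ifs with h
    · exact potential_nonneg L
    · exact one_le_potential (not_le.1 h)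
  have h₂ : expect n q (T + 1) (potential n x y) [] ≤ (1 - 1 / (4 * k)) ^ T * k := by
    have h : ∀ i, expect n q T (potential n x y) [i] ≤ (1 - 1 / (4 * k)) ^ T * k := fun i =>
      (expect_le_pow_mul hq0 hρ (fun L hL => hy.sum_mul_potential_le hk hL (hq L)) T [i]
        (by simp)).trans (mul_le_mul_of_nonneg_left (hy.potential_le _) (pow_nonneg hρ T))
    calc expect n q (T + 1) (potential n x y) []
        ≤ ∑ i ∈ Finset.range n, q [] i * ((1 - 1 / (4 * k)) ^ T * k) :=
          Finset.sum_le_sum fun i _ => mul_le_mul_of_nonneg_left (h i) (hq0 _ _)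
      _ = (1 - 1 / (4 * k)) ^ T * k := by rw [← Finset.sum_mul, hq1, one_mul]
  have h₃ := one_sub_pow_mul_le (a := 1 / (4 * (k : ℝ))) (by positivity) (by linarith) T
  refine h₁.trans (h₂.trans ?_)
  rw [le_div_iff₀ (by positivity)]
  push_cast
  have hpow := pow_nonneg hρ T
  set P := (1 - 1 / (4 * (k : ℝ))) ^ T with hP
  have h₄ : P * (4 * k + T) ≤ 4 * k := by
    have : P * (4 * k + T) = 4 * k * (P * (1 + T * (1 / (4 * k)))) := by
      field_simp
    rw [this]
    nlinarith
  calc P * k * (T + 1) ≤ k * (P * (4 * k + T)) := by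
        have : P * k * (T + 1) = k * (P * (1 + T)) := by ring
        rw [this]
        refine mul_le_mul_of_nonneg_left (mul_le_mul_of_nonneg_left ?_ hpow) (by linarith)
        linarith
    _ ≤ k * (4 * k) := mul_le_mul_of_nonneg_left h₄ (by linarith)
    _ = 4 * k ^ 2 := by ring

end KMeans

set_option linter.unusedSectionVars false

namespace KMeans

variable {E : Type*} [NormedAddCommGroup E] [InnerProductSpace ℝ E]
variable {n k : ℕ} {x y : ℕ → E} {L : List ℕ}

/-! ### Importances and clusters that are hard to sample -/

/-- The importance of the point `i` with respect to the seeds `L`. -/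
noncomputable def importance (n : ℕ) (x : ℕ → E) (L : List ℕ) (i : ℕ) : ℝ :=
  weight (sqDist x) n L i

theorem cellSize_pos {i : ℕ} (hi : i < n) :
    0 < cellSize (sqDist x) n L (nearest (sqDist x) L i) :=
  Finset.card_pos.2 ⟨i, by simp [hi]⟩

theorem importance_pos {i : ℕ} (hi : i < n) : 0 < importance n x L i := by
  have h₁ : 0 ≤ minDist (sqDist x) L i / ∑ j ∈ Finset.range n, minDist (sqDist x) L j :=
    div_nonneg (minDist_sqDist_nonneg x L i)
      (Finset.sum_nonneg fun j _ => minDist_sqDist_nonneg x L j)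
  have h₂ : (0 : ℝ) < 1 / cellSize (sqDist x) n L (nearest (sqDist x) L i) := by
    have := cellSize_pos (x := x) (L := L) hi
    positivity
  unfold importance weight
  linarith

theorem sum_importance_pos (hn : 0 < n) : 0 < ∑ i ∈ Finset.range n, importance n x L i :=
  Finset.sum_pos (fun _ hi => importance_pos (Finset.mem_range.1 hi)) ⟨0, by simpa using hn⟩

theorem sum_importance_le (hL : L ≠ []) :
    ∑ i ∈ Finset.range n, importance n x L i ≤ L.length + 1 := by
  simp only [importance, weight, Finset.sum_add_distrib]
  have h₁ : ∑ i ∈ Finset.range n, minDist (sqDist x) L i /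
      ∑ j ∈ Finset.range n, minDist (sqDist x) L j ≤ 1 := by
    rw [← Finset.sum_div]
    exact div_self_le_one _
  -- every nonempty cell contributes `1`
  have h₂ : ∑ i ∈ Finset.range n,
      1 / (cellSize (sqDist x) n L (nearest (sqDist x) L i) : ℝ) ≤ L.length := by
    rw [← Finset.sum_fiberwise_of_maps_to (t := Finset.range L.length)
      (g := nearest (sqDist x) L) (fun i _ => Finset.mem_range.2 (nearest_lt hL))]
    calc ∑ t ∈ Finset.range L.length, ∑ i ∈ Finset.range n with nearest (sqDist x) L i = t,
          1 / (cellSize (sqDist x) n L (nearest (sqDist x) L i) : ℝ)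
        ≤ ∑ t ∈ Finset.range L.length, (1 : ℝ) := by
          refine Finset.sum_le_sum fun t _ => ?_
          rw [Finset.sum_congr rfl (g := fun _ => 1 / (cellSize (sqDist x) n L t : ℝ))
            (fun i hi => by rw [(Finset.mem_filter.1 hi).2]), Finset.sum_const, nsmul_eq_mul,
            mul_one_div]
          exact div_self_le_one _
      _ = L.length := by simp
  linarith

/-- The importances of all points of the cluster `c` are at least a `γ`-fraction of the reciprocal
of its size. -/
def IsSampled (n : ℕ) (x y : ℕ → E) (L : List ℕ) (γ : ℝ) (c : E) : Prop :=
  ∀ i ∈ cluster n y c, γ ≤ importance n x L i * (cluster n y c).card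

/-- A cluster with an undersampled point is close to the center of a much larger cluster: the point
is close to a seed whose cell is large, and the largest part of this cell belongs to a cluster whose
center is close to that seed; by optimality, the center of the cluster of the undersampled point is
even closer to that point. -/
theorem IsCentroidal.exists_larger (hy : IsCentroidal n k x y) (hL : L ≠ []) {γ : ℝ} (hγ : 0 < γ)
    (hkγ : k * γ ≤ 1 / 4) (hcost : seedCost n x L ≤ 32 * opt n x y) {c : E}
    (hc : ¬ IsSampled n x y L γ c) :
    ∃ c' ∈ labels n y, 4 * (cluster n y c).card ≤ (cluster n y c').card ∧
      (cluster n y c).card * ‖c - c'‖ ^ 2 ≤ 784 * k * γ * opt n x y := by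
  classical
  unfold IsSampled at hc
  push Not at hc
  obtain ⟨i, hi, hiγ⟩ := hc
  obtain ⟨hin, hyi⟩ := mem_cluster.1 hi
  set M : ℝ := ((cluster n y c).card : ℝ) with hM
  have hM1 : 1 ≤ M := by
    rw [hM]
    exact_mod_cast Finset.card_pos.2 ⟨i, hi⟩
  set S := {j ∈ Finset.range n | nearest (sqDist x) L j = nearest (sqDist x) L i} with hS
  have hSpos : 0 < S.card := cellSize_pos (x := x) (L := L) hin
  have hΦ0 : 0 ≤ seedCost n x L := Finset.sum_nonneg fun j _ => minDist_sqDist_nonneg x L j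
  have hdi := minDist_sqDist_nonneg x L i
  have hdiΦ : minDist (sqDist x) L i ≤ seedCost n x L :=
    Finset.single_le_sum (f := minDist (sqDist x) L) (fun j _ => minDist_sqDist_nonneg x L j)
      (Finset.mem_range.2 hin)
  have hw : importance n x L i = minDist (sqDist x) L i / seedCost n x L + 1 / (S.card : ℝ) := rfl
  have hS0 : (0 : ℝ) < S.card := by exact_mod_cast hSpos
  have h₁ : M * minDist (sqDist x) L i ≤ γ * seedCost n x L := by
    rcases hΦ0.eq_or_lt with h0 | h0
    · have : minDist (sqDist x) L i = 0 := le_antisymm (by rw [h0]; exact hdiΦ) hdi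
      rw [this, ← h0]
      simp
    · have : minDist (sqDist x) L i / seedCost n x L * M ≤ γ := by
        have : 0 ≤ 1 / (S.card : ℝ) * M := by positivity
        rw [hw, add_mul] at hiγ
        linarith
      rw [div_mul_eq_mul_div, div_le_iff₀ h0] at this
      linarith
  have h₂ : M ≤ γ * S.card := by
    have : 1 / (S.card : ℝ) * M ≤ γ := by
      have : 0 ≤ minDist (sqDist x) L i / seedCost n x L * M := by positivity
      rw [hw, add_mul] at hiγ
      linarith
    rwa [div_mul_eq_mul_div, one_mul, div_le_iff₀ hS0] at this
  -- the cluster with the largest part of the cell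
  obtain ⟨c', hc', hp⟩ : ∃ c' ∈ labels n y, S.card ≤ k * (S.filter (y · = c')).card := by
    by_contra! hcon
    have hmaps : ∀ j ∈ S, y j ∈ labels n y := fun j hj =>
      mem_labels.2 ⟨j, Finset.mem_range.1 (Finset.mem_filter.1 hj).1, rfl⟩
    have hsum := Finset.card_eq_sum_card_fiberwise hmaps
    have hlt : ∑ c' ∈ labels n y, k * (S.filter (y · = c')).card <
        ∑ c' ∈ labels n y, S.card :=
      Finset.sum_lt_sum_of_nonempty ⟨c, mem_labels.2 ⟨i, hin, hyi⟩⟩ hcon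
    rw [← Finset.mul_sum, ← hsum, Finset.sum_const, smul_eq_mul] at hlt
    exact absurd (Nat.mul_le_mul_right S.card hy.card_le) (not_le.2 hlt)
  set P := S.filter (y · = c') with hP
  have hPsub : P ⊆ cluster n y c' := fun j hj => by
    have h := Finset.mem_filter.1 hj
    exact mem_cluster.2 ⟨Finset.mem_range.1 (Finset.mem_filter.1 h.1).1, h.2⟩
  have hp' : (S.card : ℝ) ≤ k * P.card := by exact_mod_cast hp
  have hPne : P.Nonempty := by
    rw [Finset.nonempty_iff_ne_empty]
    intro h
    rw [h, Finset.card_empty, mul_zero] at hp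
    omega
  have hP0 : (0 : ℝ) < P.card := by exact_mod_cast hPne.card_pos
  have hMP : M ≤ k * γ * P.card := by nlinarith
  -- a point of this part that is close to both its seed and its center
  obtain ⟨j, hj, hjle⟩ : ∃ j ∈ P, minDist (sqDist x) L j + ‖x j - c'‖ ^ 2 ≤
      33 * opt n x y / P.card := by
    refine Finset.exists_le_of_sum_le hPne ?_
    rw [Finset.sum_const, nsmul_eq_mul, mul_div_cancel₀ _ hP0.ne', Finset.sum_add_distrib]
    have h₃ : ∑ j ∈ P, minDist (sqDist x) L j ≤ seedCost n x L :=
      Finset.sum_le_sum_of_subset_of_nonneg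
        (fun j hj => Finset.mem_range.2 (mem_cluster.1 (hPsub hj)).1)
        fun j _ _ => minDist_sqDist_nonneg x L j
    have h₄ : ∑ j ∈ P, ‖x j - c'‖ ^ 2 ≤ opt n x y := by
      rw [opt_eq_sum_spread]
      refine le_trans (Finset.sum_le_sum_of_subset_of_nonneg hPsub fun _ _ _ => by positivity)
        (Finset.single_le_sum (f := fun c => spread n x y c) (fun c _ => spread_nonneg c) hc')
    linarith
  obtain ⟨hjn, hyj⟩ := mem_cluster.1 (hPsub hj)
  obtain ⟨z, hz, -⟩ := exists_minDist_eq (sqDist x) hL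
  have hcell : nearest (sqDist x) L j = nearest (sqDist x) L i :=
    (Finset.mem_filter.1 (Finset.mem_filter.1 hj).1).2
  have hzj := hz j
  have hzi := hz i
  rw [hcell] at hzj
  set s := x (z (nearest (sqDist x) L i)) with hs
  simp only [sqDist] at hzi hzj
  rw [← hs] at hzi hzj
  have hclose : ‖x i - c‖ ^ 2 ≤ ‖x i - c'‖ ^ 2 := by
    have := hy.closest i hin j hjn
    rw [hyi, hyj] at this
    exact pow_le_pow_left₀ (norm_nonneg _) this 2
  have hopt := opt_nonneg (n := n) (x := x) (y := y)
  have h₅ : M * (‖x j - s‖ ^ 2 + ‖x j - c'‖ ^ 2) ≤ k * γ * (33 * opt n x y) := by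
    rw [hzj, le_div_iff₀ hP0] at hjle
    have h0 : 0 ≤ ‖x j - s‖ ^ 2 + ‖x j - c'‖ ^ 2 := by positivity
    calc M * (‖x j - s‖ ^ 2 + ‖x j - c'‖ ^ 2)
        ≤ k * γ * P.card * (‖x j - s‖ ^ 2 + ‖x j - c'‖ ^ 2) :=
          mul_le_mul_of_nonneg_right hMP h0
      _ = k * γ * ((‖x j - s‖ ^ 2 + ‖x j - c'‖ ^ 2) * P.card) := by ring
      _ ≤ k * γ * (33 * opt n x y) := mul_le_mul_of_nonneg_left hjle (by positivity)
  have hk1 : (1 : ℝ) ≤ k := by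
    have : 0 < k := (Finset.card_pos.2 ⟨c', hc'⟩).trans_le hy.card_le
    exact_mod_cast this
  have h₆ : M * ‖x i - s‖ ^ 2 ≤ k * γ * (32 * opt n x y) := by
    rw [hzi] at h₁
    have h₇ : γ * seedCost n x L ≤ γ * (32 * opt n x y) := mul_le_mul_of_nonneg_left hcost hγ.le
    have h₈ : γ * (32 * opt n x y) ≤ k * (γ * (32 * opt n x y)) :=
      le_mul_of_one_le_left (by positivity) hk1
    linarith
  refine ⟨c', hc', ?_, ?_⟩
  · have h₃ : (P.card : ℝ) ≤ (cluster n y c').card := by exact_mod_cast Finset.card_le_card hPsub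
    have : 4 * M ≤ (cluster n y c').card := by nlinarith
    rw [hM] at this
    exact_mod_cast this
  · have h₃ := norm_sub_sq_le c (x i) c'
    have h₄ := norm_sub_sq_le (x i) s c'
    have h₇ := norm_sub_sq_le s (x j) c'
    rw [norm_sub_rev c (x i)] at h₃
    rw [norm_sub_rev s (x j)] at h₇
    have h₈ : ‖c - c'‖ ^ 2 ≤ 8 * ‖x i - s‖ ^ 2 + 16 * (‖x j - s‖ ^ 2 + ‖x j - c'‖ ^ 2) := by
      linarith
    have h₉ := mul_le_mul_of_nonneg_left h₈ (by linarith : 0 ≤ M)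
    calc M * ‖c - c'‖ ^ 2 ≤ 8 * (M * ‖x i - s‖ ^ 2) +
          16 * (M * (‖x j - s‖ ^ 2 + ‖x j - c'‖ ^ 2)) := by linarith
      _ ≤ 8 * (k * γ * (32 * opt n x y)) + 16 * (k * γ * (33 * opt n x y)) := by linarith
      _ ≤ 784 * k * γ * opt n x y := by
          have : 0 ≤ k * γ * opt n x y := by positivity
          linarith

/-- Every cluster is close to the center of a cluster that is sampled well and at least as
large. Passing to larger clusters repeatedly costs no more than a geometric series. -/
theorem IsCentroidal.exists_isSampled (hy : IsCentroidal n k x y) (hL : L ≠ []) {γ : ℝ}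
    (hγ : 0 < γ) (hkγ : k * γ ≤ 1 / 4) (hcost : seedCost n x L ≤ 32 * opt n x y) (c : E)
    (hc : c ∈ labels n y) :
    ∃ c' ∈ labels n y, IsSampled n x y L γ c' ∧ (cluster n y c).card ≤ (cluster n y c').card ∧
      (cluster n y c).card * ‖c - c'‖ ^ 2 ≤ 3136 * k * γ * opt n x y := by
  classical
  have hopt := opt_nonneg (n := n) (x := x) (y := y)
  have hpos : 0 ≤ k * γ * opt n x y := by positivity
  induction hm : n - (cluster n y c).card using Nat.strong_induction_on generalizing c with
  | _ m ih =>
    by_cases hs : IsSampled n x y L γ c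
    · refine ⟨c, hc, hs, le_rfl, ?_⟩
      simp only [sub_self, norm_zero]
      linarith
    obtain ⟨c', hc', hcard, hdist⟩ := hy.exists_larger hL hγ hkγ hcost hs
    have h0 : 0 < (cluster n y c).card := by
      obtain ⟨i, hi, hyi⟩ := mem_labels.1 hc
      exact Finset.card_pos.2 ⟨i, mem_cluster.2 ⟨hi, hyi⟩⟩
    have hle : (cluster n y c').card ≤ n :=
      (Finset.card_le_card fun i hi => Finset.mem_range.2 (mem_cluster.1 hi).1).trans
        (Finset.card_range n).le
    obtain ⟨c'', hc'', hs'', hcard', hdist'⟩ := ih _ (by omega) c' hc' rfl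
    refine ⟨c'', hc'', hs'', by omega, ?_⟩
    have h₁ := norm_sub_sq_le c c' c''
    have h₂ : (4 : ℝ) * (cluster n y c).card ≤ (cluster n y c').card := by exact_mod_cast hcard
    have h₃ : 4 * (cluster n y c).card * ‖c' - c''‖ ^ 2 ≤
        (cluster n y c').card * ‖c' - c''‖ ^ 2 := mul_le_mul_of_nonneg_right h₂ (by positivity)
    have h₄ := mul_le_mul_of_nonneg_left h₁ (Nat.cast_nonneg (α := ℝ) (cluster n y c).card)
    linarith

/-- The threshold `γ` for `IsSampled`, chosen such that replacing the center of one cluster as in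
`exists_isSampled` costs at most `ε / (4 k)` times the optimum. -/
noncomputable def sampleRate (k : ℕ) (ε : ℝ) : ℝ := ε / (12544 * k ^ 2)

open Classical in
/-- Good estimates of the centers of the clusters that are sampled well suffice: the points of the
other clusters are assigned to the estimates of well sampled clusters nearby. -/
theorem IsCentroidal.exists_assignment (hy : IsCentroidal n k x y) (hk : 0 < k) (hL : L ≠ [])
    {ε : ℝ} (hε : 0 < ε) (hε' : ε ≤ 1 / 2) (hcost : seedCost n x L ≤ 32 * opt n x y) (est : E → E)
    (hest : ∑ c ∈ labels n y with IsSampled n x y L (sampleRate k ε) c,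
      (cluster n y c).card * ‖c - est c‖ ^ 2 ≤ ε / (4 * k) * opt n x y) :
    ∃ τ : E → E, (∀ c ∈ labels n y, τ c ∈ labels n y ∧ IsSampled n x y L (sampleRate k ε) (τ c)) ∧
      ∑ i ∈ Finset.range n, ‖x i - est (τ (y i))‖ ^ 2 ≤ (1 + ε) * opt n x y := by
  have hk1 : (1 : ℝ) ≤ k := by exact_mod_cast hk
  have hk0 : (0 : ℝ) < k := by linarith
  have hγ : 0 < sampleRate k ε := by unfold sampleRate; positivity
  have hkγ : k * sampleRate k ε = ε / (12544 * k) := by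
    unfold sampleRate
    field_simp
  have hkγ' : k * sampleRate k ε ≤ 1 / 4 := by
    rw [hkγ, div_le_div_iff₀ (by positivity) (by norm_num)]
    nlinarith
  have hopt := opt_nonneg (n := n) (x := x) (y := y)
  have hex : ∀ c, ∃ c', c ∈ labels n y → c' ∈ labels n y ∧ IsSampled n x y L (sampleRate k ε) c' ∧
      (cluster n y c).card ≤ (cluster n y c').card ∧
      (cluster n y c).card * ‖c - c'‖ ^ 2 ≤ 3136 * k * sampleRate k ε * opt n x y := by
    intro c
    by_cases hc : c ∈ labels n y
    · obtain ⟨c', h⟩ := hy.exists_isSampled hL hγ hkγ' hcost c hc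
      exact ⟨c', fun _ => h⟩
    · exact ⟨c, fun h => absurd h hc⟩
  choose τ hτ using hex
  refine ⟨τ, fun c hc => ⟨(hτ c hc).1, (hτ c hc).2.1⟩, ?_⟩
  have hterm : ∀ c ∈ labels n y, ∑ i ∈ cluster n y c, ‖x i - est (τ (y i))‖ ^ 2 ≤
      spread n x y c + ε / k * opt n x y := by
    intro c hc
    obtain ⟨h₁, h₂, h₃, h₄⟩ := hτ c hc
    rw [Finset.sum_congr rfl (g := fun i => ‖x i - est (τ c)‖ ^ 2)
      (fun i hi => by rw [(mem_cluster.1 hi).2]), hy.sum_norm_sub_sq]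
    have h₅ : (cluster n y (τ c)).card * ‖τ c - est (τ c)‖ ^ 2 ≤ ε / (4 * k) * opt n x y :=
      (Finset.single_le_sum (f := fun c => ((cluster n y c).card : ℝ) * ‖c - est c‖ ^ 2)
        (fun _ _ => by positivity) (Finset.mem_filter.2 ⟨h₁, h₂⟩)).trans hest
    have h₆ : (cluster n y c).card * ‖τ c - est (τ c)‖ ^ 2 ≤
        (cluster n y (τ c)).card * ‖τ c - est (τ c)‖ ^ 2 :=
      mul_le_mul_of_nonneg_right (by exact_mod_cast h₃) (by positivity)
    have h₇ := mul_le_mul_of_nonneg_left (norm_sub_sq_le c (τ c) (est (τ c)))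
      (Nat.cast_nonneg (α := ℝ) (cluster n y c).card)
    have h₈ : 3136 * k * sampleRate k ε * opt n x y = ε / (4 * k) * opt n x y := by
      rw [mul_assoc 3136, hkγ]
      field_simp
      ring
    have h₉ : ε / k * opt n x y = 4 * (ε / (4 * k) * opt n x y) := by
      field_simp
    rw [h₈] at h₄
    linarith
  rw [sum_eq_sum_labels n y]
  refine (Finset.sum_le_sum hterm).trans ?_
  rw [Finset.sum_add_distrib, ← opt_eq_sum_spread, Finset.sum_const, nsmul_eq_mul]
  have h₁ : ((labels n y).card : ℝ) * (ε / k * opt n x y) ≤ k * (ε / k * opt n x y) :=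
    mul_le_mul_of_nonneg_right (by exact_mod_cast hy.card_le) (by positivity)
  have h₂ : k * (ε / k * opt n x y) = ε * opt n x y := by
    field_simp
  linarith

end KMeans

set_option linter.unusedSectionVars false

namespace KMeans

variable {E : Type*} [NormedAddCommGroup E] [InnerProductSpace ℝ E]
variable {n k N : ℕ} {x y : ℕ → E} {L : List ℕ} {γ : ℝ} {c : E}

/-! ### The accuracy of the estimates -/

/-- The total importance of all points. -/
noncomputable def totalImportance (n : ℕ) (x : ℕ → E) (L : List ℕ) : ℝ :=
  ∑ i ∈ Finset.range n, importance n x L i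

/-- The law of the samples. -/
noncomputable def sampleLaw (n : ℕ) (x : ℕ → E) (L : List ℕ) (i : ℕ) : ℝ :=
  importance n x L i / totalImportance n x L

open Classical in
/-- The contribution of the sample `i` to the error of the weighted sum for the cluster `c`. -/
noncomputable def deviation (n : ℕ) (x y : ℕ → E) (L : List ℕ) (c : E) (i : ℕ) : E :=
  if i ∈ cluster n y c then (1 / importance n x L i) • (x i - c) else 0

open Classical in
/-- The contribution of the sample `i` to the error of the total weight for the cluster `c`. -/
noncomputable def weightDeviation (n : ℕ) (x y : ℕ → E) (L : List ℕ) (c : E) (i : ℕ) : ℝ :=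
  (if i ∈ cluster n y c then 1 / importance n x L i else 0) -
    (cluster n y c).card / totalImportance n x L

open Classical in
theorem sum_range_ite_cluster {M : Type*} [AddCommMonoid M] (f : ℕ → M) :
    ∑ i ∈ Finset.range n, (if i ∈ cluster n y c then f i else 0) = ∑ i ∈ cluster n y c, f i := by
  rw [Finset.sum_ite_mem, Finset.inter_eq_right.2]
  exact fun i hi => Finset.mem_range.2 (mem_cluster.1 hi).1

theorem sum_sampleLaw (hn : 0 < n) : ∑ i ∈ Finset.range n, sampleLaw n x L i = 1 := by
  simp only [sampleLaw, ← Finset.sum_div]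
  exact div_self (sum_importance_pos hn).ne'

theorem sampleLaw_mul_one_div {i : ℕ} (hi : i < n) :
    sampleLaw n x L i * (1 / importance n x L i) = 1 / totalImportance n x L := by
  have := (importance_pos (x := x) (L := L) hi).ne'
  unfold sampleLaw
  field_simp

/-- Samples from a cluster that is sampled well have bounded weights. -/
theorem IsSampled.one_div_le (hc : IsSampled n x y L γ c) (hγ : 0 < γ) {i : ℕ}
    (hi : i ∈ cluster n y c) : 1 / importance n x L i ≤ (cluster n y c).card / γ := by
  rw [div_le_div_iff₀ (importance_pos (mem_cluster.1 hi).1) hγ]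
  have := hc i hi
  linarith

/-- The weighted sum is unbiased because the center of a cluster is its centroid. -/
theorem IsCentroidal.sum_sampleLaw_smul_deviation (hy : IsCentroidal n k x y) (c : E) :
    ∑ i ∈ Finset.range n, sampleLaw n x L i • deviation n x y L c i = 0 := by
  classical
  simp only [deviation, smul_ite, smul_zero]
  rw [sum_range_ite_cluster (fun i => sampleLaw n x L i • (1 / importance n x L i) • (x i - c)),
    Finset.sum_congr rfl (g := fun i => (1 / totalImportance n x L) • (x i - c))
    (fun i hi => by rw [smul_smul, sampleLaw_mul_one_div (mem_cluster.1 hi).1]),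
    ← Finset.smul_sum, hy.centroid c, smul_zero]

theorem sum_sampleLaw_mul_weightDeviation (hn : 0 < n) (c : E) :
    ∑ i ∈ Finset.range n, sampleLaw n x L i • weightDeviation n x y L c i = 0 := by
  classical
  simp only [weightDeviation, smul_eq_mul, mul_sub, Finset.sum_sub_distrib, mul_ite, mul_zero]
  rw [sum_range_ite_cluster (fun i => sampleLaw n x L i * (1 / importance n x L i)),
    Finset.sum_congr rfl (g := fun i => 1 / totalImportance n x L)
    (fun i hi => sampleLaw_mul_one_div (mem_cluster.1 hi).1), ← Finset.sum_mul, sum_sampleLaw hn,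
    Finset.sum_const, nsmul_eq_mul]
  ring

theorem totalImportance_pos (hn : 0 < n) : 0 < totalImportance n x L := sum_importance_pos hn

/-- The second moment of the contribution of one sample to the weighted sum. -/
theorem sum_sampleLaw_mul_deviation_sq_le (hn : 0 < n) (hγ : 0 < γ)
    (hc : IsSampled n x y L γ c) :
    ∑ i ∈ Finset.range n, sampleLaw n x L i * ‖deviation n x y L c i‖ ^ 2 ≤
      (cluster n y c).card / (totalImportance n x L * γ) * spread n x y c := by
  classical
  have hW := totalImportance_pos (x := x) (L := L) hn
  have h : ∀ i, sampleLaw n x L i * ‖deviation n x y L c i‖ ^ 2 = if i ∈ cluster n y c then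
      sampleLaw n x L i * ‖(1 / importance n x L i) • (x i - c)‖ ^ 2 else 0 := by
    intro i
    unfold deviation
    split_ifs <;> simp
  simp only [h]
  rw [sum_range_ite_cluster (fun i =>
    sampleLaw n x L i * ‖(1 / importance n x L i) • (x i - c)‖ ^ 2), spread, Finset.mul_sum]
  refine Finset.sum_le_sum fun i hi => ?_
  have hin := (mem_cluster.1 hi).1
  have hpos := importance_pos (x := x) (L := L) hin
  have h₁ := hc.one_div_le hγ hi
  rw [norm_smul, mul_pow, ← mul_assoc, sq ‖1 / importance n x L i‖, ← mul_assoc,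
    Real.norm_of_nonneg (by positivity), sampleLaw_mul_one_div hin]
  refine mul_le_mul_of_nonneg_right ?_ (by positivity)
  calc 1 / totalImportance n x L * (1 / importance n x L i)
      ≤ 1 / totalImportance n x L * ((cluster n y c).card / γ) :=
        mul_le_mul_of_nonneg_left h₁ (by positivity)
    _ = (cluster n y c).card / (totalImportance n x L * γ) := by
        field_simp

/-- The second moment of the contribution of one sample to the total weight. -/
theorem sum_sampleLaw_mul_weightDeviation_sq_le (hn : 0 < n) (hγ : 0 < γ)
    (hc : IsSampled n x y L γ c) :
    ∑ i ∈ Finset.range n, sampleLaw n x L i * ‖weightDeviation n x y L c i‖ ^ 2 ≤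
      (cluster n y c).card ^ 2 / (totalImportance n x L * γ) := by
  classical
  have hW := totalImportance_pos (x := x) (L := L) hn
  set μ := (cluster n y c).card / totalImportance n x L with hμ
  set f : ℕ → ℝ := fun i => if i ∈ cluster n y c then 1 / importance n x L i else 0 with hf
  have hmean : ∑ i ∈ Finset.range n, sampleLaw n x L i * (f i - μ) = 0 :=
    sum_sampleLaw_mul_weightDeviation (x := x) (y := y) (L := L) hn c
  -- the variance is at most the second moment
  have h₁ : ∑ i ∈ Finset.range n, sampleLaw n x L i * ‖weightDeviation n x y L c i‖ ^ 2 =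
      ∑ i ∈ Finset.range n, sampleLaw n x L i * f i ^ 2 - μ ^ 2 := by
    have h : ∀ i ∈ Finset.range n, sampleLaw n x L i * ‖weightDeviation n x y L c i‖ ^ 2 =
        sampleLaw n x L i * f i ^ 2 - 2 * μ * (sampleLaw n x L i * (f i - μ)) -
          μ ^ 2 * sampleLaw n x L i := by
      intro i _
      rw [Real.norm_eq_abs, sq_abs]
      change sampleLaw n x L i * (f i - μ) ^ 2 = _
      ring
    rw [Finset.sum_congr rfl h, Finset.sum_sub_distrib, Finset.sum_sub_distrib, ← Finset.mul_sum,
      ← Finset.mul_sum, hmean, sum_sampleLaw hn]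
    ring
  have h₂ : ∑ i ∈ Finset.range n, sampleLaw n x L i * f i ^ 2 ≤
      (cluster n y c).card ^ 2 / (totalImportance n x L * γ) := by
    have h : ∀ i, sampleLaw n x L i * f i ^ 2 = if i ∈ cluster n y c then
        sampleLaw n x L i * (1 / importance n x L i) ^ 2 else 0 := by
      intro i
      simp only [hf]
      split_ifs <;> simp
    simp only [h]
    rw [sum_range_ite_cluster (fun i => sampleLaw n x L i * (1 / importance n x L i) ^ 2)]
    have h' : ∀ i ∈ cluster n y c, sampleLaw n x L i * (1 / importance n x L i) ^ 2 ≤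
        1 / totalImportance n x L * ((cluster n y c).card / γ) := by
      intro i hi
      rw [sq, ← mul_assoc, sampleLaw_mul_one_div (mem_cluster.1 hi).1]
      exact mul_le_mul_of_nonneg_left (hc.one_div_le hγ hi) (by positivity)
    refine (Finset.sum_le_sum h').trans (le_of_eq ?_)
    rw [Finset.sum_const, nsmul_eq_mul]
    field_simp
  have := sq_nonneg μ
  linarith

open Classical in
/-- The weighted sum of the samples from the cluster `c`. -/
noncomputable def vectorSum (v : ℕ → ℝ) (x y : ℕ → E) (l : List ℕ) (c : E) : E :=
  (l.map fun m => if y m = c then (1 / v m) • x m else 0).sum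

/-- The estimate of the center of the cluster `c`. -/
noncomputable def estimate (v : ℕ → ℝ) (x y : ℕ → E) (l : List ℕ) (c : E) : E :=
  (classSum v (fun _ => 1) y l c)⁻¹ • vectorSum v x y l c

theorem sum_map_deviation {l : List ℕ} (hl : ∀ m ∈ l, m < n) (c : E) :
    (l.map (deviation n x y L c)).sum = vectorSum (importance n x L) x y l c -
      classSum (importance n x L) (fun _ => 1) y l c • c := by
  classical
  induction l with
  | nil => simp [vectorSum, classSum]
  | cons m l ih =>
    have ih := ih fun m' hm' => hl m' (by simp [hm'])
    have hm := hl m (by simp)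
    simp only [vectorSum, classSum, List.map_cons, List.sum_cons] at ih ⊢
    rw [ih]
    unfold deviation
    by_cases h : y m = c
    · rw [if_pos (mem_cluster.2 ⟨hm, h⟩), if_pos h, if_pos h]
      module
    · rw [if_neg (fun h' => h (mem_cluster.1 h').2), if_neg h, if_neg h]
      module

theorem sum_map_weightDeviation {l : List ℕ} (hl : ∀ m ∈ l, m < n) (c : E) :
    (l.map (weightDeviation n x y L c)).sum = classSum (importance n x L) (fun _ => 1) y l c -
      l.length * ((cluster n y c).card / totalImportance n x L) := by
  classical
  induction l with
  | nil => simp [classSum]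
  | cons m l ih =>
    have ih := ih fun m' hm' => hl m' (by simp [hm'])
    have hm := hl m (by simp)
    simp only [classSum, List.map_cons, List.sum_cons, List.length_cons] at ih ⊢
    rw [ih]
    unfold weightDeviation
    by_cases h : y m = c
    · rw [if_pos (mem_cluster.2 ⟨hm, h⟩), if_pos h]
      push_cast
      ring
    · rw [if_neg (fun h' => h (mem_cluster.1 h').2), if_neg h]
      push_cast
      ring

/-- The squared deviation of the total weight for the cluster `c` that is tolerated. -/
noncomputable def tolerance (n : ℕ) (x y : ℕ → E) (L : List ℕ) (N : ℕ) (c : E) : ℝ :=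
  (N * (cluster n y c).card / (2 * totalImportance n x L)) ^ 2

/-- The bound for the error of the estimate for the cluster `c`, provided that the total weight is
at least half of its expectation. -/
noncomputable def errorBound (n : ℕ) (x y : ℕ → E) (L : List ℕ) (N : ℕ) (l : List ℕ) (c : E) :
    ℝ :=
  4 * totalImportance n x L ^ 2 / (N ^ 2 * (cluster n y c).card) *
    ‖(l.map (deviation n x y L c)).sum‖ ^ 2

theorem errorBound_nonneg (hn : 0 < n) (l : List ℕ) : 0 ≤ errorBound n x y L N l c := by
  have := totalImportance_pos (x := x) (L := L) hn
  unfold errorBound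
  positivity

theorem card_cluster_pos (hc : c ∈ labels n y) : 0 < (cluster n y c).card := by
  obtain ⟨i, hi, hyi⟩ := mem_labels.1 hc
  exact Finset.card_pos.2 ⟨i, mem_cluster.2 ⟨hi, hyi⟩⟩

/-- If the total weight for the cluster `c` is accurate, then the cluster has been sampled, and
`errorBound` bounds the cost of the estimate. -/
theorem mul_norm_sub_estimate_sq_le (hn : 0 < n) (hN : 0 < N) {l : List ℕ} (hl : ∀ m ∈ l, m < n)
    (hlen : l.length = N) (hc : c ∈ labels n y)
    (h : ‖(l.map (weightDeviation n x y L c)).sum‖ ^ 2 < tolerance n x y L N c) :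
    (∃ m ∈ l, y m = c) ∧ (cluster n y c).card *
      ‖c - estimate (importance n x L) x y l c‖ ^ 2 ≤ errorBound n x y L N l c := by
  have hW := totalImportance_pos (x := x) (L := L) hn
  have hM : (0 : ℝ) < (cluster n y c).card := by exact_mod_cast card_cluster_pos hc
  have hN' : (0 : ℝ) < N := by exact_mod_cast hN
  set W := totalImportance n x L with hWdef
  set M : ℝ := ((cluster n y c).card : ℝ) with hMdef
  set B := classSum (importance n x L) (fun _ => 1) y l c with hB
  have hpos : 0 < N * M / (2 * W) := by positivity
  have hBlt : N * M / (2 * W) < B := by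
    rw [tolerance, sum_map_weightDeviation hl, hlen] at h
    have h' := abs_lt_of_sq_lt_sq h hpos.le
    rw [Real.norm_eq_abs, abs_abs] at h'
    have h₁ := (abs_lt.1 h').1
    have h₂ : N * (M / W) = 2 * (N * M / (2 * W)) := by
      field_simp
    linarith
  have hB0 : 0 < B := hpos.trans hBlt
  refine ⟨?_, ?_⟩
  · by_contra! hcon
    exact hB0.ne' (classSum_eq_zero hcon)
  · have hZ := sum_map_deviation (x := x) (y := y) (L := L) hl c
    rw [← hB] at hZ
    have h₁ : c - estimate (importance n x L) x y l c =
        -(B⁻¹ • (l.map (deviation n x y L c)).sum) := by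
      rw [hZ, estimate, ← hB, smul_sub, smul_smul, inv_mul_cancel₀ hB0.ne', one_smul, neg_sub]
    rw [h₁, norm_neg, norm_smul, mul_pow, errorBound, ← mul_assoc]
    refine mul_le_mul_of_nonneg_right ?_ (by positivity)
    rw [norm_inv, Real.norm_of_nonneg hB0.le, inv_pow, ← div_eq_mul_inv,
      div_le_div_iff₀ (by positivity) (by positivity), ← hWdef]
    have h₂ : N * M ≤ 2 * W * B := by
      have := hBlt.le
      rwa [div_le_iff₀ (by positivity), mul_comm B] at this
    have h₃ : (N * M) ^ 2 ≤ (2 * W * B) ^ 2 := pow_le_pow_left₀ (by positivity) h₂ 2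
    rw [← hMdef]
    nlinarith

theorem sampleLaw_nonneg (hn : 0 < n) (i : ℕ) : 0 ≤ sampleLaw n x L i := by
  refine div_nonneg ?_ (totalImportance_pos hn).le
  have h := minDist_sqDist_nonneg x L
  exact add_nonneg (div_nonneg (h i) (Finset.sum_nonneg fun j _ => h j)) (by positivity)

open Classical in
/-- Chebyshev's inequality for the total weight of a cluster that is sampled well. -/
theorem expect_tolerance_le (hn : 0 < n) (hN : 0 < N) (hγ : 0 < γ)
    (hc : c ∈ labels n y) (hs : IsSampled n x y L γ c) :
    expect n (fun _ => sampleLaw n x L) N (fun l => if tolerance n x y L N c ≤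
      ‖(l.map (weightDeviation n x y L c)).sum‖ ^ 2 then 1 else 0) [] ≤
      4 * totalImportance n x L / (N * γ) := by
  have hW := totalImportance_pos (x := x) (L := L) hn
  have hM : (0 : ℝ) < (cluster n y c).card := by exact_mod_cast card_cluster_pos hc
  have hN' : (0 : ℝ) < N := by exact_mod_cast hN
  have h := expect_ite_lt_mul_le (n := n) (fun _ => sampleLaw_nonneg (x := x) (L := L) hn) (F := fun l =>
    ‖(l.map (weightDeviation n x y L c)).sum‖ ^ 2) (fun _ => by positivity)
    (tolerance n x y L N c) N []
  rw [expect_norm_sum_sq (sum_sampleLaw hn) (sum_sampleLaw_mul_weightDeviation hn c)] at h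
  have h₁ := mul_le_mul_of_nonneg_left (sum_sampleLaw_mul_weightDeviation_sq_le hn hγ hs) hN'.le
  have htol : 0 < tolerance n x y L N c := by unfold tolerance; positivity
  simp only [List.map_nil, List.sum_nil, norm_zero] at h
  rw [zero_pow two_ne_zero, zero_add] at h
  refine le_of_mul_le_mul_left (h.trans (h₁.trans (le_of_eq ?_))) htol
  unfold tolerance
  field_simp
  ring

open Classical in
/-- Markov's inequality for the total cost of the estimates. -/
theorem IsCentroidal.expect_errorBound_le (hy : IsCentroidal n k x y) (hn : 0 < n) (hN : 0 < N)
    (hγ : 0 < γ) {a : ℝ} (ha : 0 < a) :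
    expect n (fun _ => sampleLaw n x L) N (fun l => if ∑ c ∈ labels n y with IsSampled n x y L γ c,
      errorBound n x y L N l c ≤ a * opt n x y then 0 else 1) [] ≤
      4 * totalImportance n x L / (N * γ * a) := by
  have hW := totalImportance_pos (x := x) (L := L) hn
  have hN' : (0 : ℝ) < N := by exact_mod_cast hN
  set F : List ℕ → ℝ := fun l => ∑ c ∈ labels n y with IsSampled n x y L γ c,
    errorBound n x y L N l c with hF
  have hmean : expect n (fun _ => sampleLaw n x L) N F [] ≤
      4 * totalImportance n x L / (N * γ) * opt n x y := by
    rw [hF, expect_finsetSum, opt_eq_sum_spread, Finset.mul_sum]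
    refine le_trans (Finset.sum_le_sum fun c hc => ?_) (Finset.sum_le_sum_of_subset_of_nonneg
      (Finset.filter_subset _ _) fun c _ _ => mul_nonneg (by positivity) (spread_nonneg c))
    obtain ⟨hc, hs⟩ := Finset.mem_filter.1 hc
    have hM : (0 : ℝ) < (cluster n y c).card := by exact_mod_cast card_cluster_pos hc
    unfold errorBound
    rw [expect_mul_left, expect_norm_sum_sq (sum_sampleLaw hn) (hy.sum_sampleLaw_smul_deviation c),
      List.map_nil, List.sum_nil, norm_zero, zero_pow two_ne_zero, zero_add]
    have h₁ := mul_le_mul_of_nonneg_left (sum_sampleLaw_mul_deviation_sq_le hn hγ hs) hN'.le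
    refine (mul_le_mul_of_nonneg_left h₁ (by positivity)).trans (le_of_eq ?_)
    field_simp
  have hF0 : ∀ l, 0 ≤ F l := fun l => Finset.sum_nonneg fun c _ => errorBound_nonneg hn l
  rcases (opt_nonneg (n := n) (x := x) (y := y)).eq_or_lt with h0 | h0
  · -- if the optimal cost is zero, then all estimates are exact
    have hzero : ∀ l, F l = 0 := by
      intro l
      refine Finset.sum_eq_zero fun c _ => ?_
      have hdev : ∀ i, deviation n x y L c i = 0 := by
        intro i
        unfold deviation
        split_ifs with hi
        · obtain ⟨hin, hyi⟩ := mem_cluster.1 hi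
          have := (Finset.sum_eq_zero_iff_of_nonneg fun i _ => by positivity).1 h0.symm i
            (Finset.mem_range.2 hin)
          rw [← hyi, norm_eq_zero.1 (pow_eq_zero_iff two_ne_zero |>.1 this), smul_zero]
        · rfl
      have : (l.map (deviation n x y L c)).sum = 0 :=
        List.sum_eq_zero fun v hv => by
          obtain ⟨i, -, rfl⟩ := List.mem_map.1 hv
          exact hdev i
      unfold errorBound
      rw [this, norm_zero, zero_pow two_ne_zero, mul_zero]
    have : (fun l => if F l ≤ a * opt n x y then (0 : ℝ) else 1) = fun _ => 0 := by
      funext l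
      rw [hzero, ← h0, mul_zero, if_pos le_rfl]
    change expect n (fun _ => sampleLaw n x L) N
      (fun l => if F l ≤ a * opt n x y then (0 : ℝ) else 1) [] ≤ _
    rw [this, expect_const fun _ => sum_sampleLaw hn]
    positivity
  · have hb : 0 < a * opt n x y := by positivity
    have h₁ := expect_ite_lt_mul_le (n := n) (fun _ => sampleLaw_nonneg (x := x) (L := L) hn) hF0
      (a * opt n x y) N []
    have h₂ : expect n (fun _ => sampleLaw n x L) N
        (fun l => if F l ≤ a * opt n x y then 0 else 1) [] ≤
        expect n (fun _ => sampleLaw n x L) N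
        (fun l => if a * opt n x y ≤ F l then 1 else 0) [] := by
      refine expect_mono (fun _ => sampleLaw_nonneg hn) N [] fun l _ => ?_
      split_ifs with h h' h'
      · exact zero_le_one
      · exact le_rfl
      · exact le_rfl
      · exact absurd (not_le.1 h).le h'
    refine h₂.trans (le_of_mul_le_mul_left (h₁.trans (hmean.trans (le_of_eq ?_))) hb)
    field_simp

open Classical in
/-- If the seeds are good, then with probability at least `1 - 1 / 200` the estimates of the
clusters that have been sampled are centers of cost at most `(1 + ε) opt`. -/
theorem IsCentroidal.expect_estimate_le (hy : IsCentroidal n k x y) (hn : 0 < n) (hk : 0 < k)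
    (hL : L ≠ []) {ε : ℝ} (hε : 0 < ε) (hε' : ε ≤ 1 / 2) (hcost : seedCost n x L ≤ 32 * opt n x y)
    (hN : 6400 * k * totalImportance n x L ≤ N * sampleRate k ε * ε) :
    expect n (fun _ => sampleLaw n x L) N (fun l => if (∀ m ∈ l, m < n) →
      ∃ τ : E → E, (∀ c ∈ labels n y, ∃ m ∈ l, y m = τ c) ∧ ∑ i ∈ Finset.range n,
        ‖x i - estimate (importance n x L) x y l (τ (y i))‖ ^ 2 ≤ (1 + ε) * opt n x y
      then 0 else 1) [] ≤ 1 / 200 := by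
  have hW := totalImportance_pos (x := x) (L := L) hn
  have hk0 : (0 : ℝ) < k := by exact_mod_cast hk
  have hγ : 0 < sampleRate k ε := by unfold sampleRate; positivity
  have hN0 : 0 < N := by
    rw [Nat.pos_iff_ne_zero]
    rintro rfl
    have : 0 < 6400 * k * totalImportance n x L := by positivity
    simp only [Nat.cast_zero, zero_mul] at hN
    linarith
  have hN' : (0 : ℝ) < N := by exact_mod_cast hN0
  set γ := sampleRate k ε with hγdef
  set G : Finset E := {c ∈ labels n y | IsSampled n x y L γ c} with hG
  set bad₁ : E → List ℕ → ℝ := fun c l => if tolerance n x y L N c ≤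
      ‖(l.map (weightDeviation n x y L c)).sum‖ ^ 2 then 1 else 0 with hbad₁
  set bad₂ : List ℕ → ℝ := fun l => if ∑ c ∈ G, errorBound n x y L N l c ≤
    ε / (4 * k) * opt n x y then 0 else 1 with hbad₂
  have hbad₁0 : ∀ c l, 0 ≤ bad₁ c l := fun c l => by
    simp only [hbad₁]; split_ifs <;> norm_num
  have hbad₂0 : ∀ l, 0 ≤ bad₂ l := fun l => by
    simp only [hbad₂]; split_ifs <;> norm_num
  have hmain := expect_mono (n := n) (fun _ => sampleLaw_nonneg (x := x) (L := L) hn)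
    (F := fun l => if (∀ m ∈ l, m < n) →
      ∃ τ : E → E, (∀ c ∈ labels n y, ∃ m ∈ l, y m = τ c) ∧ ∑ i ∈ Finset.range n,
        ‖x i - estimate (importance n x L) x y l (τ (y i))‖ ^ 2 ≤ (1 + ε) * opt n x y
      then (0 : ℝ) else 1)
    (G := fun l => 1 * ∑ c ∈ G, bad₁ c l + 1 * bad₂ l) N [] (fun l hlen => by
      rw [List.length_nil, zero_add] at hlen
      rw [one_mul, one_mul]
      have hsum0 : 0 ≤ ∑ c ∈ G, bad₁ c l := Finset.sum_nonneg fun c _ => hbad₁0 c l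
      split_ifs with hsucc
      · exact add_nonneg hsum0 (hbad₂0 l)
      · by_contra! hlt
        apply hsucc
        intro hl
        have h₁ : ∀ c ∈ G, ‖(l.map (weightDeviation n x y L c)).sum‖ ^ 2 <
            tolerance n x y L N c := by
          intro c hc
          by_contra! hcon
          have : bad₁ c l ≤ ∑ c ∈ G, bad₁ c l :=
            Finset.single_le_sum (f := fun c => bad₁ c l) (fun c _ => hbad₁0 c l) hc
          simp only [hbad₁, if_pos hcon] at this
          have := hbad₂0 l
          linarith
        have h₂ : ∑ c ∈ G, errorBound n x y L N l c ≤ ε / (4 * k) * opt n x y := by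
          by_contra hcon
          have : bad₂ l = 1 := if_neg hcon
          linarith
        have h₃ : ∀ c ∈ G, (∃ m ∈ l, y m = c) ∧ (cluster n y c).card *
            ‖c - estimate (importance n x L) x y l c‖ ^ 2 ≤ errorBound n x y L N l c :=
          fun c hc => mul_norm_sub_estimate_sq_le hn hN0 hl hlen (Finset.mem_filter.1 hc).1 (h₁ c hc)
        obtain ⟨τ, hτ, hτcost⟩ := hy.exists_assignment hk hL hε hε' hcost
          (estimate (importance n x L) x y l)
          ((Finset.sum_le_sum fun c hc => (h₃ c hc).2).trans h₂)
        exact ⟨τ, fun c hc => (h₃ (τ c) (Finset.mem_filter.2 (hτ c hc))).1, hτcost⟩)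
  refine hmain.trans ?_
  rw [expect_linear, expect_finsetSum, one_mul, one_mul]
  have h₁ : ∑ c ∈ G, expect n (fun _ => sampleLaw n x L) N (bad₁ c) [] ≤ 1 / 400 := by
    have h : ∀ c ∈ G, expect n (fun _ => sampleLaw n x L) N (bad₁ c) [] ≤
        4 * totalImportance n x L / (N * γ) := fun c hc =>
      expect_tolerance_le hn hN0 hγ (Finset.mem_filter.1 hc).1 (Finset.mem_filter.1 hc).2
    refine (Finset.sum_le_sum h).trans ?_
    rw [Finset.sum_const, nsmul_eq_mul]
    have hcard : (G.card : ℝ) ≤ k := by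
      exact_mod_cast (Finset.card_filter_le _ _).trans hy.card_le
    calc (G.card : ℝ) * (4 * totalImportance n x L / (N * γ))
        ≤ k * (4 * totalImportance n x L / (N * γ)) :=
          mul_le_mul_of_nonneg_right hcard (by positivity)
      _ ≤ 1 / 400 := by
          rw [← mul_div_assoc, div_le_div_iff₀ (by positivity) (by norm_num)]
          have : N * γ * ε ≤ N * γ * 1 :=
            mul_le_mul_of_nonneg_left (by linarith) (by positivity)
          nlinarith [mul_pos hk0 hW]
  have h₂ : expect n (fun _ => sampleLaw n x L) N bad₂ [] ≤ 1 / 400 := by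
    refine (hy.expect_errorBound_le hn hN0 hγ (a := ε / (4 * k)) (by positivity)).trans ?_
    rw [div_le_div_iff₀ (by positivity) (by norm_num)]
    have : N * γ * (ε / (4 * k)) * (4 * k) = N * γ * ε := by field_simp
    have h₃ : 6400 * k * totalImportance n x L ≤ N * γ * (ε / (4 * k)) * (4 * k) := by
      rw [this]; exact hN
    have h₄ : 1600 * totalImportance n x L ≤ N * γ * (ε / (4 * k)) := by
      refine le_of_mul_le_mul_right (a := 4 * (k : ℝ)) ?_ (by positivity)
      linarith
    linarith
  linarith

end KMeans

set_option linter.unusedSectionVars false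

namespace KMeans

open RealRAM

/-! ### The probability of success -/

section Success

variable {E : Type*} [NormedAddCommGroup E] [InnerProductSpace ℝ E]
variable {n k : ℕ} {x y : ℕ → E} {ε : ℝ}

/-- The samples `l` with the seeds `L` yield centers of cost at most `(1 + ε) opt`: every cluster can
be assigned to the estimate of a cluster that has been sampled. Only lists of indices below `n`
matter. -/
def Succeeds (n : ℕ) (x y : ℕ → E) (ε : ℝ) (l L : List ℕ) : Prop :=
  (∀ m ∈ l, m < n) → ∃ τ : E → E, (∀ c ∈ labels n y, ∃ m ∈ l, y m = τ c) ∧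
    ∑ i ∈ Finset.range n, ‖x i - estimate (importance n x L) x y l (τ (y i))‖ ^ 2 ≤
      (1 + ε) * opt n x y

/-- The choice of the next sampled point, where `K` is the number of seeds and `h` is the list of
the points sampled so far. -/
noncomputable def nextSample (n : ℕ) (x : ℕ → E) (K : ℕ) (h : List ℕ) (u : unitInterval) : ℕ :=
  if h.length < K then sampleIdx (minDist (sqDist x) h) n u
  else sampleIdx (importance n x (h.drop (h.length - K))) n u

theorem process_nextSample_of_le {K t : ℕ} (ht : t ≤ K) (ω : ℕ → unitInterval) :
    process (nextSample n x K) ω t = seeds (sqDist x) n ω t := by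
  induction t with
  | zero => rfl
  | succ t ih =>
    rw [process, seeds, ih (by omega), nextSample, if_pos (by rw [length_seeds]; omega)]

theorem process_nextSample_add (K t : ℕ) (ω : ℕ → unitInterval) :
    process (nextSample n x K) ω (K + t) =
      samples (importance n x (seeds (sqDist x) n ω K)) n ω K t ++ seeds (sqDist x) n ω K := by
  induction t with
  | zero => simpa [samples] using process_nextSample_of_le le_rfl ω
  | succ t ih =>
    have hlen := length_process (nextSample n x K) ω (K + t)
    rw [← add_assoc, process, samples, List.cons_append, ← ih]
    congr 1
    rw [nextSample, if_neg (by omega), hlen, ih]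
    have hlen' : (samples (importance n x (seeds (sqDist x) n ω K)) n ω K t).length = t := by
      rw [ih, List.length_append, length_seeds] at hlen
      omega
    rw [List.drop_left' (by omega)]

theorem length_samples (v : ℕ → ℝ) (n : ℕ) (ω : ℕ → unitInterval) (K T : ℕ) :
    (samples v n ω K T).length = T := by
  induction T with
  | zero => rfl
  | succ T ih => simp [samples, ih]

theorem samples_lt {v : ℕ → ℝ} (hn : 0 < n) (ω : ℕ → unitInterval) (K T : ℕ) :
    ∀ m ∈ samples v n ω K T, m < n := by
  induction T with
  | zero => simp [samples]
  | succ T ih =>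
    intro m hm
    rcases List.mem_cons.1 hm with rfl | hm
    · exact pick_lt v hn _
    · exact ih m hm

/-- The algorithm fails with probability at most `1 / 100`. -/
theorem IsCentroidal.randomTape_not_succeeds_le (hy : IsCentroidal n k x y) (hn : 0 < n)
    (hk : 0 < k) (hε : 0 < ε) (hε' : ε ≤ 1 / 2) {K N : ℕ} (hK : 1600 * k ^ 2 ≤ K)
    (hN : 6400 * k * (K + 1) ≤ N * sampleRate k ε * ε) :
    randomTape {ω | ¬ Succeeds n x y ε
      (samples (importance n x (seeds (sqDist x) n ω K)) n ω K N) (seeds (sqDist x) n ω K)} ≤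
      1 / 100 := by
  classical
  have hk0 : (0 : ℝ) < k := by exact_mod_cast hk
  have hK0 : 0 < K := lt_of_lt_of_le (by positivity) hK
  have hK0' : (0 : ℝ) < K := by exact_mod_cast hK0
  set f := nextSample n x K with hf
  obtain ⟨B, hB⟩ : ∃ B : List ℕ → Prop, B = fun h => ¬ Succeeds n x y ε (h.take N) (h.drop N) :=
    ⟨_, rfl⟩
  have hset : {ω | ¬ Succeeds n x y ε
      (samples (importance n x (seeds (sqDist x) n ω K)) n ω K N) (seeds (sqDist x) n ω K)} =
      {ω | B (process f ω (K + N))} := by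
    ext ω
    simp only [Set.mem_ofPred_eq, hB, hf, process_nextSample_add]
    rw [List.take_left' (length_samples ..), List.drop_left' (length_samples ..)]
  have hmeas : ∀ h i, MeasurableSet {u | f h u = i} := by
    intro h i
    simp only [hf, nextSample]
    split_ifs
    · exact measurableSet_sampleIdx _ n i
    · exact measurableSet_sampleIdx _ n i
  have hlt : ∀ h u, f h u < n := by
    intro h u
    simp only [hf, nextSample]
    split_ifs
    · exact pick_lt _ hn _
    · exact pick_lt _ hn _
  set q : List ℕ → ℕ → ℝ := fun h i => volume.real {u | f h u = i} with hq
  have hq0 : ∀ h i, 0 ≤ q h i := fun h i => measureReal_nonneg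
  have hq1 : ∀ h, ∑ i ∈ Finset.range n, q h i = 1 := by
    intro h
    simp only [hq, hf, nextSample]
    split_ifs
    · exact sum_volume_sampleIdx _ hn
    · exact sum_volume_sampleIdx _ hn
  have hle1 : ∀ h, (if B h then (1 : ℝ) else 0) ≤ 1 := fun h => by split_ifs <;> norm_num
  -- the samples, given good seeds
  have hsecond : ∀ L : List ℕ, L.length = K →
      expect n q N (fun h => if B h then 1 else 0) L ≤
        1 * (if seedCost n x L ≤ 32 * opt n x y then 0 else 1) + 1 * (1 / 200) := by
    intro L hL
    have hL' : L ≠ [] := by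
      rintro rfl
      simp at hL
      omega
    split_ifs with hcost
    · have hqp : ∀ l, ∀ i < n, q (l ++ L) i = sampleLaw n x L i := by
        intro l i hi
        have : ∀ u, f (l ++ L) u = sampleIdx (importance n x L) n u := by
          intro u
          rw [hf, nextSample, if_neg (by rw [List.length_append]; omega),
            List.drop_left' (by rw [List.length_append]; omega)]
        simp only [hq, this]
        exact volume_sampleIdx_eq (fun i hi => (importance_pos hi).le) (sum_importance_pos hn) hi
      have h := expect_append hqp N (fun h => if B h then 1 else 0) []
      rw [List.nil_append] at h
      rw [h, mul_zero, zero_add, one_mul]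
      have hW : totalImportance n x L ≤ K + 1 := by
        rw [← hL]; exact sum_importance_le hL'
      refine le_trans (expect_mono (fun _ => sampleLaw_nonneg hn) N [] fun l hl => ?_)
        (hy.expect_estimate_le hn hk hL' hε hε' hcost (le_trans ?_ hN))
      · rw [List.length_nil, zero_add] at hl
        have hBl : B (l ++ L) ↔ ¬ Succeeds n x y ε l L := by
          simp only [hB]
          rw [List.take_left' hl, List.drop_left' hl]
        simp only [hBl, Succeeds]
        rw [ite_not]
      · exact mul_le_mul_of_nonneg_left hW (by positivity)
    · have := expect_mono (n := n) hq0 N L (F := fun h => if B h then 1 else 0) (G := fun _ => 1)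
        fun h _ => hle1 h
      rw [expect_const hq1] at this
      linarith
  -- the seeds
  have hfirst : expect n q K (fun L => if seedCost n x L ≤ 32 * opt n x y then 0 else 1) [] ≤
      4 * k ^ 2 / K := by
    rw [expect_congr (q' := fun h i =>
      volume.real {u : unitInterval | sampleIdx (minDist (sqDist x) h) n u = i}) K _ [] ?_]
    · exact hy.expect_seedCost_le hk (fun _ _ => measureReal_nonneg)
        (fun h => sum_volume_sampleIdx _ hn) hK0 fun h hpos i hi =>
          volume_sampleIdx_eq (fun j _ => minDist_sqDist_nonneg x h j) hpos hi
    · intro h hh i _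
      rw [List.length_nil, zero_add] at hh
      simp only [hq, hf, nextSample, if_pos hh]
  rw [hset]
  refine (randomTape_process_le hmeas hlt B (K + N)).trans ?_
  have hreal : expect n q (K + N) (fun h => if B h then 1 else 0) [] ≤ 1 / 100 := by
    rw [expect_add]
    refine (expect_mono hq0 K [] fun L hL => hsecond L (by simpa using hL)).trans ?_
    rw [expect_linear, expect_const hq1]
    have : 4 * (k : ℝ) ^ 2 / K ≤ 1 / 400 := by
      rw [div_le_div_iff₀ hK0' (by norm_num)]
      have : (1600 : ℝ) * k ^ 2 ≤ K := by exact_mod_cast hK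
      linarith
    linarith
  refine (ENNReal.ofReal_le_ofReal hreal).trans (le_of_eq ?_)
  rw [ENNReal.ofReal_div_of_pos (by norm_num)]
  simp

end Success

/-! ### Optimal clusterings -/

section Optimal

variable {d k : ℕ} {X : Finset (EuclideanSpace ℝ (Fin d))}

theorem cost_nonneg (C X : Finset (EuclideanSpace ℝ (Fin d))) : 0 ≤ cost C X :=
  Finset.sum_nonneg fun _ _ => Real.iInf_nonneg fun _ => by positivity

theorem cost_le_sum {C : Finset (EuclideanSpace ℝ (Fin d))}
    {f : EuclideanSpace ℝ (Fin d) → EuclideanSpace ℝ (Fin d)} (hf : ∀ z ∈ X, f z ∈ C) :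
    cost C X ≤ ∑ z ∈ X, ‖z - f z‖ ^ 2 := by
  refine Finset.sum_le_sum fun z hz => ?_
  exact ciInf_le (f := fun c : C => ‖z - (c : EuclideanSpace ℝ (Fin d))‖ ^ 2)
    ⟨0, by rintro _ ⟨c, rfl⟩; positivity⟩ ⟨f z, hf z hz⟩

/-- The optimal value is at most the cost of any assignment to at most `k` centers. -/
theorem optCost_le_sum (hd : 0 < d)
    {f : EuclideanSpace ℝ (Fin d) → EuclideanSpace ℝ (Fin d)}
    {C : Finset (EuclideanSpace ℝ (Fin d))} (hC : C.card ≤ k) (hf : ∀ z ∈ X, f z ∈ C) :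
    optCost k X ≤ ∑ z ∈ X, ‖z - f z‖ ^ 2 := by
  have : Infinite (EuclideanSpace ℝ (Fin d)) :=
    Infinite.of_injective (fun t : ℝ => EuclideanSpace.single (⟨0, hd⟩ : Fin d) t) fun s t h => by
      simpa using congrArg (fun v => v ⟨0, hd⟩) h
  obtain ⟨C', hsub, hcard⟩ := Infinite.exists_superset_card_eq C k hC
  refine le_trans (csInf_le ⟨0, ?_⟩ ⟨C', hcard, rfl⟩) (cost_le_sum fun z hz => hsub (hf z hz))
  rintro _ ⟨C, -, rfl⟩
  exact cost_nonneg C X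

variable {x : ℕ → EuclideanSpace ℝ (Fin d)}
  {cl : EuclideanSpace ℝ (Fin d) → EuclideanSpace ℝ (Fin d)}

theorem IsOptimalClustering.optCost_eq (h : IsOptimalClustering k X cl) (hk : 0 < k) :
    optCost k X = ∑ z ∈ X, ‖z - cl z‖ ^ 2 := by
  obtain ⟨C, hC, hcost, hcl⟩ := h
  rw [← hcost]
  refine le_antisymm (cost_le_sum fun z hz => (hcl z hz).1) (Finset.sum_le_sum fun z hz => ?_)
  have : Nonempty C := by
    obtain ⟨c, hc⟩ := Finset.card_pos.1 (hC.symm ▸ hk)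
    exact ⟨⟨c, hc⟩⟩
  exact le_ciInf fun c => pow_le_pow_left₀ (norm_nonneg _) ((hcl z hz).2 c c.2) 2

/-- The centers of an optimal clustering are the centroids of its clusters. -/
theorem IsOptimalClustering.isCentroidal {n : ℕ} (h : IsOptimalClustering k X cl) (hd : 0 < d)
    (hk : 0 < k)
    (hx : ∀ i < n, x i ∈ X)
    (hsum : ∀ f : EuclideanSpace ℝ (Fin d) → ℝ,
      ∑ z ∈ X, f z = ∑ i ∈ Finset.range n, f (x i)) :
    IsCentroidal n k x fun i => cl (x i) := by
  classical
  have hopt := h.optCost_eq hk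
  obtain ⟨C, hC, -, hcl⟩ := h
  set y : ℕ → EuclideanSpace ℝ (Fin d) := fun i => cl (x i) with hy
  refine ⟨?_, fun i hi j hj => (hcl _ (hx i hi)).2 _ (hcl _ (hx j hj)).1, ?_⟩
  · rw [← hC]
    refine Finset.card_le_card fun c hc => ?_
    obtain ⟨i, hi, rfl⟩ := mem_labels.1 hc
    exact (hcl _ (hx i hi)).1
  set mean : EuclideanSpace ℝ (Fin d) → EuclideanSpace ℝ (Fin d) := fun c =>
    ((cluster n y c).card : ℝ)⁻¹ • ∑ i ∈ cluster n y c, x i with hmean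
  -- moving the centers to the centroids does not pay off
  have hle : ∑ i ∈ Finset.range n, ‖x i - y i‖ ^ 2 ≤
      ∑ i ∈ Finset.range n, ‖x i - mean (y i)‖ ^ 2 := by
    rw [← hsum fun z => ‖z - cl z‖ ^ 2, ← hopt, ← hsum fun z => ‖z - mean (cl z)‖ ^ 2]
    exact optCost_le_sum hd (C := C.image mean) (Finset.card_image_le.trans hC.le)
      fun z hz => Finset.mem_image_of_mem _ (hcl z hz).1
  have hmean0 : ∀ c, ∑ i ∈ cluster n y c, (x i - mean c) = 0 := by
    intro c
    rcases (cluster n y c).eq_empty_or_nonempty with h0 | h0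
    · rw [h0, Finset.sum_empty]
    · have : ((cluster n y c).card : ℝ) ≠ 0 := by exact_mod_cast h0.card_pos.ne'
      rw [Finset.sum_sub_distrib, Finset.sum_const, ← Nat.cast_smul_eq_nsmul ℝ]
      simp only [hmean]
      rw [smul_smul, mul_inv_cancel₀ this, one_smul, sub_self]
  have hcluster : ∀ c, ∑ i ∈ cluster n y c, ‖x i - y i‖ ^ 2 =
      ∑ i ∈ cluster n y c, ‖x i - mean (y i)‖ ^ 2 +
        (cluster n y c).card * ‖mean c - c‖ ^ 2 := by
    intro c
    have h0 : ∑ i ∈ cluster n y c, inner ℝ (x i - mean c) (mean c - c) = 0 := by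
      rw [← sum_inner, hmean0 c, inner_zero_left]
    have h1 : ∀ i ∈ cluster n y c, ‖x i - y i‖ ^ 2 =
        ‖x i - mean (y i)‖ ^ 2 + 2 * inner ℝ (x i - mean c) (mean c - c) + ‖mean c - c‖ ^ 2 := by
      intro i hi
      rw [(mem_cluster.1 hi).2, ← norm_add_sq_real, sub_add_sub_cancel]
    rw [Finset.sum_congr rfl h1, Finset.sum_add_distrib, Finset.sum_add_distrib, ← Finset.mul_sum,
      h0, Finset.sum_const, nsmul_eq_mul]
    ring
  rw [sum_eq_sum_labels n y, sum_eq_sum_labels n y,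
    Finset.sum_congr rfl fun c _ => hcluster c, Finset.sum_add_distrib] at hle
  intro c
  by_cases hc : c ∈ labels n y
  · have h0 : (cluster n y c).card * ‖mean c - c‖ ^ 2 ≤
        ∑ c ∈ labels n y, (cluster n y c).card * ‖mean c - c‖ ^ 2 :=
      Finset.single_le_sum (f := fun c => ((cluster n y c).card : ℝ) * ‖mean c - c‖ ^ 2)
        (fun _ _ => by positivity) hc
    have hpos : (0 : ℝ) < (cluster n y c).card := by exact_mod_cast card_cluster_pos hc
    have h1 : ‖mean c - c‖ ^ 2 ≤ 0 := by nlinarith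
    have h2 : mean c = c := by
      rw [← sub_eq_zero, ← norm_eq_zero]
      exact pow_eq_zero_iff two_ne_zero |>.1 (le_antisymm h1 (by positivity))
    have := hmean0 c
    rwa [h2] at this
  · rw [Finset.sum_eq_zero]
    intro i hi
    exact absurd (mem_labels.2 ⟨i, (mem_cluster.1 hi)⟩) hc

end Optimal

end KMeans

namespace KMeans

open RealRAM

/-! ### Correctness of the algorithm -/

/-- The points whose coordinates are stored, point after point, in the array `a`. -/
noncomputable def storedPoint (d : ℕ) (a : ℕ → ℝ) (i : ℕ) : EuclideanSpace ℝ (Fin d) :=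
  WithLp.toLp 2 fun j : Fin d => a (i * d + j)

theorem arrDist_eq_sqDist (d : ℕ) (a : ℕ → ℝ) : arrDist d a = sqDist (storedPoint d a) := by
  funext i m
  rw [sqDist, EuclideanSpace.real_norm_sq_eq, arrDist,
    ← Fin.sum_univ_eq_sum_range
      (fun j => (a (i * d + j) - a (m * d + j)) * (a (i * d + j) - a (m * d + j)))]
  exact Finset.sum_congr rfl fun j _ => by simp [storedPoint, sq]

/-- The coordinates of the estimates are the quotients that the program computes. -/
theorem estimate_apply {d : ℕ} (a v : ℕ → ℝ) (y : ℕ → EuclideanSpace ℝ (Fin d)) (l : List ℕ)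
    (c : EuclideanSpace ℝ (Fin d)) (j : Fin d) :
    estimate v (storedPoint d a) y l c j =
      classSum v (fun m => a (m * d + j)) y l c / classSum v (fun _ => 1) y l c := by
  have h : vectorSum v (storedPoint d a) y l c j = classSum v (fun m => a (m * d + j)) y l c := by
    induction l with
    | nil => simp [vectorSum, classSum]
    | cons m l ih =>
      simp only [vectorSum, classSum, List.map_cons, List.sum_cons] at ih ⊢
      rw [PiLp.add_apply, ih]
      congr 1
      split_ifs
      · simp [storedPoint]
        ring
      · simp
  rw [estimate, PiLp.smul_apply, h, smul_eq_mul, div_eq_inv_mul]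

theorem numSeeds_eq (k : ℕ) : numSeeds k = 1600 * (k * k) := by
  rw [numSeeds]
  exact_mod_cast Nat.ceil_natCast (R := ℝ) (1600 * (k * k))

theorem le_numSamples (k : ℕ) (ε : ℝ) :
    200000000000 * (k : ℝ) ^ 5 / ε ^ 2 ≤ numSamples k ε := by
  refine le_trans (le_of_eq ?_) (Nat.le_ceil _)
  ring

theorem numSamples_le (k : ℕ) {ε : ℝ} (hε : 0 < ε) :
    (numSamples k ε : ℝ) ≤ 200000000000 * (k : ℝ) ^ 5 / ε ^ 2 + 1 := by
  refine (Nat.ceil_lt_add_one (by positivity)).le.trans (le_of_eq ?_)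
  ring

/-- The number of samples suffices for the accuracy of the estimates. It has the order `k⁵ / ε²`
because `sampleRate` has the order `ε / k²`, and the number of seeds has the order `k²`. -/
theorem seeds_le_samples {k : ℕ} (hk : 0 < k) {ε : ℝ} (hε : 0 < ε) :
    6400 * (k : ℝ) * ((numSeeds k : ℝ) + 1) ≤ numSamples k ε * sampleRate k ε * ε := by
  have hk1 : (1 : ℝ) ≤ k := by exact_mod_cast hk
  have hk0 : (0 : ℝ) < k := by linarith
  rw [numSeeds_eq]
  push_cast
  have h₁ : 200000000000 * (k : ℝ) ^ 5 / ε ^ 2 * sampleRate k ε * ε ≤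
      numSamples k ε * sampleRate k ε * ε := by
    have : 0 ≤ sampleRate k ε := by unfold sampleRate; positivity
    exact mul_le_mul_of_nonneg_right (mul_le_mul_of_nonneg_right (le_numSamples k ε) this) hε.le
  refine le_trans ?_ h₁
  have h₂ : 200000000000 * (k : ℝ) ^ 5 / ε ^ 2 * sampleRate k ε * ε =
      200000000000 / 12544 * (k : ℝ) ^ 3 := by
    unfold sampleRate
    field_simp
  have h₃ : (k : ℝ) ≤ k ^ 3 := le_self_pow₀ hk1 (by norm_num)
  rw [h₂]
  nlinarith

/-- The bounds for the numbers of seeds and of samples in terms of `k ^ 9 / ε ^ 4`. -/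
theorem size_bounds {k : ℕ} (hk : 0 < k) {ε : ℝ} (hε : 0 < ε) (hε' : ε ≤ 1 / 2) :
    1 ≤ (k : ℝ) ^ 9 / ε ^ 4 ∧ (numSeeds k : ℝ) ≤ 1600 * ((k : ℝ) ^ 9 / ε ^ 4) ∧
      (numSamples k ε : ℝ) * k ≤ 200000000001 * ((k : ℝ) ^ 9 / ε ^ 4) := by
  have hk1 : (1 : ℝ) ≤ k := by exact_mod_cast hk
  have hε1 : ε ≤ 1 := by linarith
  have h : ∀ i ≤ 9, ∀ j ≤ 4, (k : ℝ) ^ i / ε ^ j ≤ (k : ℝ) ^ 9 / ε ^ 4 := fun i hi j hj =>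
    div_le_div₀ (by positivity) (pow_le_pow_right₀ hk1 hi) (by positivity)
      (pow_le_pow_of_le_one hε.le hε1 hj)
  refine ⟨by simpa using h 0 (by norm_num) 0 (by norm_num), ?_, ?_⟩
  · rw [numSeeds_eq]
    have := h 2 (by norm_num) 0 (by norm_num)
    rw [pow_zero, div_one] at this
    push_cast
    linarith
  · have h₁ := h 6 (by norm_num) 2 (by norm_num)
    have h₂ := h 1 (by norm_num) 0 (by norm_num)
    rw [pow_zero, div_one, pow_one] at h₂
    have h₃ := mul_le_mul_of_nonneg_right (numSamples_le k hε) (by linarith : 0 ≤ (k : ℝ))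
    have h₄ : (200000000000 * (k : ℝ) ^ 5 / ε ^ 2 + 1) * k =
        200000000000 * ((k : ℝ) ^ 6 / ε ^ 2) + k := by ring
    linarith

/-- The running time of `clusterCode_spec`, with `K` seeds and `N` samples, in product form. -/
theorem time_le {n d k K N : ℕ} (hn : 0 < n) (hd : 0 < d) (hk : 0 < k) :
    K * 9 + N * 9 + n * 15 + K * (n * (d * 34 + 72) + 44) + n * 50 +
      N * (n * 32 + k * 18 + d * 28 + 73) + n * (d * 24 + 14) + 150 ≤
    n * d * (K * 159 + N * k * 160 + 253) := by
  have hnd : 1 ≤ n * d := Nat.mul_pos hn hd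
  have h₁ : n ≤ n * d := Nat.le_mul_of_pos_right n hd
  have h₂ : d ≤ n * d := Nat.le_mul_of_pos_left d hn
  have h₃ : n * d ≤ n * d * k := Nat.le_mul_of_pos_right _ hk
  have h₄ : k ≤ n * d * k := Nat.le_mul_of_pos_left k hnd
  have e₁ : 9 + (n * (d * 34 + 72) + 44) ≤ n * d * 159 := by
    have : n * (d * 34 + 72) = n * d * 34 + n * 72 := by ring
    omega
  have e₂ : 9 + (n * 32 + k * 18 + d * 28 + 73) ≤ n * d * k * 160 := by omega
  have e₃ : n * 15 + n * 50 + n * (d * 24 + 14) + 150 ≤ n * d * 253 := by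
    have : n * (d * 24 + 14) = n * d * 24 + n * 14 := by ring
    omega
  have e₄ := Nat.mul_le_mul_left K e₁
  have e₅ := Nat.mul_le_mul_left N e₂
  have h := add_le_add (add_le_add e₄ e₅) e₃
  have l : K * 9 + N * 9 + n * 15 + K * (n * (d * 34 + 72) + 44) + n * 50 +
      N * (n * 32 + k * 18 + d * 28 + 73) + n * (d * 24 + 14) + 150 =
      K * (9 + (n * (d * 34 + 72) + 44)) + N * (9 + (n * 32 + k * 18 + d * 28 + 73)) +
        (n * 15 + n * 50 + n * (d * 24 + 14) + 150) := by ring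
  have r : n * d * (K * 159 + N * k * 160 + 253) =
      K * (n * d * 159) + N * (n * d * k * 160) + n * d * 253 := by ring
  rw [l, r]
  exact h

/-- The program meets the bounds for the time and the queries on every random tape, and its output
is good enough with probability at least `99 / 100`. -/
theorem clusterCode_correct {n d k : ℕ} {ε : ℝ} {X : Finset (EuclideanSpace ℝ (Fin d))}
    (hd : 0 < d) (hk : 0 < k) (hε : 0 < ε) (hε' : ε ≤ 1 / 2) (hX : X.Nonempty)
    (p : Fin n ≃ X) {cl : EuclideanSpace ℝ (Fin d) → EuclideanSpace ℝ (Fin d)}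
    (hcl : IsOptimalClustering k X cl) :
    (∀ ω : ℕ → unitInterval, ∃ s : State,
      Runs ω (sameCluster (fun i => (p i : EuclideanSpace ℝ (Fin d))) cl) clusterCode
        (start (fun i => (p i : EuclideanSpace ℝ (Fin d))) k ε) s ∧
      (s.time : ℝ) ≤ 10 ^ 14 * ((n : ℝ) * (d : ℝ) * (k : ℝ) ^ 9 / ε ^ 4) ∧
      (s.queries : ℝ) ≤ 10 ^ 14 * ((k : ℝ) ^ 9 / ε ^ 4)) ∧
    randomTape {ω : ℕ → unitInterval | ∃ s : State,
      Runs ω (sameCluster (fun i => (p i : EuclideanSpace ℝ (Fin d))) cl) clusterCode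
        (start (fun i => (p i : EuclideanSpace ℝ (Fin d))) k ε) s ∧
      ¬ cost (output d k s) X ≤ (1 + ε) * optCost k X} ≤ 1 / 100 := by
  classical
  have hn : 0 < n := by
    obtain ⟨z, hz⟩ := hX
    exact (p.symm ⟨z, hz⟩).pos
  set P : Fin n → EuclideanSpace ℝ (Fin d) := fun i => (p i : EuclideanSpace ℝ (Fin d)) with hP
  set a : ℕ → ℝ := (start P k ε).realArr 0 with ha
  set x := storedPoint d a with hxdef
  set y : ℕ → EuclideanSpace ℝ (Fin d) := fun i => cl (x i) with hy
  have hxp : ∀ i (hi : i < n), x i = P ⟨i, hi⟩ := by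
    intro i hi
    ext j
    have hlt : i * d + j < d * n := by
      have := mul_add_lt_of_lt hi j.2
      rwa [mul_comm d n]
    have hdiv : (i * d + j) / d = i := by
      rw [mul_comm, Nat.mul_add_div hd, Nat.div_eq_of_lt j.2, add_zero]
    have hmod : (i * d + j) % d = j := by
      rw [mul_comm, Nat.mul_add_mod, Nat.mod_eq_of_lt j.2]
    simp only [hxdef, storedPoint, ha, start, true_and, dif_pos hlt, hdiv, hmod]
  have hsum : ∀ f : EuclideanSpace ℝ (Fin d) → ℝ,
      ∑ z ∈ X, f z = ∑ i ∈ Finset.range n, f (x i) := by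
    intro f
    rw [← Finset.sum_coe_sort, ← Equiv.sum_comp p, ← Fin.sum_univ_eq_sum_range]
    exact Finset.sum_congr rfl fun i _ => by rw [hxp i i.2]
  have hxX : ∀ i < n, x i ∈ X := fun i hi => by
    rw [hxp i hi]
    exact (p ⟨i, hi⟩).2
  have hcent : IsCentroidal n k x y := hcl.isCentroidal hd hk hxX hsum
  have hopt : optCost k X = opt n x y := by
    rw [hcl.optCost_eq hk, hsum fun z => ‖z - cl z‖ ^ 2]
    rfl
  have hO : ∀ i < n, ∀ j < n, (sameCluster P cl i j ↔ y i = y j) := by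
    intro i hi j hj
    simp only [sameCluster, hy, hxp i hi, hxp j hj]
    exact ⟨fun ⟨_, _, h⟩ => h, fun h => ⟨hi, hj, h⟩⟩
  set K := numSeeds k with hK
  set N := numSamples k ε with hN
  have hrun : ∀ ω, ∃ s, Runs ω (sameCluster P cl) clusterCode (start P k ε) s ∧ _ := fun ω =>
    clusterCode_spec (ω := ω) (K := K) (N := N) (a := a) (D := arrDist d a) (ε := ε) (n := n)
      (d := d) (k := k) (v := weight (arrDist d a) n (seeds (arrDist d a) n ω K)) hO
      (le_trans (le_of_eq (by congr)) hcent.card_le) hn rfl rfl rfl rfl rfl rfl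
      (fun b t hb => by simp [start, hb]) (fun b t => rfl) rfl hK hN rfl rfl
  rw [arrDist_eq_sqDist] at hrun
  refine ⟨fun ω => ?_, ?_⟩
  · obtain ⟨s, hs, -, ht, hq⟩ := hrun ω
    obtain ⟨h₁, h₂, h₃⟩ := size_bounds hk hε hε'
    refine ⟨s, hs, ?_, ?_⟩
    · have ht' := ht.trans (Nat.add_le_add_left (time_le (K := K) (N := N) hn hd hk) _)
      have ht'' : (s.time : ℝ) ≤ n * d * (K * 159 + N * k * 160 + 253) := by
        have : (start P k ε).time = 0 := rfl
        rw [this, zero_add] at ht'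
        exact_mod_cast ht'
      refine ht''.trans ?_
      have e : (10 : ℝ) ^ 14 * ((n : ℝ) * d * (k : ℝ) ^ 9 / ε ^ 4) =
          n * d * (10 ^ 14 * ((k : ℝ) ^ 9 / ε ^ 4)) := by ring
      rw [e]
      refine mul_le_mul_of_nonneg_left ?_ (by positivity)
      linarith
    · have hq' : (s.queries : ℝ) ≤ N * k := by
        have : (start P k ε).queries = 0 := rfl
        rw [this, zero_add] at hq
        exact_mod_cast hq
      linarith
  · refine le_trans (measure_mono fun ω hω => ?_)
      (hcent.randomTape_not_succeeds_le (K := K) (N := N) hn hk hε hε' ?_ (seeds_le_samples hk hε))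
    · obtain ⟨s, hs, hcost⟩ := hω
      obtain ⟨s', hs', hout, -⟩ := hrun ω
      obtain rfl := hs.deterministic hs'
      intro hsucc
      apply hcost
      obtain ⟨τ, hτ, hτcost⟩ := hsucc (samples_lt hn ω K N)
      rw [hopt]
      refine le_trans ?_ hτcost
      have hmem : ∀ z ∈ X, estimate (importance n x (seeds (sqDist x) n ω K)) x y
          (samples (importance n x (seeds (sqDist x) n ω K)) n ω K N) (τ (cl z)) ∈
          output d k s := by
        intro z hz
        obtain ⟨i, hi⟩ := p.surjective ⟨z, hz⟩
        have hzi : x i = z := by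
          rw [hxp i i.2]
          simp only [hP]
          rw [hi]
        obtain ⟨m, hm, hym⟩ := hτ (cl z) (mem_labels.2 ⟨i, i.2, by rw [← hzi]⟩)
        obtain ⟨r, hr, hrj⟩ := hout m hm
        refine Finset.mem_image.2 ⟨⟨r, hr⟩, Finset.mem_univ _, ?_⟩
        ext j
        rw [← hym]
        exact (hrj j j.2).trans (estimate_apply a _ y _ _ j).symm
      refine (cost_le_sum hmem).trans (le_of_eq ?_)
      rw [hsum fun z => ‖z - estimate (importance n x (seeds (sqDist x) n ω K)) x y
          (samples (importance n x (seeds (sqDist x) n ω K)) n ω K N) (τ (cl z))‖ ^ 2]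
    · rw [hK, numSeeds_eq]
      exact le_of_eq (by ring)

end KMeans

theorem mainTheorem1 :
    ∃ (A : RealRAM.Program) (c : ℝ),
      ∀ (d k : ℕ) (ε : ℝ) (X : Finset (EuclideanSpace ℝ (Fin d))),
        0 < d → 0 < k → 0 < ε → ε ≤ 1 / 2 → X.Nonempty →
        ∀ (p : Fin X.card ≃ X)
          (cl : EuclideanSpace ℝ (Fin d) → EuclideanSpace ℝ (Fin d)),
          KMeans.IsOptimalClustering k X cl →
          (∀ ω : ℕ → unitInterval, ∃ s : RealRAM.State,
            RealRAM.Runs ω (KMeans.sameCluster (fun i => (p i : EuclideanSpace ℝ (Fin d))) cl) A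
              (KMeans.start (fun i => (p i : EuclideanSpace ℝ (Fin d))) k ε) s ∧
            (s.time : ℝ) ≤ c * ((X.card : ℝ) * (d : ℝ) * (k : ℝ) ^ 9 / ε ^ 4) ∧
            (s.queries : ℝ) ≤ c * ((k : ℝ) ^ 9 / ε ^ 4)) ∧
          RealRAM.randomTape {ω : ℕ → unitInterval | ∃ s : RealRAM.State,
            RealRAM.Runs ω (KMeans.sameCluster (fun i => (p i : EuclideanSpace ℝ (Fin d))) cl) A
              (KMeans.start (fun i => (p i : EuclideanSpace ℝ (Fin d))) k ε) s ∧
            ¬ KMeans.cost (KMeans.output d k s) X ≤ (1 + ε) * KMeans.optCost k X} ≤ 1 / 100 := by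
  refine ⟨KMeans.clusterCode, 10 ^ 14, fun d k ε X hd hk hε hε' hX p cl hcl => ?_⟩
  exact KMeans.clusterCode_correct hd hk hε hε' hX p hcl
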